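/- **Setting.** Signatures are order-sorted (poset of sorts $S$; the many-sorted case is that of a discrete order), with countably many sorts and symbols and countably many variables of each sort; all sorts have ground terms. A *rewrite theory* $(\Sigma,B,R)$ has regular and linear axioms $B$ and rules $l\to r$ with $l$ not a variable and $\mathrm{vars}(r)\subseteq \mathrm{vars}(l)$ (axioms sort-preserving, rules sort-decreasing, which is automatic in the many-sorted case); $t\to_{R,B}t'$ if $t|_q=_B l\sigma$ and $t'=t[r\sigma]_q$ for a rule $l\to r$, a substitution $\sigma$ and a position $q$. It is a *decomposition* of $(\Sigma,E)$, where $E$ consists of $B$ and the rules read as equations, if $\to_{R,B}$ is terminating, confluent modulo $B$ and strictly $B$-coherent. $t!_{R,B}$ is the normal form, and $\mathcal C_{\mathcal R}$ the canonical term algebra, whose elements of sort $s$ are the classes $[t!_{R,B}]_B$ of the ground terms $t$ of sort $s$, with $f([u_1]_B,\dots,[u_n]_B)=[f(u_1,\dots,u_n)!_{R,B}]_B$. A *variant* of $t$ is a pair $(u,\theta)$ with $\theta$ a normalized substitution, $\mathrm{dom}(\theta)\subseteq \mathrm{vars}(t)$, $u=_B(t\theta)!_{R,B}$; a set of variants of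 $t$ is *complete* if every variant $(v,\gamma)$ of $t$ satisfies $v=_B u\rho$, $\gamma=_B(\theta\rho)|_{\mathrm{vars}(t)}$ for some $(u,\theta)$ in the set and some $\rho$; $\mathcal R$ is *FVP* if every term has a finite complete set of variants. $\mathcal R$ *protects* a decomposition $\mathcal R_0=(\Sigma_0,B_0,R_0)\subseteq\mathcal R$ if on $\Sigma_0$-terms $=_{B_0}$ and $=_B$ agree, being in $R_0,B_0$-normal form and in $R,B$-normal form agree, and $\mathcal C_{\mathcal R_0}=\mathcal C_{\mathcal R}|_{\Sigma_0}$. If $\mathcal R_0$ has the same sorts it is a *constructor decomposition* of $\mathcal R$. $(\Sigma,E)$ is *OS-compact* if (i) it is decidable which sorts $s$ are finite in the initial algebra $T_{\Sigma/E}$, and for these a finite list of ground representatives of the elements is computable; (ii) $=_E$ is decidable and there is a finitary (computable) $E$-unification algorithm; (iii) every finite conjunction of disequalities $u_i\neq v_i$ with $u_i\neq_E v_i$, all of whose variables have infinite sorts, is satisfiable in $T_{\Sigma/E}$. **Hypotheses.** Let $\mathcal R=(\Delta\uplus\Omega_c\uplus\Omega_\Pi,\;B_\Delta\uplus B_{\Omega_c},\;R_\Delta\uplus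 R_{\Omega_c}\uplus R_\Pi)$ be an FVP decomposition that protects the decomposition $\mathcal R_\Omega=(\Omega_c\uplus\Omega_\Pi,B_{\Omega_c},R_{\Omega_c}\uplus R_\Pi)$. Write $\Sigma,B,R$ for its components. There is a sort $\mathit{Pred}$, incomparable to the other sorts and not an argument sort of any symbol, with a constant $\mathit{tt}\in\Omega_c$. Assume: 1. every $p\in\Omega_\Pi$ has result sort $\mathit{Pred}$, and every rule in $R_\Pi$ has the form $p(u_1,\dots,u_n)\to \mathit{tt}$ with $p\in\Omega_\Pi$; $B$ has a finitary (computable) unification algorithm, and $B_\Delta$ consists of equations between non-variable $\Delta$-terms; 2. $\mathcal R_{\Omega_c}=(\Omega_c,B_{\Omega_c},R_{\Omega_c})$ is OS-compact, and is a constructor decomposition of the decomposition $(\Delta\uplus\Omega_c,B_\Delta\uplus B_{\Omega_c},R_\Delta\uplus R_{\Omega_c})$; 3. each $p\in\Omega_\Pi$ has a finite list of negative constrained patterns $\bigwedge_l w^j_l\neq w'^j_l\Rightarrow p(v^j_1,\dots,v^j_n)\neq \mathit{tt}$, $1\le j\le m_p$, with $v^j_i,w^j_l,w'^j_l$ $\Omega_c$-terms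 whose variables are in $Y_j=\mathrm{vars}(p(v^j_1,\dots,v^j_n))$, such that, for $\rho_j$ ranging over the normalized substitutions from $Y_j$ to ground $\Omega_c$-terms and all ground terms $p(t_1,\dots,t_n)$: $[p(v^j_1,\dots,v^j_n)\rho_j]_B\in\mathcal C_{\mathcal R}$ iff $w^j_l\rho_j\neq_E w'^j_l\rho_j$ for all $l$; and $[p(t_1,\dots,t_n)]_B\in\mathcal C_{\mathcal R}$ iff there are $j$ and $\rho_j$ with $[p(t_1,\dots,t_n)]_B=[p(v^j_1,\dots,v^j_n)\rho_j]_B$ and $w^j_l\rho_j\neq_E w'^j_l\rho_j$ for all $l$. **Procedure.** The input is a quantifier-free formula $\varphi$ whose atoms are $(\Delta\uplus\Omega_c)$-equations without variables of sort $\mathit{Pred}$ and predicate atoms $p(t_1,\dots,t_n)=\mathit{tt}$ with $p\in\Omega_\Pi$. Put $\varphi$ in disjunctive normal form and apply the following steps to each disjunct $\bigwedge G\wedge\bigwedge D$ ($G$ equations, $D$ disequalities); conjunctions that a sound test recognizes as unsatisfiable may be discarded in Steps 1 and 2. *Step 1.* Replace the disjunct by the conjunctions $(\bigwedge D\alpha)!_{R,B}$,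 for $\alpha$ in a finite set of $E$-unifiers of $G$ away from the variables $W$ of the disjunct, such that every normalized $E$-unifier of $G$ is on $W$ $B$-equal to $\alpha\rho$ for some such $\alpha$ and some normalized $\rho$. *Step 2.* While there is a disequality $p(t_1,\dots,t_n)\neq \mathit{tt}$ with $p\in\Omega_\Pi$ in a conjunction $\bigwedge D_1\wedge p(t_1,\dots,t_n)\neq \mathit{tt}\wedge\bigwedge D_2$, replace the conjunction by all $(\bigwedge D_1\wedge\bigwedge_l w^j_l\neq w'^j_l\wedge\bigwedge D_2)\theta\alpha$, where $(p(t'_1,\dots,t'_n),\theta)$ is a constructor variant (one that is a term in $\Omega_c\uplus\Omega_\Pi$) in a finite complete set of variants of $p(t_1,\dots,t_n)$ away from the variables of the conjunction, $1\le j\le m_p$, and $\alpha$ is in a finite complete set of $B_{\Omega_c}$-unifiers of $p(t'_1,\dots,t'_n)=p(v^j_1,\dots,v^j_n)$, the pattern being renamed apart and $\alpha$ being away from all variables in use. *Step 3.* For the resulting $\bigwedge D'$, take a finite complete set of variants of $\bigwedge D'$ (viewed as a term), and its members $(\bigwedge D'',\gamma)$ with $D''$ consisting of $\Omega_c$-terms.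 Answer "satisfiable" if, for one of these, for a choice $\tau$ of canonical representatives for the variables of $D''$ whose sorts are finite in $\mathcal R_{\Omega_c}$, $\bigwedge D''\tau$ is normalized and has $u\tau\neq_{B_{\Omega_c}}v\tau$ for each of its disequalities. If this happens for none of the conjunctions, answer "unsatisfiable". **Theorem.** (a) The finite complete sets, normal forms, representatives and tests that the procedure calls for exist. (b) For every choice of subroutines that supply them, and for every $\varphi$ as above, the procedure terminates; Step 2 ends, after as many rounds as there are disequalities $p(\dots)\neq \mathit{tt}$, with $(\Delta\uplus\Omega_c)$-conjunctions; and the answer is "satisfiable" if and only if $\varphi$ is satisfiable in $\mathcal C_{\mathcal R}$. (c) If the subroutines, the partition of the symbols and the assignment of the patterns to the predicates are computable, then the procedure is a computable function, so that it decides satisfiability of these formulas in $\mathcal C_{\mathcal R}$. -/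

import Mathlib

namespace VarSat

/-! ## Terms -/

/-- First-order terms with variables in `V` and function symbols in `F`. -/
inductive Term (V F : Type) : Type where
  | var (x : V) : Term V F
  | app (f : F) (ts : List (Term V F)) : Term V F

namespace Term
variable {V F : Type}

/-- The list of occurrences of variables. -/
def vars : Term V F → List V
  | .var x => [x]
  | .app _ ts => ts.flatMap vars

/-- The list of occurrences of function symbols. -/
def syms : Term V F → List F
  | .var _ => []
  | .app f ts => f :: ts.flatMap syms

/-- Homomorphic extension of a substitution. -/
def subst (σ : V → Term V F) : Term V F → Term V F
  | .var x => σ x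
  | .app f ts => .app f (ts.map (subst σ))

/-- Ground terms are the terms without variables. -/
def Ground (t : Term V F) : Prop := t.vars = []

/-- Polish notation: an application is written as its symbol, with the number of arguments,
followed by its arguments. -/
def toks : Term V F → List (V ⊕ F × ℕ)
  | .var x => [.inl x]
  | .app f ts => .inr (f, ts.length) :: ts.flatMap toks

theorem induct {P : Term V F → Prop} (hv : ∀ x, P (.var x))
    (ha : ∀ f ts, (∀ t ∈ ts, P t) → P (.app f ts)) : ∀ t, P t
  | .var x => hv x
  | .app f ts => ha f ts fun t _ => induct hv ha t

/-- One step of reading Polish notation from the right. -/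
def parseTok (k : V ⊕ F × ℕ) (st : Option (List (Term V F))) : Option (List (Term V F)) :=
  st.bind fun l =>
    match k with
    | .inl x => some (.var x :: l)
    | .inr (f, n) => if n ≤ l.length then some (.app f (l.take n) :: l.drop n) else none

/-- The same step, on the number of terms that have been read. -/
def countTok (k : V ⊕ F × ℕ) (st : Option ℕ) : Option ℕ :=
  st.bind fun m =>
    match k with
    | .inl _ => some (m + 1)
    | .inr (_, n) => if n ≤ m then some (m - n + 1) else none

/-- A list of tokens is the Polish notation of a term. -/
def Valid (l : List (V ⊕ F × ℕ)) : Prop := l.foldr countTok (some 0) = some 1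

instance : DecidablePred (Valid (V := V) (F := F)) := fun _ => by unfold Valid; infer_instance

theorem parse_toks (t : Term V F) (st : List (Term V F)) :
    t.toks.foldr parseTok (some st) = some (t :: st) := by
  induction t using induct generalizing st with
  | hv x => simp [toks, parseTok]
  | ha f ts ih =>
    have h : ∀ us : List (Term V F), (∀ t ∈ us, t ∈ ts) → ∀ st,
        (us.flatMap toks).foldr parseTok (some st) = some (us ++ st) := by
      intro us
      induction us with
      | nil => simp
      | cons u us ihu =>
        intro hu st
        rw [List.flatMap_cons, List.foldr_append, ihu (fun t ht => hu t (by simp [ht])),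
          ih u (hu u (by simp))]
        simp
    rw [toks, List.foldr_cons, h ts (fun _ h => h)]
    simp [parseTok]

theorem count_eq (l : List (V ⊕ F × ℕ)) :
    l.foldr countTok (some 0) = (l.foldr parseTok (some [])).map List.length := by
  induction l with
  | nil => simp
  | cons k l ih =>
    rw [List.foldr_cons, List.foldr_cons, ih]
    cases l.foldr parseTok (some []) with
    | none => simp [countTok, parseTok]
    | some st =>
      rcases k with x | ⟨f, n⟩
      · simp [countTok, parseTok]
      · by_cases h : n ≤ st.length <;> simp [countTok, parseTok, h]

theorem toks_parse (l : List (V ⊕ F × ℕ)) (st : List (Term V F))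
    (h : l.foldr parseTok (some []) = some st) : st.flatMap toks = l := by
  induction l generalizing st with
  | nil => simp at h; subst h; rfl
  | cons k l ih =>
    rw [List.foldr_cons] at h
    cases hl : l.foldr parseTok (some []) with
    | none => rw [hl] at h; simp [parseTok] at h
    | some st' =>
      rw [hl] at h
      have ih := ih st' hl
      rcases k with x | ⟨f, n⟩
      · simp only [parseTok, Option.bind_some, Option.some.injEq] at h
        subst h
        simp [toks, ih]
      · by_cases hn : n ≤ st'.length
        · simp only [parseTok, Option.bind_some, hn, if_true, Option.some.injEq] at h
          subst h
          rw [List.flatMap_cons, toks, ← ih]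
          conv_rhs => rw [← List.take_append_drop n st', List.flatMap_append]
          simp [hn]
        · simp [parseTok, hn] at h

theorem valid_toks (t : Term V F) : Valid t.toks := by
  unfold Valid; rw [count_eq, parse_toks]; rfl

/-- Terms are the same as valid lists of tokens. -/
def equivToks : Term V F ≃ {l : List (V ⊕ F × ℕ) // Valid l} where
  toFun t := ⟨t.toks, t.valid_toks⟩
  invFun l :=
    match h : l.1.foldr parseTok (some []) with
    | some (t :: _) => t
    | some [] => absurd l.2 (by unfold Valid; rw [count_eq, h]; simp)
    | none => absurd l.2 (by unfold Valid; rw [count_eq, h]; simp)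
  left_inv t := by
    have h := parse_toks t []
    dsimp only
    split
    · rename_i h'; rw [h] at h'; simp at h'; exact h'.1.symm
    · rename_i h'; rw [h] at h'; simp at h'
    · rename_i h'; rw [h] at h'; simp at h'
  right_inv l := by
    apply Subtype.ext
    dsimp only
    have hv := l.2
    unfold Valid at hv
    rw [count_eq] at hv
    split
    · rename_i t r h
      rw [h] at hv
      simp at hv
      subst hv
      simpa using toks_parse _ _ h
    · rename_i h; rw [h] at hv; simp at hv
    · rename_i h; rw [h] at hv; simp at hv

theorem primrecPred_valid [Primcodable V] [Primcodable F] :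
    PrimrecPred (Valid (V := V) (F := F)) := by
  unfold Valid
  have h : Primrec₂ fun (a : (List (V ⊕ F × ℕ)) × (V ⊕ F × ℕ) × Option ℕ) (m : ℕ) =>
      (Sum.casesOn a.2.1 (fun _ => some (m + 1))
        (fun p => if p.2 ≤ m then some (m - p.2 + 1) else none) : Option ℕ) := by
    refine Primrec.sumCasesOn (Primrec.fst.comp (Primrec.snd.comp Primrec.fst)) ?_ ?_
    · exact Primrec.option_some.comp (Primrec.succ.comp (Primrec.snd.comp Primrec.fst))
    · have hn : Primrec fun q : (((List (V ⊕ F × ℕ)) × (V ⊕ F × ℕ) × Option ℕ) × ℕ) × (F × ℕ) =>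
        q.2.2 := Primrec.snd.comp Primrec.snd
      have hm : Primrec fun q : (((List (V ⊕ F × ℕ)) × (V ⊕ F × ℕ) × Option ℕ) × ℕ) × (F × ℕ) =>
        q.1.2 := Primrec.snd.comp Primrec.fst
      exact Primrec.ite (PrimrecRel.comp Primrec.nat_le hn hm)
        (Primrec.option_some.comp (Primrec.succ.comp (Primrec.nat_sub.comp hm hn)))
        (Primrec.const _)
  have h0 : Primrec fun a : (List (V ⊕ F × ℕ)) × (V ⊕ F × ℕ) × Option ℕ => a.2.2 :=
    Primrec.snd.comp Primrec.snd
  have h1 : Primrec₂ fun (_ : List (V ⊕ F × ℕ)) (q : (V ⊕ F × ℕ) × Option ℕ) => countTok q.1 q.2 := by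
    refine (Primrec.option_bind h0 h).of_eq ?_
    rintro ⟨a, k, st⟩
    cases st with
    | none => rfl
    | some m => rcases k with x | ⟨f, n⟩ <;> rfl
  exact PrimrecRel.comp Primrec.eq (Primrec.list_foldr Primrec.id (Primrec.const _) h1)
    (Primrec.const _)

/-- Terms are coded by their Polish notation. -/
instance [Primcodable V] [Primcodable F] : Primcodable (Term V F) :=
  letI := Primcodable.subtype (primrecPred_valid (V := V) (F := F))
  Primcodable.ofEquiv {l : List (V ⊕ F × ℕ) // Valid l} equivToks

end Term

/-! ## Quantifier-free formulas -/

/-- Quantifier-free formulas whose atoms are equations `u = v`, given as pairs `(u, v)` in `A`. -/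
inductive QF (A : Type) : Type where
  | eq (e : A) : QF A
  | neg (φ : QF A) : QF A
  | and (φ ψ : QF A) : QF A
  | or (φ ψ : QF A) : QF A

namespace QF
variable {A : Type}

/-- Polish notation: `none` stands for `neg`, `some true` for `and`, `some false` for `or`. -/
def toks : QF A → List (A ⊕ Option Bool)
  | .eq e => [.inl e]
  | .neg φ => .inr none :: φ.toks
  | .and φ ψ => .inr (some true) :: (φ.toks ++ ψ.toks)
  | .or φ ψ => .inr (some false) :: (φ.toks ++ ψ.toks)

/-- One step of reading Polish notation from the right. -/
def parseTok : A ⊕ Option Bool → List (QF A) → Option (List (QF A))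
  | .inl e, l => some (.eq e :: l)
  | .inr none, φ :: l => some (.neg φ :: l)
  | .inr (some true), φ :: ψ :: l => some (.and φ ψ :: l)
  | .inr (some false), φ :: ψ :: l => some (.or φ ψ :: l)
  | .inr _, _ => none

/-- The number of subformulas that a connective takes. -/
def arity (c : Option Bool) : ℕ := if c = none then 1 else 2

/-- The same step, on the number of formulas that have been read. -/
def countTok (k : A ⊕ Option Bool) (st : Option ℕ) : Option ℕ :=
  st.bind fun m =>
    match k with
    | .inl _ => some (m + 1)
    | .inr c => if arity c ≤ m then some (m - arity c + 1) else none

/-- A list of tokens is the Polish notation of a formula. -/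
def Valid (l : List (A ⊕ Option Bool)) : Prop := l.foldr countTok (some 0) = some 1

instance : DecidablePred (Valid (A := A)) := fun _ => by unfold Valid; infer_instance

/-- Reading Polish notation from the right. -/
def parse (l : List (A ⊕ Option Bool)) (st : List (QF A)) : Option (List (QF A)) :=
  l.foldr (fun k o => o.bind (parseTok k)) (some st)

theorem foldr_toks (φ : QF A) (st : List (QF A)) :
    φ.toks.foldr (fun k o => o.bind (parseTok k)) (some st) = some (φ :: st) := by
  induction φ generalizing st with
  | eq e => simp [toks, parseTok]
  | neg φ ih => simp [toks, ih, parseTok]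
  | and φ ψ ih1 ih2 => simp [toks, ih1, ih2, parseTok]
  | or φ ψ ih1 ih2 => simp [toks, ih1, ih2, parseTok]

theorem parse_toks (φ : QF A) (st : List (QF A)) : parse φ.toks st = some (φ :: st) :=
  foldr_toks φ st

theorem count_eq (l : List (A ⊕ Option Bool)) :
    l.foldr countTok (some 0) = (parse l []).map List.length := by
  induction l with
  | nil => simp [parse]
  | cons k l ih =>
    have hp : parse (k :: l) [] = (parse l []).bind (parseTok k) := rfl
    rw [List.foldr_cons, ih, hp]
    cases parse l [] with
    | none => simp [countTok]
    | some st =>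
      rcases k with x | _ | _ | _ <;> rcases st with _ | ⟨a, _ | ⟨b, st⟩⟩ <;>
        simp [countTok, parseTok, arity]

theorem toks_parse (l : List (A ⊕ Option Bool)) (st : List (QF A))
    (h : parse l [] = some st) : st.flatMap toks = l := by
  induction l generalizing st with
  | nil => simp [parse] at h; subst h; rfl
  | cons k l ih =>
    rw [parse, List.foldr_cons, ← parse] at h
    cases hl : parse l [] with
    | none => rw [hl] at h; simp at h
    | some st' =>
      rw [hl] at h
      have ih := ih st' hl
      rcases k with x | _ | _ | _ <;> rcases st' with _ | ⟨a, _ | ⟨b, st'⟩⟩ <;>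
        simp [parseTok] at h <;> subst h <;> simp_all [toks]

theorem valid_toks (φ : QF A) : Valid φ.toks := by
  unfold Valid; rw [count_eq, parse_toks]; rfl

/-- Formulas are the same as valid lists of tokens. -/
def equivToks : QF A ≃ {l : List (A ⊕ Option Bool) // Valid l} where
  toFun φ := ⟨φ.toks, φ.valid_toks⟩
  invFun l :=
    match h : parse l.1 [] with
    | some (t :: _) => t
    | some [] => absurd l.2 (by unfold Valid; rw [count_eq, h]; simp)
    | none => absurd l.2 (by unfold Valid; rw [count_eq, h]; simp)
  left_inv t := by
    have h := parse_toks t []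
    dsimp only
    split
    · rename_i h'; rw [h] at h'; simp at h'; exact h'.1.symm
    · rename_i h'; rw [h] at h'; simp at h'
    · rename_i h'; rw [h] at h'; simp at h'
  right_inv l := by
    apply Subtype.ext
    dsimp only
    have hv := l.2
    unfold Valid at hv
    rw [count_eq] at hv
    split
    · rename_i t r h
      rw [h] at hv
      simp at hv
      subst hv
      simpa using toks_parse _ _ h
    · rename_i h; rw [h] at hv; simp at hv
    · rename_i h; rw [h] at hv; simp at hv

theorem primrecPred_valid [Primcodable A] : PrimrecPred (Valid (A := A)) := by
  unfold Valid
  have ha : Primrec arity :=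
    Primrec.ite (PrimrecRel.comp Primrec.eq Primrec.id (Primrec.const _))
      (Primrec.const _) (Primrec.const _)
  have h : Primrec₂ fun (a : (List (A ⊕ Option Bool)) × (A ⊕ Option Bool) × Option ℕ) (m : ℕ) =>
      (Sum.casesOn a.2.1 (fun _ => some (m + 1))
        (fun c => if arity c ≤ m then some (m - arity c + 1) else none) : Option ℕ) := by
    refine Primrec.sumCasesOn (Primrec.fst.comp (Primrec.snd.comp Primrec.fst)) ?_ ?_
    · exact Primrec.option_some.comp (Primrec.succ.comp (Primrec.snd.comp Primrec.fst))
    · have hn : Primrec fun q : (((List (A ⊕ Option Bool)) × (A ⊕ Option Bool) × Option ℕ) × ℕ) ×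
        Option Bool => arity q.2 := ha.comp Primrec.snd
      have hm : Primrec fun q : (((List (A ⊕ Option Bool)) × (A ⊕ Option Bool) × Option ℕ) × ℕ) ×
        Option Bool => q.1.2 := Primrec.snd.comp Primrec.fst
      exact Primrec.ite (PrimrecRel.comp Primrec.nat_le hn hm)
        (Primrec.option_some.comp (Primrec.succ.comp (Primrec.nat_sub.comp hm hn)))
        (Primrec.const _)
  have h0 : Primrec fun a : (List (A ⊕ Option Bool)) × (A ⊕ Option Bool) × Option ℕ => a.2.2 :=
    Primrec.snd.comp Primrec.snd
  have h1 : Primrec₂ fun (_ : List (A ⊕ Option Bool)) (q : (A ⊕ Option Bool) × Option ℕ) => countTok q.1 q.2 := by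
    refine (Primrec.option_bind h0 h).of_eq ?_
    rintro ⟨a, k, st⟩
    cases st with
    | none => rfl
    | some m => rcases k with x | c <;> rfl
  exact PrimrecRel.comp Primrec.eq (Primrec.list_foldr Primrec.id (Primrec.const _) h1)
    (Primrec.const _)

/-- Formulas are coded by their Polish notation. -/
instance [Primcodable A] : Primcodable (QF A) :=
  letI := Primcodable.subtype (primrecPred_valid (A := A))
  Primcodable.ofEquiv {l : List (A ⊕ Option Bool) // Valid l} equivToks

end QF
end VarSat

namespace VarSat

/-! ## Order-sorted signatures, deduction modulo equations, algebras -/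

/-- Variables: countably many for each sort, and variables of distinct sorts are distinct. -/
abbrev Var (S : Type) := S × ℕ
abbrev Tm (S F : Type) := Term (Var S) F
abbrev Subst (S F : Type) := Var S → Tm S F
/-- An equation `u = v`, or a rule `u → v`, or a disequality `u ≠ v`, is given by `(u, v)`. -/
abbrev Eqn (S F : Type) := Tm S F × Tm S F
/-- A finite conjunction, of equations or of disequalities. -/
abbrev Conj (S F : Type) := List (Eqn S F)
/-- A substitution with finite domain, as an association list (the first entry counts). -/
abbrev ASubst (S F : Type) := List (Var S × Tm S F)

section
variable {S F : Type}

def Eqn.vars (e : Eqn S F) : List (Var S) := e.1.vars ++ e.2.vars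
def Conj.vars (D : Conj S F) : List (Var S) := D.flatMap Eqn.vars
def Eqn.subst (σ : Subst S F) (e : Eqn S F) : Eqn S F := (e.1.subst σ, e.2.subst σ)
def Conj.subst (σ : Subst S F) (D : Conj S F) : Conj S F := D.map (Eqn.subst σ)

def ASubst.fn [DecidableEq S] (σ : ASubst S F) : Subst S F :=
  fun x => (σ.lookup x).getD (.var x)

/-- Operator declarations: `op f w s` says that `f : w → s` belongs to the signature.
The poset of sorts is `S`; the many-sorted case is the one in which `≤` is equality and each
symbol has one declaration. -/
structure Sig (S F : Type) where
  op : F → List S → S → Prop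

variable [PartialOrder S]

namespace Sig
variable (Sg : Sig S F)

/-- The subsignature of the symbols that satisfy `P` (with the same poset of sorts). -/
def restrict (P : F → Prop) : Sig S F := ⟨fun f w s => P f ∧ Sg.op f w s⟩

/-- `HasSort t s` is `t ∈ T_Σ(X)_s`. -/
inductive HasSort : Tm S F → S → Prop
  | var (x : Var S) : HasSort (.var x) x.1
  | app {f : F} {ts : List (Tm S F)} {w : List S} {s : S} (hf : Sg.op f w s)
      (hl : ts.length = w.length) (ht : ∀ t s', (t, s') ∈ ts.zip w → HasSort t s') :
      HasSort (.app f ts) s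
  | sub {t : Tm S F} {s s' : S} (h : HasSort t s) (hs : s ≤ s') : HasSort t s'

/-- `t ∈ T_Σ(X)`. -/
def WT (t : Tm S F) : Prop := ∃ s, Sg.HasSort t s

/-- `u = v` (or `u ≠ v`) is a `Σ`-equation (or `Σ`-disequality). -/
def IsEqn (e : Eqn S F) : Prop := ∃ s, Sg.HasSort e.1 s ∧ Sg.HasSort e.2 s

/-- `σ` is an `S`-sorted function from the variables to `T_Σ(X)`. -/
def IsSubst (σ : Subst S F) : Prop := ∀ x, Sg.HasSort (σ x) x.1

/-- `E ⊢ u = v` on `T_Σ(X)`, that is, `u =_E v`. -/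
inductive EqMod (E : Set (Eqn S F)) : Tm S F → Tm S F → Prop
  | refl {t : Tm S F} (ht : Sg.WT t) : EqMod E t t
  | symm {t u : Tm S F} (h : EqMod E t u) : EqMod E u t
  | trans {t u v : Tm S F} (h : EqMod E t u) (h' : EqMod E u v) : EqMod E t v
  | inst {e : Eqn S F} {σ : Subst S F} (he : e ∈ E) (hσ : Sg.IsSubst σ) :
      EqMod E (e.1.subst σ) (e.2.subst σ)
  | congr {f : F} {ts us : List (Tm S F)} (hl : ts.length = us.length)
      (h : ∀ t u, (t, u) ∈ ts.zip us → EqMod E t u)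
      (ht : Sg.WT (.app f ts)) (hu : Sg.WT (.app f us)) : EqMod E (.app f ts) (.app f us)

end Sig

/-- A `Σ`-algebra: a universe, for each sort its subset of elements of that sort, and an
interpretation of the symbols (only its values on arguments of declared sorts matter). -/
structure Alg (S F : Type) where
  U : Type
  dom : S → Set U
  fn : F → List U → U

namespace Alg
variable (A : Alg S F)

/-- The value of a term under an assignment. -/
def eval (a : Var S → A.U) : Tm S F → A.U
  | .var x => a x
  | .app f ts => A.fn f (ts.map (eval a))

/-- `a` is a sorted assignment. -/
def IsAssign (a : Var S → A.U) : Prop := ∀ x, a x ∈ A.dom x.1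

/-- Satisfaction of a quantifier-free formula under an assignment. -/
def Holds (a : Var S → A.U) : QF (Eqn S F) → Prop
  | .eq e => A.eval a e.1 = A.eval a e.2
  | .neg φ => ¬ Holds a φ
  | .and φ ψ => Holds a φ ∧ Holds a ψ
  | .or φ ψ => Holds a φ ∨ Holds a ψ

/-- The formula is satisfiable in the algebra. -/
def Satisfiable (φ : QF (Eqn S F)) : Prop := ∃ a, A.IsAssign a ∧ A.Holds a φ

/-- The conjunction of the disequalities in `D` is satisfiable in the algebra. -/
def SatNe (D : Conj S F) : Prop :=
  ∃ a, A.IsAssign a ∧ ∀ e ∈ D, A.eval a e.1 ≠ A.eval a e.2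

end Alg

/-- The initial algebra `T_{Σ/E}`: classes of ground terms modulo `=_E`. -/
def initAlg (Sg : Sig S F) (E : Set (Eqn S F)) : Alg S F where
  U := Set (Tm S F)
  dom s := {c | ∃ t, t.Ground ∧ Sg.HasSort t s ∧ c = {v | v.Ground ∧ Sg.EqMod E t v}}
  fn f cs := {v | v.Ground ∧
    ∃ ts, List.Forall₂ (fun t c => t ∈ c) ts cs ∧ Sg.EqMod E (.app f ts) v}

/-! ## Unification -/

/-- `dom(σ) = X`, `ran(σ) ∩ W = ∅`, and `σ` is idempotent. -/
def Away (σ : Subst S F) (X W : List (Var S)) : Prop :=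
  (∀ x, σ x ≠ .var x ↔ x ∈ X) ∧ (∀ x ∈ X, ∀ y ∈ (σ x).vars, y ∉ W) ∧
    ∀ x, (σ x).subst σ = σ x

/-- `σ` is an `E`-unifier of the equations in `φ`. -/
def Sig.IsUnifier (Sg : Sig S F) (E : Set (Eqn S F)) (φ : Conj S F) (σ : Subst S F) : Prop :=
  Sg.IsSubst σ ∧ ∀ e ∈ φ, Sg.EqMod E (e.1.subst σ) (e.2.subst σ)

/-- `U` is a (finite) complete set `Unif_E^W(φ)` of `E`-unifiers of `φ`, away from `W`. -/
def Sig.IsCompleteUnif [DecidableEq S] (Sg : Sig S F) (E : Set (Eqn S F)) (φ : Conj S F)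
    (W : List (Var S)) (U : List (ASubst S F)) : Prop :=
  (∀ τ ∈ U, Sg.IsUnifier E φ τ.fn ∧ Away τ.fn φ.vars W) ∧
    ∀ σ, Sg.IsUnifier E φ σ →
      ∃ τ ∈ U, ∃ ρ, Sg.IsSubst ρ ∧ ∀ x ∈ W, Sg.EqMod E (σ x) ((τ.fn x).subst ρ)

/-- There is a finitary `E`-unification algorithm. -/
def Sig.FinitaryUnif [DecidableEq S] [Primcodable S] [Primcodable F] (Sg : Sig S F)
    (E : Set (Eqn S F)) : Prop :=
  ∃ alg : Conj S F → List (Var S) → List (ASubst S F), Computable₂ alg ∧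
    ∀ φ W, (∀ e ∈ φ, Sg.IsEqn e) → φ.vars ⊆ W → Sg.IsCompleteUnif E φ W (alg φ W)

/-! ## Rewrite theories and decompositions -/

/-- A rewrite theory `(Σ, B, R)`. -/
structure RewTheory (S F : Type) where
  sig : Sig S F
  ax : Set (Eqn S F)
  rules : Set (Eqn S F)

namespace RewTheory
variable (T : RewTheory S F)

/-- `=_B`. -/
def EqB : Tm S F → Tm S F → Prop := T.sig.EqMod T.ax

/-- The equations `E`: the axioms `B` and the rules `R`, read as equations. -/
def eqns : Set (Eqn S F) := T.ax ∪ T.rules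

/-- `=_E`. -/
def EqE : Tm S F → Tm S F → Prop := T.sig.EqMod T.eqns

/-- One-step rewriting `→_{R,B}` on `T_Σ(X)`: the subterm at some position is `B`-equal to an
instance of the left-hand side of a rule and is replaced by that of the right-hand side. -/
inductive Step : Tm S F → Tm S F → Prop
  | root {t : Tm S F} {e : Eqn S F} {σ : Subst S F} (he : e ∈ T.rules) (hσ : T.sig.IsSubst σ)
      (h : T.EqB t (e.1.subst σ)) : Step t (e.2.subst σ)
  | arg {f : F} {l r : List (Tm S F)} {t u : Tm S F} (h : Step t u)
      (ht : T.sig.WT (.app f (l ++ t :: r))) (hu : T.sig.WT (.app f (l ++ u :: r))) :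
      Step (.app f (l ++ t :: r)) (.app f (l ++ u :: r))

/-- `t` is in `R,B`-normal form. -/
def Irred (t : Tm S F) : Prop := ∀ u, ¬ T.Step t u

/-- `u` is a normal form `t!_{R,B}` of `t`. -/
def NF (t u : Tm S F) : Prop := Relation.ReflTransGen T.Step t u ∧ T.Irred u

/-- `u =_B t!_{R,B}`. -/
def NFB (t u : Tm S F) : Prop := ∃ v, T.NF t v ∧ T.EqB u v

/-- `(Σ, B, R)` is a decomposition of `(Σ, E)`: a convergent rewrite theory with regular and
linear axioms. `ax_sort` and `rules_sort` are the usual order-sorted requirements that axioms are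
sort-preserving and rules sort-decreasing; they hold automatically in the many-sorted case. -/
structure IsDecomposition : Prop where
  ax_eqn : ∀ e ∈ T.ax, T.sig.IsEqn e
  ax_regular : ∀ e ∈ T.ax, ∀ x, x ∈ e.1.vars ↔ x ∈ e.2.vars
  ax_linear : ∀ e ∈ T.ax, e.1.vars.Nodup ∧ e.2.vars.Nodup
  ax_sort : ∀ e ∈ T.ax, ∀ σ, T.sig.IsSubst σ → ∀ s,
    T.sig.HasSort (e.1.subst σ) s ↔ T.sig.HasSort (e.2.subst σ) s
  rules_eqn : ∀ e ∈ T.rules, T.sig.IsEqn e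
  rules_lhs : ∀ e ∈ T.rules, ∀ x, e.1 ≠ .var x
  rules_vars : ∀ e ∈ T.rules, e.2.vars ⊆ e.1.vars
  rules_sort : ∀ e ∈ T.rules, ∀ σ, T.sig.IsSubst σ → ∀ s,
    T.sig.HasSort (e.1.subst σ) s → T.sig.HasSort (e.2.subst σ) s
  terminating : WellFounded fun u t => T.Step t u
  coherent : ∀ u v u', T.Step u v → T.EqB u u' → ∃ v', T.Step u' v' ∧ T.EqB v v'
  confluent : ∀ u v₁ v₂, T.sig.WT u →
    Relation.ReflTransGen T.Step u v₁ → Relation.ReflTransGen T.Step u v₂ →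
      ∃ w₁ w₂, Relation.ReflTransGen T.Step v₁ w₁ ∧ Relation.ReflTransGen T.Step v₂ w₂ ∧
        T.EqB w₁ w₂

/-- The class `[u]_B`. -/
def cls (u : Tm S F) : Set (Tm S F) := {v | T.EqB u v}

/-- The canonical term algebra `C_R`: the elements of sort `s` are the classes `[t!_{R,B}]_B` of
the normal forms of the ground terms `t` of sort `s`, and `f` maps `[u₁]_B, …, [uₙ]_B` to
`[f(u₁, …, uₙ)!_{R,B}]_B`. -/
def canon : Alg S F where
  U := Set (Tm S F)
  dom s := {c | ∃ t u, t.Ground ∧ T.sig.HasSort t s ∧ T.NF t u ∧ c = T.cls u}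
  fn f cs := {v | ∃ us, List.Forall₂ (fun u c => u ∈ c) us cs ∧ T.NFB (.app f us) v}

/-- The decomposition `T` protects the decomposition `T₀`. -/
structure Protects (T₀ : RewTheory S F) : Prop where
  sig_sub : ∀ f w s, T₀.sig.op f w s → T.sig.op f w s
  ax_sub : T₀.ax ⊆ T.ax
  rules_sub : T₀.rules ⊆ T.rules
  eqB_iff : ∀ t t', T₀.sig.WT t → T₀.sig.WT t' → (T₀.EqB t t' ↔ T.EqB t t')
  irred_iff : ∀ t, T₀.sig.WT t → (T₀.Irred t ↔ T.Irred t)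
  canon_dom : ∀ s, T₀.canon.dom s = T.canon.dom s
  canon_fn : ∀ f w s, T₀.sig.op f w s → ∀ cs : List (Set (Tm S F)),
    List.Forall₂ (fun c s' => c ∈ T.canon.dom s') cs w → T₀.canon.fn f cs = T.canon.fn f cs

/-! ## Variants -/

/-- `(us, θ)` is a variant of the tuple of terms `ts`. A term is a tuple of length one; the
variants of a conjunction `⋀ uᵢ ≠ vᵢ`, viewed as a term in the signature extended by `∧` and `≠`,
are those of the tuple `(u₁, v₁, u₂, v₂, …)`, as there are no axioms or rules for `∧` and `≠`. -/
structure IsVariant (ts us : List (Tm S F)) (θ : Subst S F) : Prop where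
  subst : T.sig.IsSubst θ
  dom : ∀ x, x ∉ ts.flatMap Term.vars → θ x = .var x
  normal : ∀ x, T.Irred (θ x)
  nf : List.Forall₂ (fun t u => T.NFB (t.subst θ) u) ts us

/-- The variant `(us, θ)` of `ts` is more general than the variant `(vs, γ)`. -/
def MoreGeneral (ts us : List (Tm S F)) (θ : Subst S F) (vs : List (Tm S F)) (γ : Subst S F) :
    Prop :=
  ∃ ρ, T.sig.IsSubst ρ ∧ (∀ x ∈ ts.flatMap Term.vars, T.EqB ((θ x).subst ρ) (γ x)) ∧
    List.Forall₂ (fun u v => T.EqB (u.subst ρ) v) us vs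

/-- The finite variant property. -/
def FVP : Prop :=
  ∀ t, T.sig.WT t → ∃ V : Set (Tm S F × Subst S F), V.Finite ∧
    (∀ p ∈ V, T.IsVariant [t] [p.1] p.2) ∧
    ∀ v γ, T.IsVariant [t] [v] γ → ∃ p ∈ V, T.MoreGeneral [t] [p.1] p.2 [v] γ

/-- `V` is a (finite) complete set of variants of `a`, away from `W`, where `g` says how `a` is
read as a tuple of terms. -/
def IsCompleteVariants [DecidableEq S] {α : Type} (g : α → List (Tm S F)) (a : α)
    (W : List (Var S)) (V : List (α × ASubst S F)) : Prop :=
  (∀ p ∈ V, T.IsVariant (g a) (g p.1) p.2.fn ∧ Away p.2.fn ((g a).flatMap Term.vars) W) ∧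
    ∀ vs γ, T.IsVariant (g a) vs γ → ∃ p ∈ V, T.MoreGeneral (g a) (g p.1) p.2.fn vs γ

/-- `U` is a (finite) set `VarUnif_E^W(φ)`: `E`-unifiers away from `W` that cover, by a normalized
substitution, every normalized `E`-unifier of `φ`. -/
def IsVarUnif [DecidableEq S] (φ : Conj S F) (W : List (Var S)) (U : List (ASubst S F)) : Prop :=
  (∀ θ ∈ U, T.sig.IsUnifier T.eqns φ θ.fn ∧ Away θ.fn φ.vars W) ∧
    ∀ α, T.sig.IsUnifier T.eqns φ α → (∀ x, T.Irred (α x)) →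
      ∃ θ ∈ U, ∃ ρ, T.sig.IsSubst ρ ∧ (∀ x, T.Irred (ρ x)) ∧
        ∀ x ∈ W, T.EqB (α x) ((θ.fn x).subst ρ)

/-! ## OS-compactness -/

/-- The sort `s` is finite in `T_{Σ/E}`. -/
def FinSort (s : S) : Prop := ((initAlg T.sig T.eqns).dom s).Finite

/-- `reps` lists representatives, which are ground terms, for the classes in `T_{Σ/E,s}`. -/
def IsReps (s : S) (reps : List (Tm S F)) : Prop :=
  (∀ r ∈ reps, r.Ground ∧ T.sig.HasSort r s) ∧
    ∀ t, t.Ground → T.sig.HasSort t s → ∃ r ∈ reps, T.EqE t r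

/-- The equational theory `(Σ, E)` of `(Σ, B, R)` is OS-compact. -/
structure OSCompact [DecidableEq S] [Primcodable S] [Primcodable F] : Prop where
  sorts : ∃ fin : S → Bool, Computable fin ∧ ∀ s, fin s = true ↔ T.FinSort s
  reps : ∃ reps : S → List (Tm S F), Computable reps ∧ ∀ s, T.FinSort s → T.IsReps s (reps s)
  eq_dec : ∃ eq : Tm S F → Tm S F → Bool, Computable₂ eq ∧
    ∀ u v, T.sig.IsEqn (u, v) → (eq u v = true ↔ T.EqE u v)
  unif : T.sig.FinitaryUnif T.eqns
  compact : ∀ D : Conj S F, (∀ e ∈ D, T.sig.IsEqn e) → (∀ x ∈ D.vars, ¬ T.FinSort x.1) →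
    (∀ e ∈ D, ¬ T.EqE e.1 e.2) → (initAlg T.sig T.eqns).SatNe D

end RewTheory

/-! ## Theories with predicates -/

/-- The three parts of the signature: `Δ`, `Ω_c` and `Ω_Π`. -/
inductive Part : Type where
  | defined
  | ctor
  | pred
  deriving DecidableEq

/-- Codes for the three parts. -/
def Part.equiv : Part ≃ Option Bool where
  toFun p := match p with
    | .defined => none
    | .ctor => some false
    | .pred => some true
  invFun o := match o with
    | none => .defined
    | some false => .ctor
    | some true => .pred
  left_inv p := by cases p <;> rfl
  right_inv o := by rcases o with _ | _ | _ <;> rfl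

instance : Primcodable Part := Primcodable.ofEquiv _ Part.equiv

/-- A negative constrained pattern `⋀ wₗ ≠ w'ₗ ⇒ p(v₁, …, vₙ) ≠ tt`, given by the list of the `vᵢ`
and the list of the `(wₗ, w'ₗ)`. -/
abbrev Pattern (S F : Type) := List (Tm S F) × Conj S F

/-- The data of `R = (Δ ⊎ Ω_c ⊎ Ω_Π, B_Δ ⊎ B_{Ω_c}, R_Δ ⊎ R_{Ω_c} ⊎ R_Π)`, together with the
negative constrained patterns of the predicates in `Ω_Π`. -/
structure PredTheory (S F : Type) where
  sig : Sig S F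
  part : F → Part
  Pred : S
  tt : F
  axD : Set (Eqn S F)
  axC : Set (Eqn S F)
  rulesD : Set (Eqn S F)
  rulesC : Set (Eqn S F)
  rulesP : Set (Eqn S F)
  pats : F → List (Pattern S F)

namespace PredTheory
variable (R : PredTheory S F)

/-- The decomposition `R` itself. -/
def full : RewTheory S F := ⟨R.sig, R.axD ∪ R.axC, R.rulesD ∪ R.rulesC ∪ R.rulesP⟩

/-- `R_Ω = (Ω_c ⊎ Ω_Π, B_{Ω_c}, R_{Ω_c} ⊎ R_Π)`. -/
def omega : RewTheory S F :=
  ⟨R.sig.restrict fun f => R.part f ≠ .defined, R.axC, R.rulesC ∪ R.rulesP⟩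

/-- `R_{Ω_c} = (Ω_c, B_{Ω_c}, R_{Ω_c})`. -/
def omegaC : RewTheory S F := ⟨R.sig.restrict fun f => R.part f = .ctor, R.axC, R.rulesC⟩

/-- `(Δ ⊎ Ω_c, B_Δ ⊎ B_{Ω_c}, R_Δ ⊎ R_{Ω_c})`. -/
def deltaC : RewTheory S F :=
  ⟨R.sig.restrict fun f => R.part f ≠ .pred, R.axD ∪ R.axC, R.rulesD ∪ R.rulesC⟩

/-- `ρ` maps the variables in `Y` to ground `Ω_c`-terms in normal form. -/
def IsPatInst (Y : List (Var S)) (ρ : Subst S F) : Prop :=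
  ∀ x ∈ Y, (ρ x).Ground ∧ R.omegaC.sig.HasSort (ρ x) x.1 ∧ R.full.Irred (ρ x)

/-- The list `R.pats p` is a set of negative constrained patterns for `p`. -/
structure IsNegPatterns (p : F) : Prop where
  sort : ∀ pt ∈ R.pats p, R.omega.sig.HasSort (.app p pt.1) R.Pred
  args : ∀ pt ∈ R.pats p, ∀ v ∈ pt.1, R.omegaC.sig.WT v
  constr : ∀ pt ∈ R.pats p, ∀ e ∈ pt.2, R.omegaC.sig.IsEqn e
  vars : ∀ pt ∈ R.pats p, pt.2.vars ⊆ (Term.app p pt.1).vars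
  inst_iff : ∀ pt ∈ R.pats p, ∀ ρ, R.IsPatInst (Term.app p pt.1).vars ρ →
    (R.full.cls ((Term.app p pt.1).subst ρ) ∈ R.full.canon.dom R.Pred ↔
      ∀ e ∈ pt.2, ¬ R.full.EqE (e.1.subst ρ) (e.2.subst ρ))
  complete_iff : ∀ ts, (Term.app p ts).Ground → R.sig.HasSort (.app p ts) R.Pred →
    (R.full.cls (.app p ts) ∈ R.full.canon.dom R.Pred ↔
      ∃ pt ∈ R.pats p, ∃ ρ, R.IsPatInst (Term.app p pt.1).vars ρ ∧
        R.full.cls (.app p ts) = R.full.cls ((Term.app p pt.1).subst ρ) ∧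
        ∀ e ∈ pt.2, ¬ R.full.EqE (e.1.subst ρ) (e.2.subst ρ))

/-- The standing assumptions. -/
structure Conditions [DecidableEq S] [Primcodable S] [Primcodable F] : Prop where
  /-- `R` is an FVP decomposition. -/
  dec : R.full.IsDecomposition
  fvp : R.full.FVP
  /-- All sorts are non-empty. -/
  nonempty : ∀ s, ∃ t : Tm S F, t.Ground ∧ R.sig.HasSort t s
  /-- `R` protects the decomposition `R_Ω`. -/
  dec_omega : R.omega.IsDecomposition
  protects_omega : R.full.Protects R.omega
  /-- `Pred` is a sort that is added to the other sorts: it is not comparable to any of them, and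
  not among the argument sorts of any symbol. It has the constant `tt`. -/
  pred_isolated : ∀ s, s ≤ R.Pred ∨ R.Pred ≤ s → s = R.Pred
  pred_not_arg : ∀ f w s, R.sig.op f w s → R.Pred ∉ w
  tt_op : R.sig.op R.tt [] R.Pred
  tt_ctor : R.part R.tt = .ctor
  /-- The symbols in `Ω_Π` are predicates, and `R_Π` consists of rules `p(u₁, …, uₙ) → tt`. -/
  preds : ∀ p w s, R.part p = .pred → R.sig.op p w s → s = R.Pred
  rulesP_form : ∀ e ∈ R.rulesP, ∃ p us, R.part p = .pred ∧
    e = (Term.app p us, Term.app R.tt [])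
  /-- `B` has a finitary unification algorithm, and the axioms in `B_Δ` are equations between
  non-variable `Δ`-terms. -/
  unif : R.full.sig.FinitaryUnif R.full.ax
  axD_form : ∀ e ∈ R.axD, (∀ x, e.1 ≠ .var x ∧ e.2 ≠ .var x) ∧
    ∀ f ∈ e.1.syms ++ e.2.syms, R.part f = .defined
  /-- `R_{Ω_c}` is OS-compact, and is the constructor decomposition of the theory without the
  predicates in `Ω_Π`. -/
  dec_omegaC : R.omegaC.IsDecomposition
  dec_deltaC : R.deltaC.IsDecomposition
  protects_omegaC : R.deltaC.Protects R.omegaC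
  compact : R.omegaC.OSCompact
  /-- Each predicate in `Ω_Π` has negative constrained patterns. -/
  patterns : ∀ p, R.part p = .pred → R.IsNegPatterns p

/-- Quantifier-free formulas: the atoms are `(Δ ⊎ Ω_c)`-equations without variables of sort `Pred`,
and predicate atoms `p(t₁, …, tₙ) = tt` with `p` in `Ω_Π`. -/
def IsFormula : QF (Eqn S F) → Prop
  | .eq e => (R.deltaC.sig.IsEqn e ∧ ∀ x ∈ e.vars, x.1 ≠ R.Pred) ∨
      ∃ p ts, R.part p = .pred ∧ R.sig.HasSort (.app p ts) R.Pred ∧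
        e = (Term.app p ts, Term.app R.tt [])
  | .neg φ => IsFormula φ
  | .and φ ψ => IsFormula φ ∧ IsFormula ψ
  | .or φ ψ => IsFormula φ ∧ IsFormula ψ

end PredTheory
end

/-! ## The procedure -/

section
variable {S F : Type}

/-- Disjunctive normal form of `φ` (for `true`) or of its negation (for `false`): a list of pairs
`(G, D)`, standing for the conjunction of the equations in `G` and the disequalities in `D`. -/
def dnf : Bool → QF (Eqn S F) → List (Conj S F × Conj S F)
  | true, .eq e => [([e], [])]
  | false, .eq e => [([], [e])]
  | b, .neg φ => dnf (!b) φ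
  | true, .and φ ψ => (dnf true φ).flatMap fun p =>
      (dnf true ψ).map fun q => (p.1 ++ q.1, p.2 ++ q.2)
  | false, .and φ ψ => dnf false φ ++ dnf false ψ
  | true, .or φ ψ => dnf true φ ++ dnf true ψ
  | false, .or φ ψ => (dnf false φ).flatMap fun p =>
      (dnf false ψ).map fun q => (p.1 ++ q.1, p.2 ++ q.2)

/-- The subroutines that the procedure calls. -/
structure Subroutines (S F : Type) where
  /-- `t ↦ t!_{R,B}` -/
  nf : Tm S F → Tm S F
  /-- `VarUnif_E^W(φ)` -/
  varUnif : Conj S F → List (Var S) → List (ASubst S F)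
  /-- complete sets of variants of terms, away from `W` -/
  variants : Tm S F → List (Var S) → List (Tm S F × ASubst S F)
  /-- complete sets of variants of conjunctions, away from `W` -/
  conjVariants : Conj S F → List (Var S) → List (Conj S F × ASubst S F)
  /-- `B_{Ω_c}`-unification of constructor terms, away from `W` -/
  unif : Conj S F → List (Var S) → List (ASubst S F)
  /-- test of `B_{Ω_c}`-equality of `Ω_c`-terms -/
  eqB : Tm S F → Tm S F → Bool
  /-- test of finiteness of sorts in `R_{Ω_c}` -/
  finSort : S → Bool
  /-- canonical representatives of the elements of a finite sort -/
  reps : S → List (Tm S F)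
  /-- a test for obviously unsatisfiable conjunctions of disequalities -/
  obvious : Conj S F → Bool

/-- A bound above the indices of all variables in `W`. -/
def freshIdx (W : List (Var S)) : ℕ := W.foldr (fun x m => max (x.2 + 1) m) 0

/-- The renaming of variables that adds `k` to all indices. -/
def shift (k : ℕ) : Subst S F := fun x => .var (x.1, x.2 + k)

/-- The root symbol of a term is `p`. -/
def rootIs [DecidableEq F] (p : F) : Tm S F → Bool
  | .var _ => false
  | .app f _ => decide (f = p)

namespace PredTheory
variable [DecidableEq S] [DecidableEq F] (R : PredTheory S F) (sub : Subroutines S F)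

/-- Step 1: unification. -/
def unifStep (G D : Conj S F) : List (Conj S F) :=
  ((sub.varUnif G (G.vars ++ D.vars)).map fun α =>
    (D.subst α.fn).map fun e => (sub.nf e.1, sub.nf e.2)).filter fun D' => !sub.obvious D'

/-- The disequality is of the form `p(t₁, …, tₙ) ≠ v` with `p` in `Ω_Π` (here `v` is `tt`, or a
normal form of `tt` after Step 1). -/
def isPi (e : Eqn S F) : Bool :=
  match e.1 with
  | .var _ => false
  | .app f _ => decide (R.part f = .pred)

/-- Writes `D` as `D₁ ∧ p(t₁, …, tₙ) ≠ v ∧ D₂`, with the first such disequality, and returns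
`(D₁, p, p(t₁, …, tₙ), D₂)`. -/
def findPi : Conj S F → Option (Conj S F × F × Tm S F × Conj S F)
  | [] => none
  | e :: D =>
    match e.1 with
    | .app f ts =>
      if R.part f = .pred then some ([], f, .app f ts, D)
      else (findPi D).map fun q => (e :: q.1, q.2)
    | .var _ => (findPi D).map fun q => (e :: q.1, q.2)

/-- Step 2, for one disequality `t ≠ tt` with `t = p(t₁, …, tₙ)` in `D₁ ∧ t ≠ tt ∧ D₂`, where `W`
contains the variables of this conjunction. -/
def elimOne (W : List (Var S)) (D₁ : Conj S F) (p : F) (t : Tm S F) (D₂ : Conj S F) :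
    List (Conj S F) :=
  ((sub.variants t W).flatMap fun v =>
    -- only the constructor variants `(p(t'₁, …, t'ₙ), θ)`
    if rootIs p v.1 && v.1.syms.all (fun f => decide (R.part f ≠ .defined)) then
      (R.pats p).flatMap fun pt =>
        let W₁ := W ++ v.2.flatMap (fun b => b.2.vars) ++ v.1.vars
        -- the pattern, with its variables renamed away from `W₁`
        let k := freshIdx W₁
        let q := (Term.app p pt.1).subst (shift k)
        let C := pt.2.subst (shift k)
        (sub.unif [(v.1, q)] (W₁ ++ q.vars)).map fun α =>
          ((D₁ ++ C ++ D₂).subst v.2.fn).subst α.fn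
    else []).filter fun D' => !sub.obvious D'

/-- Step 2, iterated `n` times or until no predicate in `Ω_Π` is left. -/
def elim : ℕ → Conj S F → List (Conj S F)
  | 0, D => [D]
  | n + 1, D =>
    match R.findPi D with
    | none => [D]
    | some (D₁, p, t, D₂) => (R.elimOne sub D.vars D₁ p t D₂).flatMap (elim n)

/-- Step 2, iterated as often as there are disequalities to eliminate. -/
def elimStep (D : Conj S F) : List (Conj S F) := R.elim sub (D.countP R.isPi) D

/-- All choices of representatives for the variables in a list. -/
def choices : List (Var S) → List (ASubst S F)
  | [] => [[]]
  | y :: ys => (sub.reps y.1).flatMap fun r => (choices ys).map fun τ => (y, r) :: τ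

/-- Step 3: computation of `Ω_c`-variants and elimination of finite sorts. -/
def finalStep (D : Conj S F) : Bool :=
  (sub.conjVariants D D.vars).any fun v =>
    v.1.all (fun e => (e.1.syms ++ e.2.syms).all fun f => decide (R.part f = .ctor)) &&
    (choices sub (v.1.vars.filter fun y => sub.finSort y.1)).any fun τ =>
      (v.1.subst τ.fn).all fun e =>
        -- both sides are normalized, and they are not `B_{Ω_c}`-equal
        sub.eqB (sub.nf e.1) e.1 && sub.eqB (sub.nf e.2) e.2 && !sub.eqB e.1 e.2

/-- The whole procedure, with answer `true` for satisfiable. -/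
def decideSat (φ : QF (Eqn S F)) : Bool :=
  (dnf true φ).any fun GD =>
    (unifStep sub GD.1 GD.2).any fun D' => (R.elimStep sub D').any fun D'' => R.finalStep sub D''

end PredTheory

/-- The sides of a conjunction of disequalities. -/
def Conj.sides (D : Conj S F) : List (Tm S F) := D.flatMap fun e => [e.1, e.2]

/-- The subroutines do what they are supposed to do for the theory `R`. -/
structure Subroutines.Correct [PartialOrder S] [DecidableEq S] (sub : Subroutines S F)
    (R : PredTheory S F) : Prop where
  nf : ∀ t, R.sig.WT t → R.full.NF t (sub.nf t)
  varUnif : ∀ φ W, (∀ e ∈ φ, R.sig.IsEqn e) → φ.vars ⊆ W →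
    R.full.IsVarUnif φ W (sub.varUnif φ W)
  variants : ∀ t W, R.sig.WT t → t.vars ⊆ W →
    R.full.IsCompleteVariants (fun t => [t]) t W (sub.variants t W)
  conjVariants : ∀ D W, (∀ e ∈ D, R.sig.IsEqn e) → D.vars ⊆ W →
    R.full.IsCompleteVariants Conj.sides D W (sub.conjVariants D W)
  unif : ∀ φ W, (∀ e ∈ φ, R.omega.sig.IsEqn e) → φ.vars ⊆ W →
    R.omega.sig.IsCompleteUnif R.axC φ W (sub.unif φ W)
  eqB : ∀ u v, R.omegaC.sig.IsEqn (u, v) → (sub.eqB u v = true ↔ R.omegaC.EqB u v)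
  finSort : ∀ s, sub.finSort s = true ↔ R.omegaC.FinSort s
  reps : ∀ s, R.omegaC.FinSort s →
    R.omegaC.IsReps s (sub.reps s) ∧ ∀ r ∈ sub.reps s, R.omegaC.Irred r
  obvious : ∀ D, (∀ e ∈ D, R.sig.IsEqn e) → sub.obvious D = true → ¬ R.full.canon.SatNe D

/-- The subroutines are computable functions. -/
structure Subroutines.IsComputable [DecidableEq S] [Primcodable S] [Primcodable F]
    (sub : Subroutines S F) : Prop where
  nf : Computable sub.nf
  varUnif : Computable₂ sub.varUnif
  variants : Computable₂ sub.variants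
  conjVariants : Computable₂ sub.conjVariants
  unif : Computable₂ sub.unif
  eqB : Computable₂ sub.eqB
  finSort : Computable sub.finSort
  reps : Computable sub.reps
  obvious : Computable sub.obvious

end
end VarSat

/-! An assignment into `C_R` is the same as a normalized ground substitution `ρ`, and an equation
holds under it iff its `ρ`-instances are `E`-equal (`isAssign_iff`, `eval_eq_iff`). With the
disjunctive normal form (`holds_iff_dnf`), satisfiability of `φ` becomes the existence of such a `ρ`
for one disjunct, and each step of the procedure preserves this existence in both directions. The
tool throughout is the Church–Rosser property modulo `B` (`nf_of_eqE`): `E`-equal terms have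
`B`-equal normal forms. Backwards, a solution of the new conjunction is composed with the
substitutions of the step and normalized (`exists_pull`).

Step 1 (`unifStep_sat`): a solution is a normalized unifier of `G`, so it factors through one of the
computed unifiers.

Step 2 (`elimOne_sound`, `elimOne_complete`): rewriting takes a predicate atom to a predicate atom
or to a term that is `E`-equal to `tt` (`steps_hasRoot`), and an irreducible predicate atom is never
`E`-equal to `tt` (`not_eqE_tt`). Hence `p(t)ρ ≠ tt` holds iff the normal form of `p(t)ρ` still has
root `p`. Such a ground normal form contains no defined symbol, because `R` protects `R_Ω`. It is
therefore covered both by a constructor variant of `p(t)` and by a pattern whose constraint holds,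
and the two instances together form a unifier of the variant with the renamed pattern. A round
removes one predicate disequality and adds only constructor disequalities, so the number of rounds
is known beforehand (`elim_spec`).

Step 3 (`finalStep_sound`, `finalStep_complete`): what remains is free of predicates, so the normal
forms of its ground instances are `Ω_c`-terms and are covered by a variant over `Ω_c`. Variables of
finite sort may be replaced by representatives. Conversely, normalized sides that are not `B`-equal
are not `E`-equal, and OS-compactness supplies a solution in the infinite sorts.

The finite complete sets come from the finite variant property together with `B`-unification.
Variants of tuples are obtained by unifying the substitutions of variants of the parts
(`combine_variants`), and variant unifiers by unifying the two sides in each variant of the system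
(`exists_varUnif`). Computability rests on Polish notation: substitution acts token by token,
recursion on formulas becomes a fold with a stack, and Step 2 becomes the iteration of one map on
lists (`elim_eq_rec`). -/

namespace VarSat

/-! ### Substitution, variables and symbols of terms -/

namespace Term
variable {V F : Type}

theorem mem_vars_app {f : F} {ts : List (Term V F)} {x : V} :
    x ∈ (app f ts).vars ↔ ∃ t ∈ ts, x ∈ t.vars := by
  simp [vars]

theorem subst_congr {σ τ : V → Term V F} (t : Term V F) (h : ∀ x ∈ t.vars, σ x = τ x) :
    t.subst σ = t.subst τ := by
  induction t using induct with
  | hv x => simpa [subst, vars] using h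
  | ha f ts ih =>
    simp only [subst, app.injEq, true_and]
    exact List.map_congr_left fun t ht => ih t ht fun x hx => h x (mem_vars_app.2 ⟨t, ht, hx⟩)

theorem subst_var (t : Term V F) : t.subst .var = t := by
  induction t using induct with
  | hv x => simp [subst]
  | ha f ts ih =>
    simp only [subst, app.injEq, true_and]
    exact (List.map_congr_left ih).trans (List.map_id' ts)

theorem subst_subst (t : Term V F) (σ τ : V → Term V F) :
    (t.subst σ).subst τ = t.subst fun x => (σ x).subst τ := by
  induction t using induct with
  | hv x => simp [subst]
  | ha f ts ih =>
    simp only [subst, app.injEq, true_and, List.map_map]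
    exact List.map_congr_left ih

theorem mem_vars_subst {t : Term V F} {σ : V → Term V F} {y : V} :
    y ∈ (t.subst σ).vars ↔ ∃ x ∈ t.vars, y ∈ (σ x).vars := by
  induction t using induct with
  | hv x => simp [subst, vars]
  | ha f ts ih =>
    simp only [subst, mem_vars_app, List.mem_map]
    constructor
    · rintro ⟨_, ⟨t, ht, rfl⟩, hy⟩
      obtain ⟨x, hx, hxy⟩ := (ih t ht).1 hy
      exact ⟨x, ⟨t, ht, hx⟩, hxy⟩
    · rintro ⟨x, ⟨t, ht, hx⟩, hxy⟩
      exact ⟨_, ⟨t, ht, rfl⟩, (ih t ht).2 ⟨x, hx, hxy⟩⟩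

/-- All function symbols of `t` satisfy `P`. -/
def AllSyms (P : F → Prop) (t : Term V F) : Prop := ∀ f ∈ t.syms, P f

theorem allSyms_var {P : F → Prop} {x : V} : (var x : Term V F).AllSyms P := by
  simp [AllSyms, syms]

theorem allSyms_app {P : F → Prop} {f : F} {ts : List (Term V F)} :
    (app f ts).AllSyms P ↔ P f ∧ ∀ t ∈ ts, t.AllSyms P := by
  simp only [AllSyms, syms, List.mem_cons, List.mem_flatMap]
  grind

theorem allSyms_subst {P : F → Prop} {t : Term V F} {σ : V → Term V F} :
    (t.subst σ).AllSyms P ↔ t.AllSyms P ∧ ∀ x ∈ t.vars, (σ x).AllSyms P := by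
  induction t using induct with
  | hv x => simp [subst, vars, allSyms_var]
  | ha f ts ih =>
    simp only [subst, allSyms_app, mem_vars_app, List.mem_map]
    constructor
    · rintro ⟨hf, h⟩
      exact ⟨⟨hf, fun t ht => ((ih t ht).1 (h _ ⟨t, ht, rfl⟩)).1⟩,
        fun x ⟨t, ht, hx⟩ => ((ih t ht).1 (h _ ⟨t, ht, rfl⟩)).2 x hx⟩
    · rintro ⟨⟨hf, h⟩, h'⟩
      refine ⟨hf, ?_⟩
      rintro _ ⟨t, ht, rfl⟩
      exact (ih t ht).2 ⟨h t ht, fun x hx => h' x ⟨t, ht, hx⟩⟩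

theorem ground_iff {t : Term V F} : t.Ground ↔ ∀ x, x ∉ t.vars := List.eq_nil_iff_forall_not_mem

theorem ground_subst {t : Term V F} {σ : V → Term V F} :
    (t.subst σ).Ground ↔ ∀ x ∈ t.vars, (σ x).Ground := by
  simp only [ground_iff, mem_vars_subst]
  grind

theorem Ground.subst_eq {t : Term V F} (h : t.Ground) (σ : V → Term V F) : t.subst σ = t :=
  (subst_congr t fun x hx => absurd hx (ground_iff.1 h x)).trans t.subst_var

end Term

/-! ### Sorts of terms and deduction modulo equations -/

section
variable {S F : Type}

/-- A substitution, cut down to a list of variables. -/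
def Sig.cut [DecidableEq S] (σ : Subst S F) (X : List (Var S)) : Subst S F :=
  fun x => if x ∈ X then σ x else .var x

theorem Sig.cut_subst [DecidableEq S] (σ : Subst S F) {X : List (Var S)} {t : Tm S F}
    (h : t.vars ⊆ X) : t.subst (Sig.cut σ X) = t.subst σ :=
  Term.subst_congr t fun _ hx => if_pos (h hx)

variable [PartialOrder S]

namespace Sig
variable {Sg : Sig S F}

theorem hasSort_var_iff {x : Var S} {s : S} : Sg.HasSort (.var x) s ↔ x.1 ≤ s := by
  constructor
  · intro h
    generalize ht : (Term.var x : Tm S F) = t at h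
    induction h with
    | var y => cases ht; exact le_rfl
    | app => cases ht
    | sub _ hs ih => exact (ih ht).trans hs
  · exact fun h => (HasSort.var x).sub h

theorem hasSort_app_iff {f : F} {ts : List (Tm S F)} {s : S} : Sg.HasSort (.app f ts) s ↔
    ∃ w s', Sg.op f w s' ∧ s' ≤ s ∧ List.Forall₂ Sg.HasSort ts w := by
  constructor
  · intro h
    generalize ht : (Term.app f ts : Tm S F) = t at h
    induction h with
    | var y => cases ht
    | app hf hl ht' =>
      cases ht
      exact ⟨_, _, hf, le_rfl, List.forall₂_iff_zip.2 ⟨hl, fun {a b} => ht' a b⟩⟩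
    | sub _ hs ih =>
      obtain ⟨w, s', h1, h2, h3⟩ := ih ht
      exact ⟨w, s', h1, h2.trans hs, h3⟩
  · rintro ⟨w, s', hf, hs, h⟩
    exact (HasSort.app hf h.length_eq fun t s' => (List.forall₂_iff_zip.1 h).2).sub hs

theorem wt_app_iff {f : F} {ts : List (Tm S F)} : Sg.WT (.app f ts) ↔
    ∃ w s, Sg.op f w s ∧ List.Forall₂ Sg.HasSort ts w := by
  constructor
  · rintro ⟨s, h⟩
    obtain ⟨w, s', h1, _, h3⟩ := hasSort_app_iff.1 h
    exact ⟨w, s', h1, h3⟩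
  · rintro ⟨w, s, h1, h3⟩
    exact ⟨s, hasSort_app_iff.2 ⟨w, s, h1, le_rfl, h3⟩⟩

theorem _root_.List.Forall₂.exists_of_mem_left {α β : Type*} {R : α → β → Prop} {l : List α}
    {l' : List β} (h : List.Forall₂ R l l') {a : α} (ha : a ∈ l) : ∃ b ∈ l', R a b := by
  induction h with
  | nil => simp at ha
  | cons h _ ih =>
    rcases List.mem_cons.1 ha with rfl | ha
    · exact ⟨_, by simp, h⟩
    · obtain ⟨b, hb, hr⟩ := ih ha
      exact ⟨b, by simp [hb], hr⟩

theorem WT.arg {f : F} {ts : List (Tm S F)} (h : Sg.WT (.app f ts)) {t : Tm S F} (ht : t ∈ ts) :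
    Sg.WT t := by
  obtain ⟨w, s, _, h⟩ := wt_app_iff.1 h
  obtain ⟨s', _, h'⟩ := h.exists_of_mem_left ht
  exact ⟨s', h'⟩

/-- Replacing the arguments by terms that have at least the same sorts. -/
theorem HasSort.args {f : F} {ts us : List (Tm S F)} {s : S} (h : Sg.HasSort (.app f ts) s)
    (hu : List.Forall₂ (fun t u => ∀ s, Sg.HasSort t s → Sg.HasSort u s) ts us) :
    Sg.HasSort (.app f us) s := by
  obtain ⟨w, s', h1, h2, h3⟩ := hasSort_app_iff.1 h
  refine hasSort_app_iff.2 ⟨w, s', h1, h2, ?_⟩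
  clear h h1
  induction hu generalizing w with
  | nil => exact h3
  | cons h _ ih =>
    cases h3 with
    | cons h' h3 => exact .cons (h _ h') (ih _ h3)

theorem HasSort.subst' {t : Tm S F} {s : S} (h : Sg.HasSort t s) {σ : Subst S F}
    (hσ : ∀ x ∈ t.vars, Sg.HasSort (σ x) x.1) : Sg.HasSort (t.subst σ) s := by
  induction t using Term.induct generalizing s with
  | hv x =>
    rw [Term.subst]
    exact (hσ x (by simp [Term.vars])).sub (hasSort_var_iff.1 h)
  | ha f ts ih =>
    rw [Term.subst]
    refine HasSort.args h ?_
    rw [List.forall₂_map_right_iff, List.forall₂_same]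
    exact fun t ht s h => ih t ht h fun x hx => hσ x (Term.mem_vars_app.2 ⟨t, ht, hx⟩)

theorem HasSort.subst {t : Tm S F} {s : S} (h : Sg.HasSort t s) {σ : Subst S F}
    (hσ : Sg.IsSubst σ) : Sg.HasSort (t.subst σ) s := h.subst' fun x _ => hσ x

theorem WT.subst {t : Tm S F} (h : Sg.WT t) {σ : Subst S F}
    (hσ : Sg.IsSubst σ) : Sg.WT (t.subst σ) := h.imp fun _ h => h.subst hσ

theorem IsSubst.comp {σ τ : Subst S F} (hσ : Sg.IsSubst σ) (hτ : Sg.IsSubst τ) :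
    Sg.IsSubst fun x => (σ x).subst τ := fun x => (hσ x).subst hτ

theorem isSubst_var : Sg.IsSubst .var := fun x => .var x

theorem IsEqn.left {e : Eqn S F} (h : Sg.IsEqn e) : Sg.WT e.1 := h.imp fun _ h => h.1
theorem IsEqn.right {e : Eqn S F} (h : Sg.IsEqn e) : Sg.WT e.2 := h.imp fun _ h => h.2

theorem IsEqn.subst {e : Eqn S F} (h : Sg.IsEqn e) {σ : Subst S F} (hσ : Sg.IsSubst σ) :
    Sg.IsEqn (e.subst σ) := h.imp fun _ h => ⟨h.1.subst hσ, h.2.subst hσ⟩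

theorem HasSort.mono {Sg' : Sig S F} (hs : ∀ f w s, Sg.op f w s → Sg'.op f w s) {t : Tm S F}
    {s : S} (h : Sg.HasSort t s) : Sg'.HasSort t s := by
  induction h with
  | var x => exact .var x
  | app hf hl _ ih => exact .app (hs _ _ _ hf) hl ih
  | sub _ h ih => exact ih.sub h

/-- The restriction keeps the poset of sorts and all declarations of the remaining symbols, so a
sort derivation survives exactly when no other symbol occurs. Questions about the subtheories
thereby become questions about symbols. -/
theorem hasSort_restrict {P : F → Prop} {t : Tm S F} {s : S} :
    (Sg.restrict P).HasSort t s ↔ Sg.HasSort t s ∧ t.AllSyms P := by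
  constructor
  · intro h
    refine ⟨h.mono fun f w s (h : P f ∧ _) => h.2, ?_⟩
    induction h with
    | var x => exact Term.allSyms_var
    | app hf hl _ ih =>
      refine Term.allSyms_app.2 ⟨hf.1, fun t ht => ?_⟩
      obtain ⟨i, hi, rfl⟩ := List.getElem_of_mem ht
      exact ih _ _ (List.mem_iff_getElem.2 ⟨i, by simpa [hi] using hl ▸ hi, by
        rw [List.getElem_zip]⟩)
    | sub _ _ ih => exact ih
  · rintro ⟨h, h'⟩
    induction h with
    | var x => exact .var x
    | app hf hl _ ih =>
      rw [Term.allSyms_app] at h'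
      exact .app ⟨h'.1, hf⟩ hl fun t s ht => ih t s ht (h'.2 t (List.of_mem_zip ht).1)
    | sub _ hs ih => exact (ih h').sub hs

theorem wt_restrict {P : F → Prop} {t : Tm S F} :
    (Sg.restrict P).WT t ↔ Sg.WT t ∧ t.AllSyms P := by
  simp [WT, hasSort_restrict]

theorem isEqn_restrict {P : F → Prop} {e : Eqn S F} :
    (Sg.restrict P).IsEqn e ↔ Sg.IsEqn e ∧ e.1.AllSyms P ∧ e.2.AllSyms P := by
  simp only [IsEqn, hasSort_restrict]
  grind

/-! ### Equational deduction -/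

variable {E : Set (Eqn S F)}

theorem EqMod.wt (hE : ∀ e ∈ E, Sg.IsEqn e) {t u : Tm S F} (h : Sg.EqMod E t u) :
    Sg.WT t ∧ Sg.WT u := by
  induction h with
  | refl h => exact ⟨h, h⟩
  | symm _ ih => exact ih.symm
  | trans _ _ ih ih' => exact ⟨ih.1, ih'.2⟩
  | inst he hσ => exact ⟨(hE _ he).left.subst hσ, (hE _ he).right.subst hσ⟩
  | congr _ _ ht hu => exact ⟨ht, hu⟩

theorem EqMod.congr' {f : F} {ts us : List (Tm S F)} (h : List.Forall₂ (Sg.EqMod E) ts us)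
    (ht : Sg.WT (.app f ts)) (hu : Sg.WT (.app f us)) : Sg.EqMod E (.app f ts) (.app f us) :=
  .congr h.length_eq (fun _ _ => (List.forall₂_iff_zip.1 h).2) ht hu

theorem EqMod.mono {Sg' : Sig S F} {E' : Set (Eqn S F)}
    (hs : ∀ f w s, Sg.op f w s → Sg'.op f w s) (hE : E ⊆ E') {t u : Tm S F}
    (h : Sg.EqMod E t u) : Sg'.EqMod E' t u := by
  induction h with
  | refl h => exact .refl (h.imp fun _ h => h.mono hs)
  | symm _ ih => exact ih.symm
  | trans _ _ ih ih' => exact ih.trans ih'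
  | inst he hσ => exact .inst (hE he) fun x => (hσ x).mono hs
  | congr hl _ ht hu ih =>
    exact .congr hl ih (ht.imp fun _ h => h.mono hs) (hu.imp fun _ h => h.mono hs)

theorem EqMod.subst {t u : Tm S F} (h : Sg.EqMod E t u) {σ : Subst S F} (hσ : Sg.IsSubst σ) :
    Sg.EqMod E (t.subst σ) (u.subst σ) := by
  induction h with
  | refl h => exact .refl (h.subst hσ)
  | symm _ ih => exact ih.symm
  | trans _ _ ih ih' => exact ih.trans ih'
  | inst he hτ => rw [Term.subst_subst, Term.subst_subst]; exact .inst he (hτ.comp hσ)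
  | @congr f ts us hl _ ht hu ih =>
    have ht := ht.subst hσ
    have hu := hu.subst hσ
    simp only [Term.subst] at ht hu ⊢
    refine .congr' ?_ ht hu
    rw [List.forall₂_map_left_iff, List.forall₂_map_right_iff]
    exact List.forall₂_iff_zip.2 ⟨hl, fun {a b} => ih a b⟩

theorem EqMod.subst_congr {t : Tm S F} (ht : Sg.WT t) {σ τ : Subst S F} (hσ : Sg.IsSubst σ)
    (hτ : Sg.IsSubst τ) (h : ∀ x ∈ t.vars, Sg.EqMod E (σ x) (τ x)) :
    Sg.EqMod E (t.subst σ) (t.subst τ) := by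
  induction t using Term.induct with
  | hv x => simpa only [Term.subst] using h x (by simp [Term.vars])
  | ha f ts ih =>
    have h1 := ht.subst hσ
    have h2 := ht.subst hτ
    simp only [Term.subst] at h1 h2 ⊢
    refine .congr' ?_ h1 h2
    rw [List.forall₂_map_left_iff, List.forall₂_map_right_iff, List.forall₂_same]
    exact fun t ht' => ih t ht' (ht.arg ht') fun x hx => h x (Term.mem_vars_app.2 ⟨t, ht', hx⟩)

theorem EqMod.mem_vars (hE : ∀ e ∈ E, ∀ x, x ∈ e.1.vars ↔ x ∈ e.2.vars) {t u : Tm S F}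
    (h : Sg.EqMod E t u) (x : Var S) : x ∈ t.vars ↔ x ∈ u.vars := by
  induction h with
  | refl h => rfl
  | symm _ ih => exact ih.symm
  | trans _ _ ih ih' => exact ih.trans ih'
  | inst he hσ => simp only [Term.mem_vars_subst, hE _ he]
  | congr hl _ ht hu ih =>
    have h := List.forall₂_iff_zip.2 ⟨hl, fun {a b} => ih a b⟩
    simp only [Term.vars]
    clear hl ih ht hu
    induction h with
    | nil => rfl
    | cons h _ ih => simp_all

theorem EqMod.ground (hE : ∀ e ∈ E, ∀ x, x ∈ e.1.vars ↔ x ∈ e.2.vars) {t u : Tm S F}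
    (h : Sg.EqMod E t u) : t.Ground ↔ u.Ground := by
  simp only [Term.ground_iff, h.mem_vars hE]

/-- The axioms are regular and respect the property of having only symbols in `P`. -/
def RespectsSyms (P : F → Prop) (E : Set (Eqn S F)) : Prop :=
  ∀ e ∈ E, (∀ x, x ∈ e.1.vars ↔ x ∈ e.2.vars) ∧ (e.1.AllSyms P ↔ e.2.AllSyms P)

/-- Regularity is essential here: a variable that occurs on one side only could carry a symbol
outside `P` into or out of the term. -/
theorem EqMod.allSyms {P : F → Prop} (hE : RespectsSyms P E) {t u : Tm S F}
    (h : Sg.EqMod E t u) : t.AllSyms P ↔ u.AllSyms P := by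
  induction h with
  | refl h => rfl
  | symm _ ih => exact ih.symm
  | trans _ _ ih ih' => exact ih.trans ih'
  | inst he hσ => simp only [Term.allSyms_subst, (hE _ he).1, (hE _ he).2]
  | congr hl _ ht hu ih =>
    have h := List.forall₂_iff_zip.2 ⟨hl, fun {a b} => ih a b⟩
    simp only [Term.allSyms_app]
    clear hl ih ht hu
    induction h with
    | nil => rfl
    | cons h _ ih => simp_all

theorem IsSubst.cut' [DecidableEq S] {σ : Subst S F} {X : List (Var S)}
    (h : ∀ x ∈ X, Sg.HasSort (σ x) x.1) : Sg.IsSubst (cut σ X) := by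
  intro x
  unfold cut
  split
  · exact h x ‹_›
  · exact .var x

/-- A deduction that starts at a term over `P` passes only through terms over `P`, so it can be
carried out in the restricted signature. -/
theorem EqMod.restrict {P : F → Prop} (hE : RespectsSyms P E) {t u : Tm S F}
    (h : Sg.EqMod E t u) (ht : t.AllSyms P) : (Sg.restrict P).EqMod E t u := by
  classical
  have hu := (h.allSyms hE).1 ht
  induction h with
  | refl h => exact .refl (wt_restrict.2 ⟨h, ht⟩)
  | symm _ ih => exact (ih hu ht).symm
  | trans h _ ih ih' => exact (ih ht ((h.allSyms hE).1 ht)).trans (ih' ((h.allSyms hE).1 ht) hu)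
  | @inst e σ he hσ =>
    -- Nothing is known about `σ` off the variables of the equation, so it is cut down to those of
    -- `e.1`; by regularity the same cut serves `e.2`.
    rw [← cut_subst σ (t := e.1) (fun _ h => h),
      ← cut_subst σ (t := e.2) (fun x h => ((hE _ he).1 x).2 h)]
    exact .inst he (IsSubst.cut' fun x hx => hasSort_restrict.2
      ⟨hσ x, (Term.allSyms_subst.1 ht).2 x hx⟩)
  | congr hl h hwt hwu ih =>
    rw [Term.allSyms_app] at ht hu
    exact .congr hl (fun t u h' => ih t u h' (ht.2 _ (List.of_mem_zip h').1)
      (hu.2 _ (List.of_mem_zip h').2)) (wt_restrict.2 ⟨hwt, Term.allSyms_app.2 ht⟩)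
      (wt_restrict.2 ⟨hwu, Term.allSyms_app.2 hu⟩)

theorem EqMod.hasSort (hE : ∀ e ∈ E, ∀ σ, Sg.IsSubst σ → ∀ s,
    Sg.HasSort (e.1.subst σ) s ↔ Sg.HasSort (e.2.subst σ) s) {t u : Tm S F}
    (h : Sg.EqMod E t u) (s : S) : Sg.HasSort t s ↔ Sg.HasSort u s := by
  induction h generalizing s with
  | refl h => rfl
  | symm _ ih => exact (ih s).symm
  | trans _ _ ih ih' => exact (ih s).trans (ih' s)
  | inst he hσ => exact hE _ he _ hσ s
  | congr hl _ ht hu ih =>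
    have h := List.forall₂_iff_zip.2 ⟨hl, fun {a b} => ih a b⟩
    exact ⟨fun h' => h'.args (h.imp fun _ _ h s => (h s).1),
      fun h' => h'.args (h.flip.imp fun _ _ h s => (h s).2)⟩

end Sig
end
end VarSat

/-! ### Rewriting in a decomposition: normal forms and the Church–Rosser property -/

namespace VarSat
section
variable {S F : Type} [PartialOrder S]

namespace RewTheory
variable {T : RewTheory S F}

theorem Step.mono {T' : RewTheory S F} (hs : ∀ f w s, T.sig.op f w s → T'.sig.op f w s)
    (ha : T.ax ⊆ T'.ax) (hr : T.rules ⊆ T'.rules) {t u : Tm S F} (h : T.Step t u) :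
    T'.Step t u := by
  induction h with
  | root he hσ h => exact .root (hr he) (fun x => (hσ x).mono hs) (h.mono hs ha)
  | arg _ ht hu ih =>
    exact .arg ih (ht.imp fun _ h => h.mono hs) (hu.imp fun _ h => h.mono hs)

theorem Step.subst {t u : Tm S F} (h : T.Step t u) {σ : Subst S F} (hσ : T.sig.IsSubst σ) :
    T.Step (t.subst σ) (u.subst σ) := by
  induction h with
  | root he hτ h =>
    rw [Term.subst_subst]
    refine .root he (hτ.comp hσ) ?_
    rw [← Term.subst_subst]
    exact h.subst hσ
  | arg _ ht hu ih =>
    have ht := ht.subst hσ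
    have hu := hu.subst hσ
    simp only [Term.subst, List.map_append, List.map_cons] at ht hu ⊢
    exact .arg ih ht hu

namespace IsDecomposition
variable (hT : T.IsDecomposition)
include hT

theorem wt_eqB {t u : Tm S F} (h : T.EqB t u) : T.sig.WT t ∧ T.sig.WT u :=
  Sig.EqMod.wt hT.ax_eqn h

theorem wt_eqE {t u : Tm S F} (h : T.EqE t u) : T.sig.WT t ∧ T.sig.WT u :=
  Sig.EqMod.wt (by rintro e (h | h); exacts [hT.ax_eqn e h, hT.rules_eqn e h]) h

omit hT in
theorem eqE_of_eqB {t u : Tm S F} (h : T.EqB t u) : T.EqE t u :=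
  Sig.EqMod.mono (fun _ _ _ h => h) Set.subset_union_left h

theorem eqB_hasSort {t u : Tm S F} (h : T.EqB t u) (s : S) :
    T.sig.HasSort t s ↔ T.sig.HasSort u s := Sig.EqMod.hasSort hT.ax_sort h s

theorem eqB_ground {t u : Tm S F} (h : T.EqB t u) : t.Ground ↔ u.Ground :=
  Sig.EqMod.ground hT.ax_regular h

theorem eqB_mem_vars {t u : Tm S F} (h : T.EqB t u) (x : Var S) : x ∈ t.vars ↔ x ∈ u.vars :=
  Sig.EqMod.mem_vars hT.ax_regular h x

theorem step_hasSort {t u : Tm S F} (h : T.Step t u) {s : S} (ht : T.sig.HasSort t s) :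
    T.sig.HasSort u s := by
  induction h generalizing s with
  | root he hσ h => exact hT.rules_sort _ he _ hσ s ((hT.eqB_hasSort h s).1 ht)
  | arg _ _ _ ih =>
    refine ht.args (List.rel_append (List.forall₂_same.2 fun _ _ _ h => h)
      (.cons (fun s h => ih h) (List.forall₂_same.2 fun _ _ _ h => h)))

omit hT in
theorem step_eqE {t u : Tm S F} (h : T.Step t u) : T.EqE t u := by
  induction h with
  | root he hσ h =>
    exact (eqE_of_eqB h).trans (.inst (Or.inr he) hσ)
  | @arg f l r t u _ ht hu ih =>
    refine .congr' ?_ ht hu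
    refine List.rel_append (List.forall₂_same.2 fun v hv => .refl (ht.arg (by simp [hv])))
      (.cons ih (List.forall₂_same.2 fun v hv => .refl (ht.arg (by simp [hv]))))

theorem step_vars {t u : Tm S F} (h : T.Step t u) : u.vars ⊆ t.vars := by
  induction h with
  | root he hσ h =>
    intro x hx
    rw [hT.eqB_mem_vars h]
    obtain ⟨y, hy, hxy⟩ := Term.mem_vars_subst.1 hx
    exact Term.mem_vars_subst.2 ⟨y, hT.rules_vars _ he hy, hxy⟩
  | arg _ _ _ ih =>
    intro x hx
    simp only [Term.vars, List.flatMap_append, List.flatMap_cons, List.mem_append] at hx ⊢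
    rcases hx with h | h | h
    exacts [.inl h, .inr (.inl (ih h)), .inr (.inr h)]

theorem step_wt {t u : Tm S F} (h : T.Step t u) : T.sig.WT t ∧ T.sig.WT u :=
  hT.wt_eqE (step_eqE h)

theorem steps_hasSort {t u : Tm S F} (h : Relation.ReflTransGen T.Step t u) {s : S}
    (ht : T.sig.HasSort t s) : T.sig.HasSort u s := by
  induction h with
  | refl => exact ht
  | tail _ h ih => exact hT.step_hasSort h ih

theorem steps_wt {t u : Tm S F} (h : Relation.ReflTransGen T.Step t u) (ht : T.sig.WT t) :
    T.sig.WT u := ht.imp fun _ ht => hT.steps_hasSort h ht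

omit hT in
theorem steps_eqE {t u : Tm S F} (h : Relation.ReflTransGen T.Step t u) (ht : T.sig.WT t) :
    T.EqE t u := by
  induction h with
  | refl => exact .refl ht
  | tail _ h ih => exact ih.trans (step_eqE h)

theorem steps_vars {t u : Tm S F} (h : Relation.ReflTransGen T.Step t u) : u.vars ⊆ t.vars := by
  induction h with
  | refl => exact fun _ h => h
  | tail _ h ih => exact fun _ hx => ih (hT.step_vars h hx)

omit hT in
theorem steps_of_irred {t u : Tm S F} (ht : T.Irred t) (h : Relation.ReflTransGen T.Step t u) :
    u = t := by
  rcases h.cases_head with h | ⟨v, h, _⟩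
  · exact h.symm
  · exact absurd h (ht v)

/-- By strict coherence, a step from `u` would be matched by one from `t`. -/
theorem irred_of_eqB {t u : Tm S F} (h : T.EqB t u) (ht : T.Irred t) : T.Irred u := by
  intro v hv
  obtain ⟨v', h', _⟩ := hT.coherent u v t hv h.symm
  exact ht v' h'

omit hT in
theorem irred_of_subst {t : Tm S F} {σ : Subst S F} (hσ : T.sig.IsSubst σ)
    (h : T.Irred (t.subst σ)) : T.Irred t := fun _ hu => h _ (hu.subst hσ)

/-- `Step.arg` requires the whole reduct to be well-sorted, which holds because rewriting an
argument keeps its sorts. -/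
theorem irred_arg {f : F} {ts : List (Tm S F)} (hw : T.sig.WT (.app f ts))
    (h : T.Irred (.app f ts)) {t : Tm S F} (ht : t ∈ ts) : T.Irred t := by
  intro u hu
  obtain ⟨l, r, rfl⟩ := List.append_of_mem ht
  refine h _ (.arg hu hw ?_)
  exact hw.imp fun _ hs => hs.args (List.rel_append (List.forall₂_same.2 fun _ _ _ h => h)
      (.cons (fun s h => hT.step_hasSort hu h) (List.forall₂_same.2 fun _ _ _ h => h)))

theorem irred_subst_var {t : Tm S F} {σ : Subst S F} (hw : T.sig.WT (t.subst σ))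
    (h : T.Irred (t.subst σ)) {x : Var S} (hx : x ∈ t.vars) :
    T.Irred (σ x) := by
  induction t using Term.induct with
  | hv y =>
    simp only [Term.vars, List.mem_singleton] at hx
    subst hx
    simpa only [Term.subst] using h
  | ha f ts ih =>
    obtain ⟨t, ht, hx⟩ := Term.mem_vars_app.1 hx
    rw [Term.subst] at h hw
    have hm := List.mem_map_of_mem (f := Term.subst σ) ht
    exact ih t ht (hw.arg hm) (hT.irred_arg hw h hm) hx

/-- That left-hand sides are not variables does not suffice, since an axiom may equate a variable
with a larger term. If `x` rewrote to `u`, then `u` would have the sort of `x`, and substituting any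
`t` of that sort for `x` would give a step from `t` to a term of that sort again. This would never
end, against termination. -/
theorem irred_var (x : Var S) : T.Irred (.var x) := by
  intro u hu
  have hs : T.sig.HasSort u x.1 := hT.step_hasSort hu (.var x)
  have key : ∀ t, ¬ T.sig.HasSort t x.1 := by
    intro t
    induction t using hT.terminating.induction with
    | _ t ih =>
      intro ht
      classical
      have hσ : T.sig.IsSubst fun y => if y = x then t else .var y := by
        intro y
        dsimp only
        split
        · subst y; exact ht
        · exact .var y
      have h := hu.subst hσ
      simp only [Term.subst, if_true] at h
      exact ih _ h (hs.subst hσ)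
  exact key _ (.var x)

theorem exists_nf (t : Tm S F) : ∃ u, T.NF t u := by
  induction t using hT.terminating.induction with
  | _ t ih =>
    by_cases h : T.Irred t
    · exact ⟨t, .refl, h⟩
    · simp only [Irred, not_forall, not_not] at h
      obtain ⟨u, hu⟩ := h
      obtain ⟨v, h, h'⟩ := ih u hu
      exact ⟨v, h.head hu, h'⟩

theorem nf_unique {t u v : Tm S F} (ht : T.sig.WT t) (hu : T.NF t u) (hv : T.NF t v) :
    T.EqB u v := by
  obtain ⟨w₁, w₂, h1, h2, h⟩ := hT.confluent t u v ht hu.1 hv.1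
  rwa [steps_of_irred hu.2 h1, steps_of_irred hv.2 h2] at h

/-- Rewriting modulo `B`-equality of the start. -/
theorem steps_coherent {t u t' : Tm S F} (h : Relation.ReflTransGen T.Step t u)
    (ht : T.EqB t t') : ∃ u', Relation.ReflTransGen T.Step t' u' ∧ T.EqB u u' := by
  induction h with
  | refl => exact ⟨t', .refl, ht⟩
  | tail _ h ih =>
    obtain ⟨u', h1, h2⟩ := ih
    obtain ⟨v', h3, h4⟩ := hT.coherent _ _ _ h h2
    exact ⟨v', h1.tail h3, h4⟩

theorem nf_of_eqB {t u v w : Tm S F} (h : T.EqB t u) (hv : T.NF t v) (hw : T.NF u w) :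
    T.EqB v w := by
  obtain ⟨v', h1, h2⟩ := hT.steps_coherent hv.1 h
  exact h2.trans (hT.nf_unique (hT.wt_eqB h).2 ⟨h1, hT.irred_of_eqB h2 hv.2⟩ hw)

theorem steps_arg {f : F} {l r : List (Tm S F)} {t u : Tm S F}
    (h : Relation.ReflTransGen T.Step t u) (hw : T.sig.WT (.app f (l ++ t :: r))) :
    Relation.ReflTransGen T.Step (.app f (l ++ t :: r)) (.app f (l ++ u :: r)) := by
  induction h with
  | refl => exact .refl
  | tail h hs ih =>
    have hw' := hT.steps_wt ih hw
    refine ih.tail (.arg hs hw' ?_)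
    exact hw'.imp fun _ hs' => hs'.args (List.rel_append (List.forall₂_same.2 fun _ _ _ h => h)
      (.cons (fun s h => hT.step_hasSort hs h) (List.forall₂_same.2 fun _ _ _ h => h)))

/-- The prefix `l` collects the arguments that are already rewritten, so that the induction works
from left to right. -/
theorem steps_args {f : F} {ts us : List (Tm S F)}
    (h : List.Forall₂ (Relation.ReflTransGen T.Step) ts us) (l : List (Tm S F))
    (hw : T.sig.WT (.app f (l ++ ts))) :
    Relation.ReflTransGen T.Step (.app f (l ++ ts)) (.app f (l ++ us)) := by
  induction h generalizing l with
  | nil => exact .refl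
  | @cons t u ts us h _ ih =>
    have h1 := hT.steps_arg h hw
    refine h1.trans ?_
    have := ih (l ++ [u])
    simp only [List.append_assoc, List.singleton_append] at this
    exact this (hT.steps_wt h1 hw)

/-- The Church–Rosser property modulo `B`, by induction on the deduction. Transitivity passes
through a normal form of the middle term, an axiom is handled by coherence, a rule by confluence. -/
theorem nf_of_eqE {t u : Tm S F} (h : T.EqE t u) :
    ∀ v w, T.NF t v → T.NF u w → T.EqB v w := by
  induction h with
  | refl ht => exact fun v w => hT.nf_unique ht
  | symm _ ih => exact fun v w hv hw => (ih w v hw hv).symm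
  | @trans t u v _ _ ih ih' =>
    intro a b ha hb
    obtain ⟨c, hc⟩ := hT.exists_nf u
    exact (ih a c ha hc).trans (ih' c b hc hb)
  | @inst e σ he hσ =>
    intro v w hv hw
    rcases he with he | he
    · exact hT.nf_of_eqB (.inst he hσ) hv hw
    · have hwt := (hT.rules_eqn _ he).left.subst hσ
      exact hT.nf_unique hwt hv ⟨hw.1.head (.root he hσ (.refl hwt)), hw.2⟩
  | @congr f ts us hl h ht hu ih =>
    intro v w hv hw
    -- For congruence the arguments are normalized first. The two applications are then `B`-equal,
    -- and coherence carries this over to their normal forms.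
    have hn : ∃ ts' us', List.Forall₂ (Relation.ReflTransGen T.Step) ts ts' ∧
        List.Forall₂ (Relation.ReflTransGen T.Step) us us' ∧ List.Forall₂ T.EqB ts' us' := by
      have h' : List.Forall₂ (fun t u => ∀ v w, T.NF t v → T.NF u w → T.EqB v w) ts us :=
        List.forall₂_iff_zip.2 ⟨hl, fun {a b} => ih a b⟩
      clear hl h ht hu hv hw ih
      induction h' with
      | nil => exact ⟨[], [], .nil, .nil, .nil⟩
      | @cons t u ts us h _ ih =>
        obtain ⟨ts', us', h1, h2, h3⟩ := ih
        obtain ⟨t', ht⟩ := hT.exists_nf t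
        obtain ⟨u', hu⟩ := hT.exists_nf u
        exact ⟨t' :: ts', u' :: us', .cons ht.1 h1, .cons hu.1 h2, .cons (h _ _ ht hu) h3⟩
    obtain ⟨ts', us', h1, h2, h3⟩ := hn
    have h1 := hT.steps_args h1 [] ht
    have h2 := hT.steps_args h2 [] hu
    obtain ⟨v', hv'⟩ := hT.exists_nf (.app f ts')
    obtain ⟨w', hw'⟩ := hT.exists_nf (.app f us')
    have h4 : T.EqB v' w' :=
      hT.nf_of_eqB (.congr' h3 (hT.steps_wt h1 ht) (hT.steps_wt h2 hu)) hv' hw'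
    exact ((hT.nf_unique ht hv ⟨h1.trans hv'.1, hv'.2⟩).trans h4).trans
      (hT.nf_unique hu ⟨h2.trans hw'.1, hw'.2⟩ hw)

theorem eqB_of_irred {t u : Tm S F} (h : T.EqE t u) (ht : T.Irred t) (hu : T.Irred u) :
    T.EqB t u := hT.nf_of_eqE h t u ⟨.refl, ht⟩ ⟨.refl, hu⟩

/-- By Church–Rosser no rewrite sequence has to be remembered: being a normal form of `t` up to `B`
amounts to being irreducible and `E`-equal to `t`. Variants are handled in this form. -/
theorem nfb_iff {t u : Tm S F} (ht : T.sig.WT t) : T.NFB t u ↔ T.EqE t u ∧ T.Irred u := by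
  constructor
  · rintro ⟨v, hv, h⟩
    exact ⟨(steps_eqE hv.1 ht).trans (eqE_of_eqB h.symm), hT.irred_of_eqB h.symm hv.2⟩
  · rintro ⟨h, hu⟩
    obtain ⟨v, hv⟩ := hT.exists_nf t
    exact ⟨v, hv, hT.nf_of_eqE h.symm u v ⟨.refl, hu⟩ hv⟩

omit hT in
theorem nf_eqE {t u : Tm S F} (ht : T.sig.WT t) (h : T.NF t u) : T.EqE t u := steps_eqE h.1 ht

/-- Every substitution has a normal form. -/
theorem exists_nf_subst {σ : Subst S F} (hσ : T.sig.IsSubst σ) : ∃ ρ, T.sig.IsSubst ρ ∧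
    (∀ x, T.Irred (ρ x)) ∧ (∀ x, T.EqE (σ x) (ρ x)) ∧ ∀ x, (ρ x).vars ⊆ (σ x).vars := by
  choose ρ hρ using fun x => hT.exists_nf (σ x)
  exact ⟨ρ, fun x => hT.steps_hasSort (hρ x).1 (hσ x), fun x => (hρ x).2,
    fun x => nf_eqE ⟨_, hσ x⟩ (hρ x), fun x => hT.steps_vars (hρ x).1⟩

end IsDecomposition
end RewTheory
end
end VarSat

/-! ### Renaming apart and variants of tuples -/

namespace VarSat
section
variable {S F : Type}

theorem lt_freshIdx {W : List (Var S)} {x : Var S} (h : x ∈ W) : x.2 < freshIdx W := by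
  induction W with
  | nil => simp at h
  | cons y W ih =>
    simp only [freshIdx, List.foldr_cons]
    rcases List.mem_cons.1 h with rfl | h
    · omega
    · have := ih h
      unfold freshIdx at this
      omega

/-- Precomposition with the inverse of `shift k`. -/
def unshift (k : ℕ) (ρ : Subst S F) : Subst S F := fun y => ρ (y.1, y.2 - k)

/-- The truncated subtraction in `unshift` is harmless, as `shift k` produces only indices that are
at least `k`. -/
theorem shift_unshift (k : ℕ) (ρ : Subst S F) (t : Tm S F) :
    (t.subst (shift k)).subst (unshift k ρ) = t.subst ρ := by
  rw [Term.subst_subst]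
  exact Term.subst_congr t fun x _ => by simp [shift, unshift, Term.subst]

theorem mem_vars_shift {k : ℕ} {t : Tm S F} {y : Var S} (h : y ∈ (t.subst (shift k)).vars) :
    k ≤ y.2 := by
  obtain ⟨x, _, h⟩ := Term.mem_vars_subst.1 h
  simp only [shift, Term.vars, List.mem_singleton] at h
  simp [h]

theorem fn_map [DecidableEq S] (σ : Subst S F) (X : List (Var S)) :
    ASubst.fn (X.map fun x => (x, σ x)) = Sig.cut σ X := by
  funext x
  unfold ASubst.fn Sig.cut
  induction X with
  | nil => simp
  | cons y X ih =>
    rw [List.map_cons, List.lookup_cons]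
    by_cases h : x = y
    · simp [h]
    · simp only [h, List.mem_cons, false_or] at ih ⊢
      rw [← ih]
      simp [beq_false_of_ne h]

variable [PartialOrder S]

theorem isSubst_shift {Sg : Sig S F} (k : ℕ) : Sg.IsSubst (shift k : Subst S F) :=
  fun x => .var (x.1, x.2 + k)

theorem Sig.IsSubst.unshift {Sg : Sig S F} {ρ : Subst S F} (h : Sg.IsSubst ρ) (k : ℕ) :
    Sg.IsSubst (unshift k ρ) := fun x => h (x.1, x.2 - k)

theorem List.exists_forall₂_map {α β γ : Type*} {R : α → β → Prop} {Q : α → γ → Prop}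
    {f : β → γ} {l : List α} {l' : List β} (h : List.Forall₂ R l l')
    (hf : ∀ a ∈ l, ∀ b ∈ l', R a b → Q a (f b)) : List.Forall₂ Q l (l'.map f) := by
  induction h with
  | nil => exact .nil
  | cons h _ ih =>
    exact .cons (hf _ (by simp) _ (by simp) h)
      (ih fun a ha b hb => hf a (by simp [ha]) b (by simp [hb]))

namespace RewTheory
variable {T : RewTheory S F} (hT : T.IsDecomposition)
include hT

namespace IsDecomposition

omit hT in
theorem irred_shift {t : Tm S F} (h : T.Irred t) (k : ℕ) : T.Irred (t.subst (shift k)) := by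
  refine irred_of_subst (Sig.isSubst_var.unshift k) ?_
  rwa [shift_unshift, Term.subst_var]

/-- If an instance of `t` is `B`-equal to an irreducible term, then `t` is irreducible. -/
theorem irred_of_eqB_subst {t u : Tm S F} {ρ : Subst S F} (hρ : T.sig.IsSubst ρ)
    (h : T.EqB (t.subst ρ) u) (hu : T.Irred u) : T.Irred t :=
  irred_of_subst hρ (hT.irred_of_eqB h.symm hu)

omit hT in
theorem eqE_subst_congr {t : Tm S F} (ht : T.sig.WT t) {σ τ : Subst S F} (hσ : T.sig.IsSubst σ)
    (hτ : T.sig.IsSubst τ) (h : ∀ x ∈ t.vars, T.EqE (σ x) (τ x)) :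
    T.EqE (t.subst σ) (t.subst τ) := Sig.EqMod.subst_congr ht hσ hτ h

theorem irred_cut [DecidableEq S] {γ : Subst S F} {X : List (Var S)}
    (h : ∀ x ∈ X, T.Irred (γ x)) (x : Var S) : T.Irred (Sig.cut γ X x) := by
  unfold Sig.cut
  split
  · exact h x ‹_›
  · exact hT.irred_var x

/-- A normalized substitution gives variants. -/
theorem isVariant_cut [DecidableEq S] {ts vs : List (Tm S F)} {γ : Subst S F}
    (hγ : T.sig.IsSubst γ) (hn : ∀ x, T.Irred (γ x))
    (h : List.Forall₂ (fun t v => T.NFB (t.subst γ) v) ts vs) :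
    T.IsVariant ts vs (Sig.cut γ (ts.flatMap Term.vars)) where
  subst := .cut' fun x _ => hγ x
  dom x hx := if_neg hx
  normal := hT.irred_cut fun x _ => hn x
  nf := by
    refine List.forall₂_iff_zip.2 ⟨h.length_eq, fun {t v} htv => ?_⟩
    rw [Sig.cut_subst γ fun x hx => List.mem_flatMap.2 ⟨t, (List.of_mem_zip htv).1, hx⟩]
    exact (List.forall₂_iff_zip.1 h).2 htv

/-- `E`-equality passes to instances, so an instance of a variant is again a normal form as soon as
it is irreducible. Agreement of `θ'` with `θα` is asked only modulo `E`, which lets the lemma serve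
both for renamings and for combinations by unifiers. -/
theorem nf_inst {ts us : List (Tm S F)} {θ : Subst S F}
    (hts : ∀ t ∈ ts, T.sig.WT t) (hθ : T.sig.IsSubst θ)
    (hv : List.Forall₂ (fun t u => T.NFB (t.subst θ) u) ts us) {α θ' : Subst S F}
    (hα : T.sig.IsSubst α) (hθ' : T.sig.IsSubst θ')
    (he : ∀ x ∈ ts.flatMap Term.vars, T.EqE ((θ x).subst α) (θ' x))
    (hu : ∀ u ∈ us, T.Irred (u.subst α)) :
    List.Forall₂ (fun t u => T.NFB (t.subst θ') u) ts (us.map (Term.subst α)) := by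
  refine List.exists_forall₂_map hv fun t ht u hu' h => ?_
  refine (hT.nfb_iff ((hts t ht).subst hθ')).2 ⟨?_, hu u hu'⟩
  have h1 := ((hT.nfb_iff ((hts t ht).subst hθ)).1 h).1
  have h2 : T.EqE ((t.subst θ).subst α) (u.subst α) := h1.subst hα
  rw [Term.subst_subst] at h2
  refine Sig.EqMod.trans (Sig.EqMod.symm ?_) h2
  exact eqE_subst_congr (hts t ht) (hθ.comp hα) hθ' fun x hx =>
    he x (List.mem_flatMap.2 ⟨t, ht, hx⟩)

/-- A variant of the concatenation that is covered on each part, by `ρ₁` and by `ρ₂`, makes the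
substitutions `θ₁` and `θ₂` agree on the shared variables. After renaming the second part apart,
`ρ₁` and `ρ₂` merge into one `B`-unifier, so it is enough to instantiate both parts by a complete
set of `B`-unifiers. -/
theorem combine_variants [DecidableEq S] [Primcodable S] [Primcodable F]
    (hU : T.sig.FinitaryUnif T.ax) {ts₁ ts₂ us₁ us₂ : List (Tm S F)}
    {θ₁ θ₂ : Subst S F} (h1 : T.IsVariant ts₁ us₁ θ₁) (h2 : T.IsVariant ts₂ us₂ θ₂)
    (hts₁ : ∀ t ∈ ts₁, T.sig.WT t) (hts₂ : ∀ t ∈ ts₂, T.sig.WT t) :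
    ∃ V : List (List (Tm S F) × Subst S F),
      (∀ p ∈ V, T.IsVariant (ts₁ ++ ts₂) p.1 p.2) ∧
      ∀ vs₁ vs₂ γ, T.IsVariant (ts₁ ++ ts₂) (vs₁ ++ vs₂) γ →
        T.MoreGeneral ts₁ us₁ θ₁ vs₁ γ → T.MoreGeneral ts₂ us₂ θ₂ vs₂ γ →
        ∃ p ∈ V, T.MoreGeneral (ts₁ ++ ts₂) p.1 p.2 (vs₁ ++ vs₂) γ := by
  classical
  obtain ⟨alg, -, hA⟩ := hU
  set X₁ := ts₁.flatMap Term.vars with hX₁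
  set X₂ := ts₂.flatMap Term.vars with hX₂
  set W₀ := X₁.flatMap (fun x => (θ₁ x).vars) ++ us₁.flatMap Term.vars with hW₀
  set k := freshIdx W₀ with hk
  set θ' : Subst S F := fun x => (θ₂ x).subst (shift k) with hθ'
  -- The unification problem: both substitutions have to take `B`-equal values at the variables that
  -- occur in both tuples.
  set φ : Conj S F := (X₁.filter (· ∈ X₂)).map fun x => (θ₁ x, θ' x) with hφ
  set W := φ.vars ++ W₀ ++ (X₂.flatMap (fun x => (θ' x).vars) ++
    us₂.flatMap fun u => (u.subst (shift k)).vars) with hW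
  have hθs : T.sig.IsSubst θ' := h2.subst.comp (isSubst_shift k)
  have hA := hA φ W (by
    intro e he
    obtain ⟨x, -, rfl⟩ := List.mem_map.1 he
    exact ⟨x.1, h1.subst x, hθs x⟩) (by rw [hW]; intro x hx; simp [hx])
  let mk (α : Subst S F) : List (Tm S F) × Subst S F :=
    (us₁.map (Term.subst α) ++ us₂.map fun u => (u.subst (shift k)).subst α,
      fun x => if x ∈ X₁ then (θ₁ x).subst α else if x ∈ X₂ then (θ' x).subst α else .var x)
  -- A unifier can make some term reducible and then yields no variant. Such unifiers are dropped;
  -- those needed for completeness remain, as they have an irreducible instance.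
  refine ⟨((alg φ W).map fun α => mk α.fn).filter fun p => T.IsVariant (ts₁ ++ ts₂) p.1 p.2,
    fun p hp => by simpa using (List.mem_filter.1 hp).2, ?_⟩
  rintro vs₁ vs₂ γ hγ ⟨ρ₁, hρ₁, he₁, hu₁⟩ ⟨ρ₂, hρ₂, he₂, hu₂⟩
  -- The renamed variables have indices at least `k`, above all those in `W₀`, so the two cases do
  -- not interfere.
  set σ : Subst S F := fun y => if y ∈ W₀ then ρ₁ y else unshift k ρ₂ y with hσ
  have hσs : T.sig.IsSubst σ := fun y => by
    rw [hσ]; dsimp only; split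
    exacts [hρ₁ y, hρ₂.unshift k y]
  have hσ1 : ∀ t : Tm S F, t.vars ⊆ W₀ → t.subst σ = t.subst ρ₁ := fun t ht =>
    Term.subst_congr t fun x hx => if_pos (ht hx)
  have hσ2 : ∀ t : Tm S F, (t.subst (shift k)).subst σ = t.subst ρ₂ := fun t => by
    rw [← shift_unshift k ρ₂ t]
    refine Term.subst_congr _ fun x hx => if_neg fun hx' => ?_
    have := mem_vars_shift hx
    have := lt_freshIdx hx'
    omega
  have hX₁v : ∀ x ∈ X₁, (θ₁ x).vars ⊆ W₀ := fun x hx y hy => by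
    rw [hW₀]; exact List.mem_append_left _ (List.mem_flatMap.2 ⟨x, hx, hy⟩)
  have hus₁v : ∀ u ∈ us₁, u.vars ⊆ W₀ := fun u hu y hy => by
    rw [hW₀]; exact List.mem_append_right _ (List.mem_flatMap.2 ⟨u, hu, hy⟩)
  have hes₁ : ∀ x ∈ X₁, T.EqB ((θ₁ x).subst σ) (γ x) := fun x hx => by
    rw [hσ1 _ (hX₁v x hx)]; exact he₁ x hx
  have hes₂ : ∀ x ∈ X₂, T.EqB ((θ' x).subst σ) (γ x) := fun x hx => by
    rw [hσ2]; exact he₂ x hx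
  obtain ⟨α, hα, ρ, hρ, hσρ⟩ := hA.2 σ ⟨hσs, by
    intro e he
    obtain ⟨x, hx, rfl⟩ := List.mem_map.1 he
    rw [List.mem_filter] at hx
    exact (hes₁ x hx.1).trans (hes₂ x (by simpa using hx.2)).symm⟩
  obtain ⟨⟨hαs, hαu⟩, -⟩ := hA.1 α hα
  have hσα : ∀ t : Tm S F, T.sig.WT t → t.vars ⊆ W →
      T.EqB (t.subst σ) ((t.subst α.fn).subst ρ) := fun t ht hv => by
    rw [Term.subst_subst]
    exact Sig.EqMod.subst_congr ht hσs (hαs.comp hρ) fun x hx => hσρ x (hv hx)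
  have hW₀W : W₀ ⊆ W := fun x hx => by rw [hW]; simp [hx]
  have hX₂W : ∀ x ∈ X₂, (θ' x).vars ⊆ W := fun x hx y hy => by
    rw [hW]
    exact List.mem_append_right _ (List.mem_append_left _ (List.mem_flatMap.2 ⟨x, hx, hy⟩))
  have hus₂W : ∀ u ∈ us₂, (u.subst (shift k)).vars ⊆ W := fun u hu y hy => by
    rw [hW]
    exact List.mem_append_right _ (List.mem_append_right _ (List.mem_flatMap.2 ⟨u, hu, hy⟩))
  have hg₁ : ∀ x ∈ X₁, T.EqB (((θ₁ x).subst α.fn).subst ρ) (γ x) := fun x hx =>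
    (hσα _ ⟨_, h1.subst x⟩ (List.Subset.trans (hX₁v x hx) hW₀W)).symm.trans (hes₁ x hx)
  have hg₂ : ∀ x ∈ X₂, T.EqB (((θ' x).subst α.fn).subst ρ) (γ x) := fun x hx =>
    (hσα _ ⟨_, hθs x⟩ (hX₂W x hx)).symm.trans (hes₂ x hx)
  have hmks : T.sig.IsSubst (mk α.fn).2 := fun x => by
    dsimp only [mk]
    split_ifs
    exacts [(h1.subst x).subst hαs, (hθs x).subst hαs, .var x]
  have hmkg : ∀ x ∈ (ts₁ ++ ts₂).flatMap Term.vars, T.EqB (((mk α.fn).2 x).subst ρ) (γ x) := by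
    intro x hx
    dsimp only [mk]
    rw [List.flatMap_append, List.mem_append] at hx
    split_ifs with h h'
    exacts [hg₁ x h, hg₂ x h', absurd hx (by simp [← hX₁, ← hX₂, h, h'])]
  have hwt₁ : ∀ u ∈ us₁, T.sig.WT u := fun u hu => by
    obtain ⟨t, -, v, -, h⟩ := h1.nf.flip.exists_of_mem_left hu
    exact (hT.wt_eqB h).1
  have hwt₂ : ∀ u ∈ us₂, T.sig.WT u := fun u hu => by
    obtain ⟨t, -, v, -, h⟩ := h2.nf.flip.exists_of_mem_left hu
    exact (hT.wt_eqB h).1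
  have hsplit := List.forall₂_iff_zip.1 hγ.nf
  have hlen : ts₁.length = vs₁.length := h1.nf.length_eq.trans hu₁.length_eq
  have hnf₁ : List.Forall₂ (fun t v => T.NFB (t.subst γ) v) ts₁ vs₁ := by
    have := List.forall₂_take ts₁.length hγ.nf
    rwa [List.take_left, hlen, List.take_left] at this
  have hnf₂ : List.Forall₂ (fun t v => T.NFB (t.subst γ) v) ts₂ vs₂ := by
    have := List.forall₂_drop ts₁.length hγ.nf
    rwa [List.drop_left, hlen, List.drop_left] at this
  have hirr : ∀ {ts vs : List (Tm S F)},
      List.Forall₂ (fun t v => T.NFB (t.subst γ) v) ts vs → ∀ v ∈ vs, T.Irred v := by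
    intro ts vs h v hv
    obtain ⟨t, -, w, hw, h⟩ := h.flip.exists_of_mem_left hv
    exact hT.irred_of_eqB h.symm hw.2
  have hm₁ : List.Forall₂ (fun u v => T.EqB ((u.subst α.fn).subst ρ) v) us₁ vs₁ := by
    refine List.forall₂_iff_zip.2 ⟨hu₁.length_eq, fun {u v} huv => ?_⟩
    have hm := (List.of_mem_zip huv).1
    have := (List.forall₂_iff_zip.1 hu₁).2 huv
    rw [← hσ1 u (hus₁v u hm)] at this
    exact (hσα u (hwt₁ u hm) (List.Subset.trans (hus₁v u hm) hW₀W)).symm.trans this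
  have hm₂ : List.Forall₂ (fun u v => T.EqB (((u.subst (shift k)).subst α.fn).subst ρ) v)
      us₂ vs₂ := by
    refine List.forall₂_iff_zip.2 ⟨hu₂.length_eq, fun {u v} huv => ?_⟩
    have hm := (List.of_mem_zip huv).1
    have := (List.forall₂_iff_zip.1 hu₂).2 huv
    rw [← hσ2 u] at this
    exact (hσα _ ((hwt₂ u hm).subst (isSubst_shift k)) (hus₂W u hm)).symm.trans this
  refine ⟨mk α.fn, List.mem_filter.2 ⟨List.mem_map_of_mem hα, ?_⟩, ρ, hρ, hmkg, ?_⟩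
  · rw [decide_eq_true_iff]
    refine ⟨hmks, fun x hx => ?_, fun x => ?_, ?_⟩
    · rw [List.flatMap_append, List.mem_append, not_or] at hx
      dsimp only [mk]
      rw [if_neg hx.1, if_neg hx.2]
    · by_cases hx : x ∈ (ts₁ ++ ts₂).flatMap Term.vars
      · exact hT.irred_of_eqB_subst hρ (hmkg x hx) (hγ.normal x)
      · rw [List.flatMap_append, List.mem_append, not_or] at hx
        dsimp only [mk]
        rw [if_neg hx.1, if_neg hx.2]
        exact hT.irred_var x
    · refine List.rel_append ?_ ?_
      · refine hT.nf_inst hts₁ h1.subst h1.nf hαs hmks (fun x hx => ?_) fun u hu => ?_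
        · dsimp only [mk]
          rw [if_pos hx]
          exact .refl (Sig.WT.subst ⟨_, h1.subst x⟩ hαs)
        · obtain ⟨v, hv, h⟩ := hm₁.exists_of_mem_left hu
          exact hT.irred_of_eqB_subst hρ h (hirr hnf₁ v hv)
      · have hc := hT.nf_inst hts₂ h2.subst h2.nf ((isSubst_shift k).comp hαs) hmks
          (fun x hx => ?_) fun u hu => ?_
        · convert hc using 2
          funext u
          exact Term.subst_subst u _ _
        · rw [← Term.subst_subst]
          dsimp only [mk]
          by_cases h : x ∈ X₁
          · rw [if_pos h]
            exact (eqE_of_eqB (hαu (θ₁ x, θ' x) (List.mem_map.2 ⟨x, List.mem_filter.2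
              ⟨h, decide_eq_true hx⟩, rfl⟩))).symm
          · rw [if_neg h, if_pos hx]
            exact .refl (Sig.WT.subst ⟨_, hθs x⟩ hαs)
        · rw [← Term.subst_subst]
          obtain ⟨v, hv, h⟩ := hm₂.exists_of_mem_left hu
          exact hT.irred_of_eqB_subst hρ h (hirr hnf₂ v hv)
  · refine List.rel_append ?_ ?_
    · rwa [List.forall₂_map_left_iff]
    · rwa [List.forall₂_map_left_iff]

/-- The finite variant property, for tuples of terms. -/
theorem exists_variants [DecidableEq S] [Primcodable S] [Primcodable F]
    (hU : T.sig.FinitaryUnif T.ax) (hF : T.FVP) (ts : List (Tm S F))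
    (hts : ∀ t ∈ ts, T.sig.WT t) :
    ∃ V : List (List (Tm S F) × Subst S F), (∀ p ∈ V, T.IsVariant ts p.1 p.2) ∧
      ∀ vs γ, T.IsVariant ts vs γ → ∃ p ∈ V, T.MoreGeneral ts p.1 p.2 vs γ := by
  induction ts with
  | nil =>
    refine ⟨[([], .var)], ?_, ?_⟩
    · simp only [List.mem_singleton, forall_eq]
      exact ⟨Sig.isSubst_var, fun _ _ => rfl, hT.irred_var, .nil⟩
    · intro vs γ h
      have : vs = [] := by simpa using h.nf
      subst this
      exact ⟨_, List.mem_singleton.2 rfl, γ, h.subst, by simp, .nil⟩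
  | cons t ts ih =>
    obtain ⟨V₁, hf, hV₁, hc₁⟩ := hF t (hts t (by simp))
    obtain ⟨V₂, hV₂, hc₂⟩ := ih fun t ht => hts t (by simp [ht])
    have key := fun (p : {p // p ∈ hf.toFinset.toList}) (q : {q // q ∈ V₂}) =>
      hT.combine_variants hU (hV₁ p.1 (by simpa using p.2)) (hV₂ q.1 q.2)
        (fun t' ht' => hts t' (by simp_all)) (fun t ht => hts t (by simp [ht]))
    choose V hV hc using key
    refine ⟨hf.toFinset.toList.attach.flatMap fun p => V₂.attach.flatMap fun q => V p q, ?_, ?_⟩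
    · intro r hr
      simp only [List.mem_flatMap] at hr
      obtain ⟨p, -, q, -, hr⟩ := hr
      exact hV p q r hr
    · intro vs γ hγ
      obtain ⟨v, vs, rfl⟩ : ∃ v vs', vs = v :: vs' := by
        have := hγ.nf
        cases this
        exact ⟨_, _, rfl⟩
      obtain ⟨h, h'⟩ := List.forall₂_cons.1 hγ.nf
      -- A variant substitution must be the identity off the variables of its tuple, so `γ` is cut
      -- down separately for the head and for the tail.
      obtain ⟨p, hp, ρ₁, hρ₁, hx₁, hm₁⟩ := hc₁ v _ (hT.isVariant_cut (ts := [t]) hγ.subst hγ.normal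
        (.cons h .nil))
      obtain ⟨q, hq, ρ₂, hρ₂, hx₂, hm₂⟩ := hc₂ vs _ (hT.isVariant_cut hγ.subst hγ.normal h')
      obtain ⟨r, hr, hm⟩ := hc ⟨p, by simpa using hp⟩ ⟨q, hq⟩ [v] vs γ hγ
        ⟨ρ₁, hρ₁, fun x hx => by have := hx₁ x hx; rwa [Sig.cut, if_pos hx] at this, hm₁⟩
        ⟨ρ₂, hρ₂, fun x hx => by have := hx₂ x hx; rwa [Sig.cut, if_pos hx] at this, hm₂⟩
      refine ⟨r, ?_, hm⟩
      simp only [List.mem_flatMap]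
      exact ⟨_, List.mem_attach _ _, _, List.mem_attach _ _, hr⟩

end IsDecomposition
end RewTheory
end
end VarSat

/-! ### Complete sets of variants and of unifiers away from given variables -/

namespace VarSat
section
variable {S F : Type}

theorem Conj.mem_vars {D : Conj S F} {x : Var S} :
    x ∈ D.vars ↔ ∃ e ∈ D, x ∈ e.1.vars ∨ x ∈ e.2.vars := by
  simp [Conj.vars, Eqn.vars]

theorem Conj.sides_vars (D : Conj S F) : D.sides.flatMap Term.vars = D.vars := by
  simp only [Conj.sides, Conj.vars, List.flatMap_assoc]
  congr 1
  funext e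
  simp [Eqn.vars]

theorem Conj.mem_sides {D : Conj S F} {t : Tm S F} :
    t ∈ D.sides ↔ ∃ e ∈ D, t = e.1 ∨ t = e.2 := by
  simp [Conj.sides]

theorem Conj.forall₂_sides {R : Tm S F → Tm S F → Prop} {D D' : Conj S F} :
    List.Forall₂ R D.sides D'.sides ↔
      List.Forall₂ (fun e e' => R e.1 e'.1 ∧ R e.2 e'.2) D D' := by
  induction D generalizing D' with
  | nil => cases D' <;> simp [Conj.sides]
  | cons e D ih =>
    cases D' with
    | nil => simp [Conj.sides]
    | cons e' D' =>
      simp only [Conj.sides, List.flatMap_cons, List.cons_append, List.nil_append,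
        List.forall₂_cons] at ih ⊢
      rw [ih, and_assoc]

theorem Conj.exists_sides (n : ℕ) (us : List (Tm S F)) (h : us.length = 2 * n) :
    ∃ D : Conj S F, D.sides = us := by
  induction n generalizing us with
  | zero => exact ⟨[], (List.length_eq_zero_iff.1 h).symm⟩
  | succ n ih =>
    match us, h with
    | u :: v :: us, h =>
      obtain ⟨D, hD⟩ := ih us (by simp at h; omega)
      exact ⟨(u, v) :: D, by rw [← hD]; rfl⟩

theorem Conj.length_sides (D : Conj S F) : D.sides.length = 2 * D.length := by
  induction D with
  | nil => rfl
  | cons e D ih => simp only [Conj.sides, List.flatMap_cons, List.length_append,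
      List.length_cons, List.length_nil] at ih ⊢; omega

/-- Every variable in a value has index at least `freshIdx W` and hence lies outside `W ⊇ X`. This
yields all three requirements: no variable in `X` is fixed, the range avoids `W`, and the
substitution is idempotent. -/
theorem away_shift [DecidableEq S] {X W : List (Var S)} (hX : X ⊆ W) (θ : Subst S F) :
    Away (ASubst.fn (X.map fun x => (x, (θ x).subst (shift (freshIdx W))))) X W := by
  rw [fn_map _ X]
  have hW : ∀ x, ∀ y ∈ ((θ x).subst (shift (freshIdx W))).vars, y ∉ W := fun x y hy hyW => by
    have := mem_vars_shift hy
    have := lt_freshIdx hyW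
    omega
  refine ⟨fun x => ⟨fun h => ?_, fun h he => ?_⟩, fun x hx y hy => ?_, fun x => ?_⟩
  · by_contra hx
    exact h (if_neg hx)
  · rw [Sig.cut, if_pos h] at he
    exact hW x x (by rw [he]; simp [Term.vars]) (hX h)
  · rw [Sig.cut, if_pos hx] at hy
    exact hW x y hy
  · by_cases hx : x ∈ X
    · rw [Sig.cut, if_pos hx]
      refine (Term.subst_congr _ fun y hy => ?_).trans (Term.subst_var _)
      exact if_neg fun h => hW x y hy (hX h)
    · rw [Sig.cut, if_neg hx, Term.subst, Sig.cut, if_neg hx]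

variable [PartialOrder S]

namespace RewTheory
variable {T : RewTheory S F} (hT : T.IsDecomposition)
include hT

namespace IsDecomposition

/-- The variants of the tuple are shifted beyond `W`, and the inverse shift shows that nothing of
their generality is lost. The hypothesis `hg` reads a tuple back as a term or a conjunction. -/
theorem exists_completeVariants [DecidableEq S] [Primcodable S] [Primcodable F]
    (hU : T.sig.FinitaryUnif T.ax) (hF : T.FVP) {α : Type} (g : α → List (Tm S F)) (a : α)
    (hg : ∀ us, us.length = (g a).length → ∃ b, g b = us) (W : List (Var S))
    (ha : ∀ t ∈ g a, T.sig.WT t) (hW : (g a).flatMap Term.vars ⊆ W) :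
    ∃ V, T.IsCompleteVariants g a W V := by
  classical
  obtain ⟨V, hV, hc⟩ := hT.exists_variants hU hF (g a) ha
  set k := freshIdx W with hk
  set X := (g a).flatMap Term.vars with hX
  have : Nonempty α := ⟨a⟩
  choose! inv hinv using hg
  refine ⟨V.map fun p => (inv (p.1.map (Term.subst (shift k))),
    X.map fun x => (x, (p.2 x).subst (shift k))), ?_, ?_⟩
  · intro q hq
    obtain ⟨p, hp, rfl⟩ := List.mem_map.1 hq
    have hv := hV p hp
    refine ⟨?_, away_shift hW p.2⟩
    dsimp only
    rw [hinv _ (by simpa using hv.nf.length_eq.symm), fn_map _ X]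
    have hs : T.sig.IsSubst fun x => (p.2 x).subst (shift k) := hv.subst.comp (isSubst_shift k)
    refine hT.isVariant_cut hs (fun x => irred_shift (hv.normal x) k) ?_
    refine hT.nf_inst ha hv.subst hv.nf (isSubst_shift k) hs
      (fun x _ => .refl ⟨_, hs x⟩) fun u hu => ?_
    obtain ⟨t, -, w, hw, h⟩ := hv.nf.flip.exists_of_mem_left hu
    exact irred_shift (hT.irred_of_eqB h.symm hw.2) k
  · intro vs γ hγ
    obtain ⟨p, hp, ρ, hρ, h1, h2⟩ := hc vs γ hγ
    refine ⟨_, List.mem_map_of_mem hp, unshift k ρ, hρ.unshift k, fun x hx => ?_, ?_⟩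
    · rw [fn_map _ X, Sig.cut, if_pos hx, shift_unshift]
      exact h1 x hx
    · dsimp only
      rw [hinv _ (by simpa using (hV p hp).nf.length_eq.symm), List.forall₂_map_left_iff]
      simpa only [shift_unshift] using h2

theorem exists_conjVariants [DecidableEq S] [Primcodable S] [Primcodable F]
    (hU : T.sig.FinitaryUnif T.ax) (hF : T.FVP) (D : Conj S F) (W : List (Var S))
    (hD : ∀ e ∈ D, T.sig.IsEqn e) (hW : D.vars ⊆ W) :
    ∃ V, T.IsCompleteVariants Conj.sides D W V := by
  refine hT.exists_completeVariants hU hF Conj.sides D (fun us h => ?_) W (fun t ht => ?_) ?_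
  · exact Conj.exists_sides D.length us (h.trans D.length_sides)
  · obtain ⟨e, he, rfl | rfl⟩ := Conj.mem_sides.1 ht
    exacts [(hD e he).left, (hD e he).right]
  · rwa [Conj.sides_vars]

/-- The normal form of an instance of a conjunction yields a variant. -/
theorem exists_isVariant_conj [DecidableEq S] {D : Conj S F} (hD : ∀ e ∈ D, T.sig.IsEqn e)
    {γ : Subst S F} (hγ : T.sig.IsSubst γ) (hn : ∀ x, T.Irred (γ x)) :
    ∃ D' : Conj S F, T.IsVariant D.sides D'.sides (Sig.cut γ D.vars) ∧
      List.Forall₂ (fun e e' => T.NF (e.1.subst γ) e'.1 ∧ T.NF (e.2.subst γ) e'.2) D D' := by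
  choose nf hnf using hT.exists_nf
  have h : List.Forall₂ (fun e e' => T.NF (e.1.subst γ) e'.1 ∧ T.NF (e.2.subst γ) e'.2) D
      (D.map fun e => (nf (e.1.subst γ), nf (e.2.subst γ))) := by
    rw [List.forall₂_map_right_iff, List.forall₂_same]
    exact fun e _ => ⟨hnf _, hnf _⟩
  refine ⟨_, ?_, h⟩
  rw [← Conj.sides_vars]
  refine hT.isVariant_cut hγ hn ?_
  have h' : List.Forall₂ (fun e e' => T.NFB (e.1.subst γ) e'.1 ∧ T.NFB (e.2.subst γ) e'.2) D
      (D.map fun e => (nf (e.1.subst γ), nf (e.2.subst γ))) := by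
    rw [List.forall₂_map_right_iff, List.forall₂_same]
    exact fun e he => ⟨⟨_, hnf _, .refl (hT.steps_wt (hnf _).1 ((hD e he).left.subst hγ))⟩,
      ⟨_, hnf _, .refl (hT.steps_wt (hnf _).1 ((hD e he).right.subst hγ))⟩⟩
  exact Conj.forall₂_sides.2 h'

theorem isEqn_of_isVariant {D D' : Conj S F} {θ : Subst S F} (hD : ∀ e ∈ D, T.sig.IsEqn e)
    (h : T.IsVariant D.sides D'.sides θ) : ∀ e ∈ D', T.sig.IsEqn e := by
  intro e' he'
  obtain ⟨e, he, ⟨v, hv, h1⟩, ⟨v', hv', h2⟩⟩ :=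
    (Conj.forall₂_sides.1 h.nf).flip.exists_of_mem_left he'
  obtain ⟨s, hs, hs'⟩ := hD e he
  exact ⟨s, (hT.eqB_hasSort h1 s).2 (hT.steps_hasSort hv.1 (hs.subst h.subst)),
    (hT.eqB_hasSort h2 s).2 (hT.steps_hasSort hv'.1 (hs'.subst h.subst))⟩

/-- For each variant of the system its sides are `B`-unified, and the variant substitution is
composed with the unifier. This covers a normalized `E`-unifier `β`: by Church–Rosser the normal
forms of the two sides of each `β`-instance are `B`-equal, so the substitution that exhibits them as
instances of a variant is a `B`-unifier of that variant. -/
theorem exists_varUnif [DecidableEq S] [Primcodable S] [Primcodable F]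
    (hU : T.sig.FinitaryUnif T.ax) (hF : T.FVP) (φ : Conj S F) (W : List (Var S))
    (hφ : ∀ e ∈ φ, T.sig.IsEqn e) (hW : φ.vars ⊆ W) : ∃ U, T.IsVarUnif φ W U := by
  classical
  obtain ⟨V, hV, hc⟩ := hT.exists_conjVariants hU hF φ W hφ hW
  obtain ⟨alg, -, hA⟩ := hU
  set k := freshIdx W with hk
  let W' (p : Conj S F × ASubst S F) : List (Var S) :=
    p.1.vars ++ φ.vars.flatMap fun x => (p.2.fn x).vars
  have hp1 : ∀ p ∈ V, ∀ e ∈ p.1, T.sig.IsEqn e := fun p hp =>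
    hT.isEqn_of_isVariant hφ (hV p hp).1
  have hA : ∀ p ∈ V, T.sig.IsCompleteUnif T.ax p.1 (W' p) (alg p.1 (W' p)) := fun p hp =>
    hA p.1 (W' p) (hp1 p hp) fun x hx => List.mem_append_left _ hx
  refine ⟨V.flatMap fun p => (alg p.1 (W' p)).map fun α =>
    φ.vars.map fun x => (x, ((p.2.fn x).subst α.fn).subst (shift k)), ?_, ?_⟩
  · intro θ hθ
    obtain ⟨p, hp, hθ⟩ := List.mem_flatMap.1 hθ
    obtain ⟨α, hα, rfl⟩ := List.mem_map.1 hθ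
    refine ⟨?_, away_shift hW fun x => (p.2.fn x).subst α.fn⟩
    rw [fn_map (fun x => ((p.2.fn x).subst α.fn).subst (shift k))]
    obtain ⟨⟨hαs, hαu⟩, -⟩ := (hA p hp).1 α hα
    have hps := (hV p hp).1.subst
    refine ⟨.cut' fun x _ => ((hps x).subst hαs).subst (isSubst_shift k), fun e he => ?_⟩
    obtain ⟨e', he', h1, h2⟩ :=
      (Conj.forall₂_sides.1 (hV p hp).1.nf).exists_of_mem_left he
    rw [Sig.cut_subst _ (fun x hx => Conj.mem_vars.2 ⟨e, he, .inl hx⟩),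
      Sig.cut_subst _ (fun x hx => Conj.mem_vars.2 ⟨e, he, .inr hx⟩)]
    simp only [← Term.subst_subst]
    have h1 := ((hT.nfb_iff ((hφ e he).left.subst hps)).1 h1).1
    have h2 := ((hT.nfb_iff ((hφ e he).right.subst hps)).1 h2).1
    have h3 : T.EqE ((e.1.subst p.2.fn).subst α.fn) ((e.2.subst p.2.fn).subst α.fn) :=
      ((h1.subst hαs).trans (eqE_of_eqB (hαu e' he'))).trans (h2.subst hαs).symm
    exact h3.subst (isSubst_shift k)
  · rintro β ⟨hβ, hβu⟩ hn
    obtain ⟨D', hv, hnf⟩ := hT.exists_isVariant_conj hφ hβ hn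
    obtain ⟨p, hp, ρ₁, hρ₁, h1, h2⟩ := hc _ _ hv
    rw [Conj.sides_vars] at h1
    have hρu : T.sig.IsUnifier T.ax p.1 ρ₁ := by
      refine ⟨hρ₁, fun e he => ?_⟩
      have h3 : List.Forall₂ (fun e' e => T.EqB e'.1 e'.2) D' φ := by
        refine List.forall₂_iff_zip.2 ⟨hnf.length_eq.symm, fun {e' e} h => ?_⟩
        have h4 := (List.forall₂_iff_zip.1 hnf.flip).2 h
        exact hT.nf_of_eqE (hβu e (List.of_mem_zip h).2) _ _ h4.1 h4.2
      obtain ⟨e', he', h4, h5⟩ := (Conj.forall₂_sides.1 h2).exists_of_mem_left he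
      obtain ⟨_, -, h6⟩ := h3.exists_of_mem_left he'
      exact (h4.trans h6).trans h5.symm
    obtain ⟨α, hα, ρ₂, hρ₂, h3⟩ := (hA p hp).2 ρ₁ hρu
    obtain ⟨⟨hαs, hαu⟩, -⟩ := (hA p hp).1 α hα
    have hps := (hV p hp).1.subst
    set θ : Subst S F := fun x => ((p.2.fn x).subst α.fn).subst (shift k) with hθ
    have hθs : T.sig.IsSubst θ := (hps.comp hαs).comp (isSubst_shift k)
    have h4 : ∀ x ∈ φ.vars, T.EqB ((θ x).subst (unshift k ρ₂)) (β x) := fun x hx => by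
      rw [hθ, shift_unshift, Term.subst_subst]
      have h5 := h1 x hx
      rw [Sig.cut, if_pos hx] at h5
      refine Sig.EqMod.trans (Sig.EqMod.symm ?_) h5
      exact Sig.EqMod.subst_congr ⟨_, hps x⟩ hρ₁ (hαs.comp hρ₂) fun y hy =>
        h3 y (List.mem_append_right _ (List.mem_flatMap.2 ⟨x, hx, hy⟩))
    set Z := φ.vars.flatMap fun x => (θ x).vars with hZ
    have hZW : ∀ y ∈ Z, y ∉ W := fun y hy hyW => by
      obtain ⟨x, -, hy⟩ := List.mem_flatMap.1 hy
      have := mem_vars_shift hy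
      have := lt_freshIdx hyW
      omega
    -- The factor is `β` on `W`, since variables of `W` outside the system are fixed, and the
    -- inverse shift followed by `ρ₂` on the range `Z`, which is disjoint from `W`. On `Z` it is
    -- irreducible because its values occur inside terms that are `B`-equal to values of `β`.
    refine ⟨_, List.mem_flatMap.2 ⟨p, hp, List.mem_map_of_mem hα⟩,
      fun y => if y ∈ W then β y else Sig.cut (unshift k ρ₂) Z y, fun y => ?_, fun y => ?_, ?_⟩
    · dsimp only
      split
      · exact hβ y
      · exact Sig.IsSubst.cut' (fun x _ => hρ₂.unshift k x) y
    · dsimp only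
      split
      · exact hn y
      · refine hT.irred_cut (fun z hz => ?_) y
        obtain ⟨x, hx, hz⟩ := List.mem_flatMap.1 hz
        exact hT.irred_subst_var (Sig.WT.subst ⟨_, hθs x⟩ (hρ₂.unshift k))
          (hT.irred_of_eqB (h4 x hx).symm (hn x)) hz
    · intro x hx
      rw [fn_map θ]
      by_cases hxφ : x ∈ φ.vars
      · rw [Sig.cut, if_pos hxφ]
        rw [Term.subst_congr (τ := unshift k ρ₂) _ fun y hy => ?_]
        · exact (h4 x hxφ).symm
        · have hyZ : y ∈ Z := List.mem_flatMap.2 ⟨x, hxφ, hy⟩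
          rw [if_neg (hZW y hyZ), Sig.cut, if_pos hyZ]
      · rw [Sig.cut, if_neg hxφ, Term.subst, if_pos hx]
        exact .refl ⟨_, hβ x⟩

end IsDecomposition
end RewTheory
end
end VarSat

namespace VarSat
section
variable {S F : Type} [PartialOrder S]

/-! ### The canonical term algebra -/

namespace RewTheory
variable {T : RewTheory S F}

/-- Normalized ground substitutions. -/
structure GroundNormal (T : RewTheory S F) (ρ : Subst S F) : Prop where
  subst : T.sig.IsSubst ρ
  ground : ∀ x, (ρ x).Ground
  irred : ∀ x, T.Irred (ρ x)

/-- The disequalities in `D` hold under `ρ`. -/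
def SatBy (T : RewTheory S F) (ρ : Subst S F) (D : Conj S F) : Prop :=
  ∀ e ∈ D, ¬ T.EqE (e.1.subst ρ) (e.2.subst ρ)

/-- The disequalities in `D` hold under some normalized ground substitution. -/
def Sat (T : RewTheory S F) (D : Conj S F) : Prop := ∃ ρ, T.GroundNormal ρ ∧ T.SatBy ρ D

namespace IsDecomposition
variable (hT : T.IsDecomposition)
include hT

theorem nfb_hasSort {t u : Tm S F} (h : T.NFB t u) {s : S} (ht : T.sig.HasSort t s) :
    T.sig.HasSort u s := by
  obtain ⟨v, hv, h⟩ := h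
  exact (hT.eqB_hasSort h s).2 (hT.steps_hasSort hv.1 ht)

theorem setOf_nfb_eq_iff {t u : Tm S F} (ht : T.sig.WT t) (hu : T.sig.WT u) :
    {v | T.NFB t v} = {v | T.NFB u v} ↔ T.EqE t u := by
  constructor
  · intro h
    obtain ⟨v, hv⟩ := hT.exists_nf t
    have h1 : T.NFB t v := ⟨v, hv, .refl (hT.steps_wt hv.1 ht)⟩
    have h2 : v ∈ {v | T.NFB u v} := h ▸ h1
    exact ((hT.nfb_iff ht).1 h1).1.trans ((hT.nfb_iff hu).1 h2).1.symm
  · intro h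
    ext v
    simp only [Set.mem_ofPred_eq, hT.nfb_iff ht, hT.nfb_iff hu]
    exact and_congr_left fun _ => ⟨fun h' => h.symm.trans h', fun h' => h.trans h'⟩

theorem cls_eq_setOf_nfb {t : Tm S F} (ht : T.sig.WT t) (h : T.Irred t) :
    T.cls t = {v | T.NFB t v} := by
  ext v
  simp only [cls, Set.mem_ofPred_eq, hT.nfb_iff ht]
  exact ⟨fun h' => ⟨eqE_of_eqB h', hT.irred_of_eqB h' h⟩, fun h' => hT.eqB_of_irred h'.1 h h'.2⟩

/-- The operations range over all representatives of the argument classes. By Church–Rosser all of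
them lead to the same normal forms modulo `B`, so evaluation amounts to substitution followed by
normalization. -/
theorem eval_canon {ρ : Subst S F} (hρ : T.sig.IsSubst ρ) {a : Var S → T.canon.U}
    (ha : ∀ x, a x = {v | T.NFB (ρ x) v}) {t : Tm S F} (ht : T.sig.WT t) :
    T.canon.eval a t = {v | T.NFB (t.subst ρ) v} := by
  induction t using Term.induct with
  | hv x => simpa only [Alg.eval, Term.subst] using ha x
  | ha f ts ih =>
    have hw := ht.subst hρ
    rw [Term.subst] at hw
    let ev : Tm S F → Set (Tm S F) := T.canon.eval a
    have hm : ∀ us : List (Tm S F), List.Forall₂ (fun u c => u ∈ c) us (ts.map ev) ↔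
        List.Forall₂ T.NFB (ts.map (Term.subst ρ)) us := by
      intro us
      rw [List.forall₂_map_right_iff, List.forall₂_map_left_iff]
      have hl : ∀ {ts'}, ts' ⊆ ts → ∀ us, List.Forall₂ (fun u t => u ∈ ev t) us ts' ↔
          List.Forall₂ (fun t u => T.NFB (t.subst ρ) u) ts' us := by
        intro ts' h us
        induction us generalizing ts' with
        | nil => simp
        | cons u us ihu =>
          cases ts' with
          | nil => simp
          | cons t ts' =>
            rw [List.cons_subset] at h
            rw [List.forall₂_cons, List.forall₂_cons, ihu h.2]
            have := ih t h.1 (ht.arg h.1)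
            simp only [ev, this]
            rfl
      exact hl (fun _ h => h) us
    have key : ∀ us, List.Forall₂ T.NFB (ts.map (Term.subst ρ)) us →
        T.EqE (.app f us) (.app f (ts.map (Term.subst ρ))) := by
      intro us h
      refine .symm (.congr' ?_ hw ?_)
      · refine List.forall₂_iff_zip.2 ⟨h.length_eq, fun {t u} htu => ?_⟩
        exact ((hT.nfb_iff (hw.arg (List.of_mem_zip htu).1)).1
          ((List.forall₂_iff_zip.1 h).2 htu)).1
      · exact hw.imp fun s hs => hs.args (h.imp fun t u h s => hT.nfb_hasSort h)
    rw [Alg.eval, Term.subst]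
    refine Set.ext fun v => ?_
    change (∃ us, List.Forall₂ (fun u c => u ∈ c) us (ts.map ev) ∧
      T.NFB (.app f us) v) ↔ T.NFB (.app f (ts.map (Term.subst ρ))) v
    simp only [hm]
    constructor
    · rintro ⟨us, h, hv⟩
      have he := key us h
      rw [hT.nfb_iff (hT.wt_eqE he).1] at hv
      exact (hT.nfb_iff hw).2 ⟨he.symm.trans hv.1, hv.2⟩
    · intro hv
      choose nf hnf using hT.exists_nf
      have h : List.Forall₂ T.NFB (ts.map (Term.subst ρ)) ((ts.map (Term.subst ρ)).map nf) := by
        rw [List.forall₂_map_right_iff, List.forall₂_same]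
        exact fun t ht => ⟨_, hnf t, .refl (hT.steps_wt (hnf t).1 (hw.arg ht))⟩
      have he := key _ h
      refine ⟨_, h, ?_⟩
      rw [hT.nfb_iff (hT.wt_eqE he).1]
      have hv := (hT.nfb_iff hw).1 hv
      exact ⟨he.trans hv.1, hv.2⟩

theorem eval_canon_cls {ρ : Subst S F} (hρ : T.GroundNormal ρ) {t : Tm S F} (ht : T.sig.WT t) :
    T.canon.eval (fun x => T.cls (ρ x)) t = {v | T.NFB (t.subst ρ) v} :=
  hT.eval_canon hρ.subst (fun x => hT.cls_eq_setOf_nfb ⟨_, hρ.subst x⟩ (hρ.irred x)) ht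

theorem eval_eq_iff {ρ : Subst S F} (hρ : T.GroundNormal ρ) {e : Eqn S F} (he : T.sig.IsEqn e) :
    T.canon.eval (fun x => T.cls (ρ x)) e.1 = T.canon.eval (fun x => T.cls (ρ x)) e.2 ↔
      T.EqE (e.1.subst ρ) (e.2.subst ρ) := by
  rw [hT.eval_canon_cls hρ he.left, hT.eval_canon_cls hρ he.right]
  exact hT.setOf_nfb_eq_iff (he.left.subst hρ.subst) (he.right.subst hρ.subst)

/-- Rewriting keeps sorts and creates no variables, so normal forms chosen for the values are
themselves ground terms of the required sorts. -/
theorem isAssign_iff {a : Var S → T.canon.U} :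
    T.canon.IsAssign a ↔ ∃ ρ, T.GroundNormal ρ ∧ a = fun x => T.cls (ρ x) := by
  constructor
  · intro h
    choose t u ht hs hu ha using h
    exact ⟨u, ⟨fun x => hT.steps_hasSort (hu x).1 (hs x), fun x => List.subset_nil.1
      ((ht x) ▸ hT.steps_vars (hu x).1), fun x => (hu x).2⟩, funext ha⟩
  · rintro ⟨ρ, hρ, rfl⟩ x
    exact ⟨ρ x, ρ x, hρ.ground x, hρ.subst x, ⟨.refl, hρ.irred x⟩, rfl⟩

theorem satNe_canon_iff {D : Conj S F} (hD : ∀ e ∈ D, T.sig.IsEqn e) :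
    T.canon.SatNe D ↔ T.Sat D := by
  constructor
  · rintro ⟨a, ha, h⟩
    obtain ⟨ρ, hρ, rfl⟩ := hT.isAssign_iff.1 ha
    exact ⟨ρ, hρ, fun e he h' => h e he ((hT.eval_eq_iff hρ (hD e he)).2 h')⟩
  · rintro ⟨ρ, hρ, h⟩
    exact ⟨_, hT.isAssign_iff.2 ⟨ρ, hρ, rfl⟩,
      fun e he h' => h e he ((hT.eval_eq_iff hρ (hD e he)).1 h')⟩

/-- A substitution that is ground on `X` agrees there, up to `E`-equality, with a normalized
ground substitution. -/
theorem exists_groundNormal (hne : ∀ s, ∃ t : Tm S F, t.Ground ∧ T.sig.HasSort t s)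
    {σ : Subst S F} (hσ : T.sig.IsSubst σ) {X : List (Var S)} (hX : ∀ x ∈ X, (σ x).Ground) :
    ∃ ρ, T.GroundNormal ρ ∧ ∀ x ∈ X, T.EqE (σ x) (ρ x) := by
  classical
  choose g hg hgs using hne
  -- Off `X` any ground term of the sort will do; here all sorts have to be non-empty.
  have hs : T.sig.IsSubst fun x => if x ∈ X then σ x else g x.1 := fun x => by
    dsimp only
    split
    exacts [hσ x, hgs x.1]
  obtain ⟨ρ, h1, h2, h3, h4⟩ := hT.exists_nf_subst hs
  refine ⟨ρ, ⟨h1, fun x => ?_, h2⟩, fun x hx => ?_⟩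
  · refine List.subset_nil.1 (List.Subset.trans (h4 x) ?_)
    split_ifs with h
    exacts [(hX x h) ▸ List.Subset.refl _, (hg x.1) ▸ List.Subset.refl _]
  · have := h3 x
    rwa [if_pos hx] at this

end IsDecomposition
end RewTheory

omit [PartialOrder S] in
/-- The formula holds iff one of the disjuncts of its disjunctive normal form does. -/
theorem holds_iff_dnf (A : Alg S F) (a : Var S → A.U) (φ : QF (Eqn S F)) :
    (A.Holds a φ ↔ ∃ GD ∈ dnf true φ, (∀ e ∈ GD.1, A.eval a e.1 = A.eval a e.2) ∧
      ∀ e ∈ GD.2, A.eval a e.1 ≠ A.eval a e.2) ∧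
    (¬ A.Holds a φ ↔ ∃ GD ∈ dnf false φ, (∀ e ∈ GD.1, A.eval a e.1 = A.eval a e.2) ∧
      ∀ e ∈ GD.2, A.eval a e.1 ≠ A.eval a e.2) := by
  have hor : ∀ L L' : List (Conj S F × Conj S F), ∀ Q : Conj S F × Conj S F → Prop,
      (∃ GD ∈ L ++ L', Q GD) ↔ (∃ GD ∈ L, Q GD) ∨ ∃ GD ∈ L', Q GD := by
    intro L L' Q
    simp only [List.mem_append]
    grind
  have hand : ∀ L L' : List (Conj S F × Conj S F),
      (∃ GD ∈ L.flatMap fun p => L'.map fun q => (p.1 ++ q.1, p.2 ++ q.2),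
        (∀ e ∈ GD.1, A.eval a e.1 = A.eval a e.2) ∧ ∀ e ∈ GD.2, A.eval a e.1 ≠ A.eval a e.2) ↔
      (∃ GD ∈ L, (∀ e ∈ GD.1, A.eval a e.1 = A.eval a e.2) ∧
        ∀ e ∈ GD.2, A.eval a e.1 ≠ A.eval a e.2) ∧
      ∃ GD ∈ L', (∀ e ∈ GD.1, A.eval a e.1 = A.eval a e.2) ∧
        ∀ e ∈ GD.2, A.eval a e.1 ≠ A.eval a e.2 := by
    intro L L'
    simp only [List.mem_flatMap, List.mem_map]
    constructor
    · rintro ⟨_, ⟨p, hp, q, hq, rfl⟩, h1, h2⟩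
      exact ⟨⟨p, hp, fun e he => h1 e (by simp [he]), fun e he => h2 e (by simp [he])⟩,
        q, hq, fun e he => h1 e (by simp [he]), fun e he => h2 e (by simp [he])⟩
    · rintro ⟨⟨p, hp, h1, h2⟩, q, hq, h3, h4⟩
      exact ⟨_, ⟨p, hp, q, hq, rfl⟩, fun e he => (List.mem_append.1 he).elim (h1 e) (h3 e),
        fun e he => (List.mem_append.1 he).elim (h2 e) (h4 e)⟩
  -- The two equivalences are proved together because negation exchanges them.
  induction φ with
  | eq e => simp only [dnf, Alg.Holds, List.mem_singleton, exists_eq_left, forall_eq,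
      List.not_mem_nil, false_implies, implies_true, and_true, true_and, ne_eq, iff_self]
  | neg φ ih =>
    simp only [dnf, Alg.Holds, Bool.not_true, Bool.not_false, not_not]
    exact ⟨ih.2, ih.1⟩
  | and φ ψ ih ih' =>
    simp only [dnf, Alg.Holds, hand, hor]
    rw [← ih.1, ← ih'.1, ← ih.2, ← ih'.2]
    exact ⟨Iff.rfl, by tauto⟩
  | or φ ψ ih ih' =>
    simp only [dnf, Alg.Holds, hand, hor]
    rw [← ih.1, ← ih'.1, ← ih.2, ← ih'.2]
    exact ⟨Iff.rfl, by tauto⟩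

namespace PredTheory
variable {R : PredTheory S F}

/-- The atoms of the formulas that the procedure treats. -/
def IsAtom (R : PredTheory S F) (e : Eqn S F) : Prop :=
  (R.deltaC.sig.IsEqn e ∧ ∀ x ∈ e.vars, x.1 ≠ R.Pred) ∨
    ∃ p ts, R.part p = .pred ∧ R.sig.HasSort (.app p ts) R.Pred ∧
      e = (Term.app p ts, Term.app R.tt [])

theorem isAtom_of_mem_dnf {φ : QF (Eqn S F)} (h : R.IsFormula φ) {b : Bool}
    {GD : Conj S F × Conj S F} (hGD : GD ∈ dnf b φ) : ∀ e ∈ GD.1 ++ GD.2, R.IsAtom e := by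
  induction φ generalizing b GD with
  | eq e =>
    cases b <;> simp only [dnf, List.mem_singleton] at hGD <;> subst hGD <;>
      simpa only [List.nil_append, List.append_nil, List.mem_singleton, forall_eq,
        IsFormula, IsAtom] using h
  | neg φ ih => cases b <;> exact ih h hGD
  | and φ ψ ih ih' =>
    cases b
    · rcases List.mem_append.1 hGD with hGD | hGD
      exacts [ih h.1 hGD, ih' h.2 hGD]
    · obtain ⟨p, hp, hGD⟩ := List.mem_flatMap.1 hGD
      obtain ⟨q, hq, rfl⟩ := List.mem_map.1 hGD
      have h1 := ih h.1 hp
      have h2 := ih' h.2 hq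
      simp only [List.mem_append] at h1 h2 ⊢
      rintro e ((he | he) | (he | he))
      exacts [h1 e (.inl he), h2 e (.inl he), h1 e (.inr he), h2 e (.inr he)]
  | or φ ψ ih ih' =>
    cases b
    · obtain ⟨p, hp, hGD⟩ := List.mem_flatMap.1 hGD
      obtain ⟨q, hq, rfl⟩ := List.mem_map.1 hGD
      have h1 := ih h.1 hp
      have h2 := ih' h.2 hq
      simp only [List.mem_append] at h1 h2 ⊢
      rintro e ((he | he) | (he | he))
      exacts [h1 e (.inl he), h2 e (.inl he), h1 e (.inr he), h2 e (.inr he)]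
    · rcases List.mem_append.1 hGD with hGD | hGD
      exacts [ih h.1 hGD, ih' h.2 hGD]

end PredTheory
end
end VarSat

/-! ### Defined symbols, predicates, and the comparison of `R` with its subtheories -/

namespace VarSat
section
variable {S F : Type} [PartialOrder S]

omit [PartialOrder S] in
theorem Sig.op_of_restrict {Sg : Sig S F} {P : F → Prop} {f : F} {w : List S} {s : S}
    (h : (Sg.restrict P).op f w s) : Sg.op f w s := And.right h

namespace PredTheory
variable {R : PredTheory S F}

/-- The term has root `p`. -/
def HasRoot (p : F) (t : Tm S F) : Prop := ∃ ts, t = .app p ts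

/-- The symbols that are not in `Δ`. -/
abbrev NotDef (R : PredTheory S F) (f : F) : Prop := R.part f ≠ .defined
/-- The symbols that are not in `Ω_Π`. -/
abbrev NotPred (R : PredTheory S F) (f : F) : Prop := R.part f ≠ .pred
/-- The symbols in `Ω_c`. -/
abbrev IsCtor (R : PredTheory S F) (f : F) : Prop := R.part f = .ctor

omit [PartialOrder S] in
theorem allSyms_isCtor_iff {t : Tm S F} :
    t.AllSyms R.IsCtor ↔ t.AllSyms R.NotDef ∧ t.AllSyms R.NotPred := by
  simp only [Term.AllSyms, NotDef, NotPred, IsCtor]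
  constructor
  · exact fun h => ⟨fun f hf => by simp [h f hf], fun f hf => by simp [h f hf]⟩
  · rintro ⟨h1, h2⟩ f hf
    have := h1 f hf
    have := h2 f hf
    cases h : R.part f <;> simp_all

namespace Conditions
variable [DecidableEq S] [Primcodable S] [Primcodable F] (hR : R.Conditions)
include hR

theorem axC_ctor {e : Eqn S F} (he : e ∈ R.axC) :
    e.1.AllSyms R.IsCtor ∧ e.2.AllSyms R.IsCtor :=
  (Sig.isEqn_restrict.1 (hR.dec_omegaC.ax_eqn e he)).2

theorem ax_notPred : Sig.RespectsSyms R.NotPred R.full.ax := fun e he => by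
  have h := (Sig.isEqn_restrict.1 (hR.dec_deltaC.ax_eqn e he)).2
  exact ⟨hR.dec.ax_regular e he, iff_of_true h.1 h.2⟩

/-- An axiom in `B_Δ` has a defined symbol on both sides, since these are non-variable `Δ`-terms,
and one in `B_{Ω_c}` has none on either side. So `=_B` neither creates nor removes the last defined
symbol. -/
theorem ax_notDef : Sig.RespectsSyms R.NotDef R.full.ax := by
  refine fun e he => ⟨hR.dec.ax_regular e he, ?_⟩
  rcases he with he | he
  · have h := hR.axD_form e he
    have key : ∀ t : Tm S F, (∀ x, t ≠ .var x) → (∀ f ∈ t.syms, R.part f = .defined) →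
        ¬ t.AllSyms R.NotDef := by
      intro t h1 h2 h3
      cases t with
      | var x => exact h1 x rfl
      | app f ts => exact h3 f (by simp [Term.syms]) (h2 f (by simp [Term.syms]))
    exact iff_of_false (key _ (fun x => (h.1 x).1) fun f hf => h.2 f (by simp [hf]))
      (key _ (fun x => (h.1 x).2) fun f hf => h.2 f (by simp [hf]))
  · have h := hR.axC_ctor he
    exact iff_of_true (allSyms_isCtor_iff.1 h.1).1 (allSyms_isCtor_iff.1 h.2).1

theorem ax_isCtor : Sig.RespectsSyms R.IsCtor R.full.ax := fun e he => by
  simp only [allSyms_isCtor_iff]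
  exact ⟨hR.dec.ax_regular e he, and_congr (hR.ax_notDef e he).2 (hR.ax_notPred e he).2⟩

theorem sort_of_pred {p : F} (hp : R.part p = .pred) {ts : List (Tm S F)} {s : S}
    (h : R.sig.HasSort (.app p ts) s) : s = R.Pred := by
  obtain ⟨w, s', h1, h2, -⟩ := Sig.hasSort_app_iff.1 h
  obtain rfl := hR.preds p w s' hp h1
  exact hR.pred_isolated s (.inr h2)

theorem hasSort_pred {p : F} (hp : R.part p = .pred) {ts : List (Tm S F)}
    (h : R.sig.WT (.app p ts)) : R.sig.HasSort (.app p ts) R.Pred := by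
  obtain ⟨s, h⟩ := h
  obtain rfl := hR.sort_of_pred hp h
  exact h

/-- Terms of sorts other than `Pred` have no symbols in `Ω_Π` and no variables of sort `Pred`. -/
theorem of_sort_ne_pred {t : Tm S F} {s : S} (h : R.sig.HasSort t s) (hs : s ≠ R.Pred) :
    t.AllSyms R.NotPred ∧ ∀ x ∈ t.vars, x.1 ≠ R.Pred := by
  induction t using Term.induct generalizing s with
  | hv x =>
    refine ⟨Term.allSyms_var, fun y hy he => hs ?_⟩
    simp only [Term.vars, List.mem_singleton] at hy
    subst hy
    exact hR.pred_isolated s (.inr (he ▸ Sig.hasSort_var_iff.1 h))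
  | ha f ts ih =>
    obtain ⟨w, s', h1, h2, h3⟩ := Sig.hasSort_app_iff.1 h
    have key : ∀ t ∈ ts, t.AllSyms R.NotPred ∧ ∀ x ∈ t.vars, x.1 ≠ R.Pred := fun t ht => by
      obtain ⟨s'', hw, ht'⟩ := h3.exists_of_mem_left ht
      exact ih t ht ht' fun he => hR.pred_not_arg f w s' h1 (he ▸ hw)
    refine ⟨Term.allSyms_app.2 ⟨fun hf => hs (hR.sort_of_pred hf h), fun t ht => (key t ht).1⟩, ?_⟩
    intro x hx
    obtain ⟨t, ht, hx⟩ := Term.mem_vars_app.1 hx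
    exact (key t ht).2 x hx

theorem of_args {f : F} {ts : List (Tm S F)} (h : R.sig.WT (.app f ts)) {t : Tm S F}
    (ht : t ∈ ts) : t.AllSyms R.NotPred ∧ ∀ x ∈ t.vars, x.1 ≠ R.Pred := by
  obtain ⟨w, s', h1, h3⟩ := Sig.wt_app_iff.1 h
  obtain ⟨s'', hw, ht'⟩ := h3.exists_of_mem_left ht
  exact hR.of_sort_ne_pred ht' fun he => hR.pred_not_arg f w s' h1 (he ▸ hw)

theorem vars_app {f : F} {ts : List (Tm S F)} (h : R.sig.WT (.app f ts)) :
    ∀ x ∈ (Term.app f ts).vars, x.1 ≠ R.Pred := fun x hx => by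
  obtain ⟨t, ht, hx⟩ := Term.mem_vars_app.1 hx
  exact (hR.of_args h ht).2 x hx

/-- Substitution preserves the absence of predicate symbols, if there are no variables of sort
`Pred`. -/
theorem subst_notPred {t : Tm S F} (h : t.AllSyms R.NotPred) (hv : ∀ x ∈ t.vars, x.1 ≠ R.Pred)
    {σ : Subst S F} (hσ : R.sig.IsSubst σ) :
    (t.subst σ).AllSyms R.NotPred ∧ ∀ x ∈ (t.subst σ).vars, x.1 ≠ R.Pred := by
  refine ⟨Term.allSyms_subst.2 ⟨h, fun x hx => (hR.of_sort_ne_pred (hσ x) (hv x hx)).1⟩, ?_⟩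
  intro y hy
  obtain ⟨x, hx, hy⟩ := Term.mem_vars_subst.1 hy
  exact (hR.of_sort_ne_pred (hσ x) (hv x hx)).2 y hy

/-- An axiom without predicate symbols can show the root `p` only through a variable, whose sort is
then `Pred`. By regularity this variable occurs on the other side too, and as `Pred` is not an
argument sort, the other side is that variable. -/
theorem hasRoot_aux {p : F} (hp : R.part p = .pred) {l r : Tm S F} {σ : Subst S F}
    (hσ : R.sig.IsSubst σ) (hl : l.AllSyms R.NotPred) (hr : R.sig.WT r)
    (hv : ∀ x, x ∈ l.vars ↔ x ∈ r.vars) (h : HasRoot p (l.subst σ)) :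
    HasRoot p (r.subst σ) := by
  obtain ⟨ts, h⟩ := h
  cases l with
  | app f us =>
    simp only [Term.subst, Term.app.injEq] at h
    exact absurd hp (h.1 ▸ (Term.allSyms_app.1 hl).1)
  | var x =>
    have hx : x ∈ r.vars := (hv x).1 (by simp [Term.vars])
    rw [Term.subst] at h
    have hs := hR.sort_of_pred hp (h ▸ hσ x)
    cases r with
    | var y =>
      simp only [Term.vars, List.mem_singleton] at hx
      subst hx
      exact ⟨ts, by rw [Term.subst, h]⟩
    | app f us => exact absurd hs (hR.vars_app hr x hx)

theorem hasRoot_eqB {p : F} (hp : R.part p = .pred) {t u : Tm S F} (h : R.full.EqB t u) :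
    HasRoot p t ↔ HasRoot p u := by
  induction h with
  | refl h => rfl
  | symm _ ih => exact ih.symm
  | trans _ _ ih ih' => exact ih.trans ih'
  | @inst e σ he hσ =>
    have h := (Sig.isEqn_restrict.1 (hR.dec_deltaC.ax_eqn e he)).2
    have hv := hR.dec.ax_regular e he
    have hw := hR.dec.ax_eqn e he
    exact ⟨hR.hasRoot_aux hp hσ h.1 hw.right hv,
      hR.hasRoot_aux hp hσ h.2 hw.left fun x => (hv x).symm⟩
  | congr => simp [HasRoot]

theorem rule_cases {e : Eqn S F} (he : e ∈ R.full.rules) :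
    (e ∈ R.deltaC.rules ∧ e.1.AllSyms R.NotPred ∧ e.2.AllSyms R.NotPred) ∨
      ∃ p us, R.part p = .pred ∧ e = (Term.app p us, Term.app R.tt []) := by
  rcases he with he | he
  · exact .inl ⟨he, (Sig.isEqn_restrict.1 (hR.dec_deltaC.rules_eqn e he)).2⟩
  · exact .inr (hR.rulesP_form e he)

/-- Rewriting a predicate atom gives a predicate atom or `tt`. -/
theorem step_hasRoot {p : F} (hp : R.part p = .pred) {t u : Tm S F} (h : R.full.Step t u)
    (ht : HasRoot p t) : HasRoot p u ∨ u = .app R.tt [] := by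
  cases h with
  | @root _ e σ he hσ h =>
    rcases hR.rule_cases he with ⟨-, hl, -⟩ | ⟨q, us, -, rfl⟩
    · obtain ⟨ts, hr⟩ := (hR.hasRoot_eqB hp h).1 ht
      cases hl' : e.1 with
      | var x => exact absurd hl' (hR.dec.rules_lhs e he x)
      | app f us =>
        rw [hl'] at hl hr
        simp only [Term.subst, Term.app.injEq] at hr
        exact absurd hp (hr.1 ▸ (Term.allSyms_app.1 hl).1)
    · right
      simp [Term.subst]
  | arg h _ _ =>
    obtain ⟨ts, ht⟩ := ht
    simp only [Term.app.injEq] at ht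
    exact .inl ⟨_, by rw [ht.1]⟩

theorem wt_tt : R.sig.WT (.app R.tt [] : Tm S F) :=
  Sig.wt_app_iff.2 ⟨[], R.Pred, hR.tt_op, .nil⟩

theorem tt_notPred : (Term.app R.tt [] : Tm S F).AllSyms R.NotPred :=
  Term.allSyms_app.2 ⟨by simp [NotPred, hR.tt_ctor], by simp⟩

theorem hasSort_tt : R.sig.HasSort (.app R.tt [] : Tm S F) R.Pred :=
  Sig.hasSort_app_iff.2 ⟨[], R.Pred, hR.tt_op, le_rfl, .nil⟩

/-- Rewriting of `(Δ ⊎ Ω_c)`-terms. -/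
theorem step_deltaC {t u : Tm S F} (h : R.full.Step t u) (ht : t.AllSyms R.NotPred) :
    R.deltaC.Step t u := by
  induction h with
  | @root t e σ he hσ h =>
    rcases hR.rule_cases he with ⟨he', -, -⟩ | ⟨q, us, hq, rfl⟩
    · have hl := ((h.allSyms hR.ax_notPred).1 ht)
      have hr : R.deltaC.EqB t (e.1.subst σ) := h.restrict hR.ax_notPred ht
      -- Off the variables of the rule `σ` may use predicate symbols, so it is cut down to the
      -- left-hand side, which contains all variables of the right-hand side.
      rw [← Sig.cut_subst σ (t := e.1) (fun _ h => h)] at hr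
      rw [← Sig.cut_subst σ (t := e.2) (hR.dec.rules_vars e he)]
      exact .root he' (Sig.IsSubst.cut' fun x hx => Sig.hasSort_restrict.2
        ⟨hσ x, (Term.allSyms_subst.1 hl).2 x hx⟩) hr
    · have hl := ((h.allSyms hR.ax_notPred).1 ht)
      simp only [Term.subst, Term.allSyms_app] at hl
      exact absurd hq hl.1
  | @arg f l r t u h hwt hwu ih =>
    have ht' := Term.allSyms_app.1 ht
    have h' := ih (ht'.2 t (by simp))
    refine .arg h' (Sig.wt_restrict.2 ⟨hwt, ht⟩) (Sig.wt_restrict.2 ⟨hwu, ?_⟩)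
    refine Term.allSyms_app.2 ⟨ht'.1, fun v hv => ?_⟩
    simp only [List.mem_append, List.mem_cons] at hv ht'
    rcases hv with hv | rfl | hv
    exacts [ht'.2 v (.inl hv), (Sig.wt_restrict.1 (hR.dec_deltaC.step_wt h').2).2,
      ht'.2 v (.inr (.inr hv))]

theorem steps_deltaC {t u : Tm S F} (h : Relation.ReflTransGen R.full.Step t u)
    (ht : t.AllSyms R.NotPred) : u.AllSyms R.NotPred := by
  induction h with
  | refl => exact ht
  | tail _ h ih =>
    exact (Sig.wt_restrict.1 (hR.dec_deltaC.step_wt (hR.step_deltaC h ih)).2).2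

/-- Predicate atoms rewrite to predicate atoms, or to `(Δ ⊎ Ω_c)`-terms that are equal to `tt`. -/
theorem steps_hasRoot {p : F} (hp : R.part p = .pred) {t u : Tm S F}
    (h : Relation.ReflTransGen R.full.Step t u) (ht : HasRoot p t) :
    HasRoot p u ∨ u.AllSyms R.NotPred ∧ R.full.EqE u (.app R.tt []) := by
  induction h with
  | refl => exact .inl ht
  | tail _ h ih =>
    -- The constant `tt` need not be irreducible, so once it is reached only `E`-equality with it is
    -- tracked.
    rcases ih with ih | ⟨ih, ih'⟩
    · rcases hR.step_hasRoot hp h ih with h | rfl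
      exacts [.inl h, .inr ⟨hR.tt_notPred, .refl hR.wt_tt⟩]
    · exact .inr ⟨hR.steps_deltaC (.single h) ih,
        (RewTheory.IsDecomposition.step_eqE h).symm.trans ih'⟩

omit hR [DecidableEq S] [Primcodable S] [Primcodable F] in
theorem eqB_of_omegaC {t u : Tm S F} (h : R.omegaC.EqB t u) : R.full.EqB t u :=
  Sig.EqMod.mono (fun _ _ _ => Sig.op_of_restrict) Set.subset_union_right h

omit hR [DecidableEq S] [Primcodable S] [Primcodable F] in
theorem eqE_of_omegaC {t u : Tm S F} (h : R.omegaC.EqE t u) : R.full.EqE t u := by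
  refine Sig.EqMod.mono (fun _ _ _ => Sig.op_of_restrict) ?_ h
  rintro e (he | he)
  exacts [.inl (.inr he), .inr (.inl (.inr he))]

omit hR [DecidableEq S] [Primcodable S] [Primcodable F] in
theorem wt_of_omegaC {t : Tm S F} (h : R.omegaC.sig.WT t) : R.sig.WT t :=
  (Sig.wt_restrict.1 h).1

/-- Protection compares `Ω_c` with `Δ ⊎ Ω_c` only; the rules in `R_Π` do not matter because they
cannot be applied to a term without predicates. -/
theorem irred_omegaC_iff {t : Tm S F} (h : R.omegaC.sig.WT t) :
    R.omegaC.Irred t ↔ R.full.Irred t := by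
  rw [hR.protects_omegaC.irred_iff t h]
  have hp := (allSyms_isCtor_iff.1 (Sig.wt_restrict.1 h).2).2
  constructor
  · exact fun hi u hu => hi u (hR.step_deltaC hu hp)
  · exact fun hi u hu => hi u (RewTheory.Step.mono (T := R.deltaC) (T' := R.full)
      (fun _ _ _ => Sig.op_of_restrict) (fun _ h => h) (fun _ h => .inl h) hu)

theorem eqB_omegaC_iff {t u : Tm S F} (ht : R.omegaC.sig.WT t) (hu : R.omegaC.sig.WT u) :
    R.omegaC.EqB t u ↔ R.full.EqB t u := by
  refine ⟨eqB_of_omegaC, fun h => ?_⟩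
  rw [hR.protects_omegaC.eqB_iff t u ht hu]
  exact h.restrict hR.ax_notPred (allSyms_isCtor_iff.1 (Sig.wt_restrict.1 ht).2).2

theorem exists_nf_omegaC {t : Tm S F} (ht : R.omegaC.sig.WT t) :
    ∃ u, R.omegaC.sig.WT u ∧ R.omegaC.EqE t u ∧ R.full.Irred u := by
  obtain ⟨u, hu⟩ := hR.dec_omegaC.exists_nf t
  have h := hR.dec_omegaC.steps_wt hu.1 ht
  exact ⟨u, h, RewTheory.IsDecomposition.nf_eqE ht hu, (hR.irred_omegaC_iff h).1 hu.2⟩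

/-- Both terms are replaced by normal forms over `Ω_c`. There `E`-equality is `B`-equality, on which
the two theories agree. -/
theorem eqE_omegaC_iff {t u : Tm S F} (ht : R.omegaC.sig.WT t) (hu : R.omegaC.sig.WT u) :
    R.omegaC.EqE t u ↔ R.full.EqE t u := by
  refine ⟨eqE_of_omegaC, fun h => ?_⟩
  obtain ⟨t', ht', h1, h2⟩ := hR.exists_nf_omegaC ht
  obtain ⟨u', hu', h3, h4⟩ := hR.exists_nf_omegaC hu
  have h5 : R.full.EqB t' u' := hR.dec.eqB_of_irred
    (((eqE_of_omegaC h1).symm.trans h).trans (eqE_of_omegaC h3)) h2 h4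
  exact (h1.trans (RewTheory.IsDecomposition.eqE_of_eqB
    ((hR.eqB_omegaC_iff ht' hu').2 h5))).trans h3.symm

theorem allSyms_nf_omegaC {t u : Tm S F} (ht : R.omegaC.sig.WT t) (hu : R.full.NF t u) :
    u.AllSyms R.IsCtor := by
  obtain ⟨v, hv, h1, h2⟩ := hR.exists_nf_omegaC ht
  have h := hR.dec.nf_of_eqE (eqE_of_omegaC h1) u v hu ⟨.refl, h2⟩
  exact (h.allSyms hR.ax_isCtor).2 (Sig.wt_restrict.1 hv).2

/-- Ground terms in normal form have no defined symbols. -/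
theorem notDef_of_irred {t : Tm S F} (hg : t.Ground) (ht : R.sig.WT t) (h : R.full.Irred t) :
    t.AllSyms R.NotDef := by
  obtain ⟨s, ht⟩ := ht
  have hc : R.full.cls t ∈ R.full.canon.dom s := ⟨t, t, hg, ht, ⟨.refl, h⟩, rfl⟩
  -- The elements of `C_{R_Ω}` are classes of terms over `Ω_c ⊎ Ω_Π`, and `t` belongs to its own
  -- class.
  rw [← hR.protects_omega.canon_dom] at hc
  obtain ⟨t₀, u, -, -, -, he⟩ := hc
  have : t ∈ R.full.cls t := Sig.EqMod.refl ⟨s, ht⟩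
  rw [he] at this
  exact (Sig.wt_restrict.1 (hR.dec_omega.wt_eqB this).2).2

theorem isCtor_of_irred {t : Tm S F} (hg : t.Ground) (ht : R.sig.WT t) (h : R.full.Irred t)
    (hp : t.AllSyms R.NotPred) : t.AllSyms R.IsCtor :=
  allSyms_isCtor_iff.2 ⟨hR.notDef_of_irred hg ht h, hp⟩

/-- Predicate atoms in normal form are not equal to `tt`. -/
theorem not_eqE_tt {p : F} (hp : R.part p = .pred) {t : Tm S F} (ht : HasRoot p t)
    (hi : R.full.Irred t) : ¬ R.full.EqE t (.app R.tt []) := by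
  intro h
  obtain ⟨u, hu⟩ := hR.dec.exists_nf (.app R.tt [])
  have h1 : u.AllSyms R.NotPred := hR.steps_deltaC hu.1 hR.tt_notPred
  have h2 := hR.dec.nf_of_eqE h t u ⟨.refl, hi⟩ hu
  rw [← h2.allSyms hR.ax_notPred] at h1
  obtain ⟨ts, rfl⟩ := ht
  exact (Term.allSyms_app.1 h1).1 hp

/-! ### Existence of the subroutines -/

/-- The `B`-unifiers whose values have no defined symbols suffice. If an instance `τρ` is `B`-equal
to a substitution over `Ω_c ⊎ Ω_Π`, then neither `τ` nor the relevant part of `ρ` contains defined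
symbols, since `=_B` respects their absence. -/
theorem exists_unif (φ : Conj S F) (W : List (Var S)) (hφ : ∀ e ∈ φ, R.omega.sig.IsEqn e)
    (hW : φ.vars ⊆ W) : ∃ U, R.omega.sig.IsCompleteUnif R.axC φ W U := by
  classical
  obtain ⟨alg, -, hA⟩ := hR.unif
  have hφ' : ∀ e ∈ φ, R.full.sig.IsEqn e := fun e he => (Sig.isEqn_restrict.1 (hφ e he)).1
  obtain ⟨h1, h2⟩ := hA φ W hφ' hW
  have hadd : ∀ {t u : Tm S F}, t.AllSyms R.NotDef → R.full.EqB t u →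
      R.omega.sig.EqMod R.axC t u := fun {t u} ht h =>
    (hR.protects_omega.eqB_iff t u (Sig.wt_restrict.2 ⟨(hR.dec.wt_eqB h).1, ht⟩)
      (Sig.wt_restrict.2 ⟨(hR.dec.wt_eqB h).2, (h.allSyms hR.ax_notDef).1 ht⟩)).2 h
  have hrem : ∀ {t u : Tm S F}, R.omega.sig.EqMod R.axC t u → R.full.EqB t u := fun h =>
    h.mono (fun _ _ _ => Sig.op_of_restrict) Set.subset_union_right
  refine ⟨(alg φ W).filter fun τ => R.omega.sig.IsSubst τ.fn, fun τ hτ => ?_, fun σ hσ => ?_⟩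
  · obtain ⟨hτ, hs⟩ := List.mem_filter.1 hτ
    have hs := of_decide_eq_true hs
    refine ⟨⟨hs, fun e he => hadd ?_ ((h1 τ hτ).1.2 e he)⟩, (h1 τ hτ).2⟩
    exact Term.allSyms_subst.2 ⟨(Sig.isEqn_restrict.1 (hφ e he)).2.1,
      fun x _ => (Sig.hasSort_restrict.1 (hs x)).2⟩
  · obtain ⟨τ, hτ, ρ, hρ, h⟩ := h2 σ ⟨fun x => (hσ.1 x).mono fun _ _ _ => Sig.op_of_restrict,
      fun e he => hrem (hσ.2 e he)⟩
    have hsym : ∀ x ∈ W, ((τ.fn x).subst ρ).AllSyms R.NotDef := fun x hx =>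
      (Sig.EqMod.allSyms hR.ax_notDef (h x hx)).1 (Sig.hasSort_restrict.1 (hσ.1 x)).2
    -- The factor `ρ` may use defined symbols elsewhere, so it is cut down to the variables in the
    -- values of `τ` on `W`.
    refine ⟨τ, List.mem_filter.2 ⟨hτ, decide_eq_true fun x => ?_⟩,
      Sig.cut ρ (W.flatMap fun x => (τ.fn x).vars), .cut' fun y hy => ?_, fun x hx => ?_⟩
    · by_cases hx : x ∈ W
      · exact Sig.hasSort_restrict.2 ⟨(h1 τ hτ).1.1 x, (Term.allSyms_subst.1 (hsym x hx)).1⟩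
      · have : τ.fn x = .var x := by
          by_contra hne
          exact hx (hW (((h1 τ hτ).2.1 x).1 hne))
        rw [this]
        exact .var x
    · obtain ⟨x, hx, hy⟩ := List.mem_flatMap.1 hy
      exact Sig.hasSort_restrict.2 ⟨hρ y, (Term.allSyms_subst.1 (hsym x hx)).2 y hy⟩
    · rw [Sig.cut_subst _ fun y hy => List.mem_flatMap.2 ⟨x, hx, hy⟩]
      exact hadd (Sig.hasSort_restrict.1 (hσ.1 x)).2 (h x hx)

/-- The representatives have to be normalized as well, so a normal form is chosen in each of the
finitely many classes. -/
theorem exists_reps {s : S} (hs : R.omegaC.FinSort s) :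
    ∃ reps : List (Tm S F), R.omegaC.IsReps s reps ∧ ∀ r ∈ reps, R.omegaC.Irred r := by
  classical
  have h : ∀ c : Set (Tm S F), c ∈ (initAlg R.omegaC.sig R.omegaC.eqns).dom s →
      ∃ r, r.Ground ∧ R.omegaC.sig.HasSort r s ∧ R.omegaC.Irred r ∧
        ∀ t ∈ c, R.omegaC.EqE t r := by
    rintro c ⟨t, hg, ht, rfl⟩
    obtain ⟨u, hu⟩ := hR.dec_omegaC.exists_nf t
    refine ⟨u, List.subset_nil.1 (hg ▸ hR.dec_omegaC.steps_vars hu.1),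
      hR.dec_omegaC.steps_hasSort hu.1 ht, hu.2, fun v hv => ?_⟩
    exact (Sig.EqMod.symm hv.2).trans (RewTheory.IsDecomposition.nf_eqE ⟨s, ht⟩ hu)
  have : Nonempty (Tm S F) := ⟨.app R.tt []⟩
  choose! r h1 h2 h3 h4 using h
  obtain ⟨L, hmem⟩ : ∃ L : List (Set (Tm S F)), ∀ c, c ∈ L ↔
      c ∈ (initAlg R.omegaC.sig R.omegaC.eqns).dom s := by
    have hs' : Set.Finite (α := Set (Tm S F)) ((initAlg R.omegaC.sig R.omegaC.eqns).dom s) := hs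
    exact ⟨hs'.toFinset.toList, fun c => Finset.mem_toList.trans hs'.mem_toFinset⟩
  refine ⟨L.map r, ⟨?_, fun t hg ht => ?_⟩, ?_⟩
  · intro _ hc
    obtain ⟨c, hcL, rfl⟩ := List.mem_map.1 hc
    have hc := (hmem c).1 hcL
    exact ⟨h1 c hc, h2 c hc⟩
  · have hc : {v | v.Ground ∧ R.omegaC.EqE t v} ∈
        (initAlg R.omegaC.sig R.omegaC.eqns).dom s := ⟨t, hg, ht, rfl⟩
    refine ⟨_, List.mem_map_of_mem (a := {v | v.Ground ∧ R.omegaC.EqE t v}) ((hmem _).2 hc), ?_⟩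
    exact h4 _ hc t ⟨hg, .refl ⟨s, ht⟩⟩
  · intro _ hc
    obtain ⟨c, hcL, rfl⟩ := List.mem_map.1 hc
    have hc := (hmem c).1 hcL
    exact h3 c hc

/-- Only existence is at stake, so the tests may be decided classically. A test that never
recognizes unsatisfiability is sound. -/
theorem exists_subroutines : ∃ sub : Subroutines S F, sub.Correct R := by
  classical
  choose nf hnf using hR.dec.exists_nf
  have hv := fun φ W hφ hW => hR.dec.exists_varUnif hR.unif hR.fvp φ W hφ hW
  have ht := fun (t : Tm S F) W (ht : R.full.sig.WT t) (hW : t.vars ⊆ W) =>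
    hR.dec.exists_completeVariants hR.unif hR.fvp (fun t => [t]) t
      (fun us h => by
        obtain ⟨u, rfl⟩ := List.length_eq_one_iff.1 h
        exact ⟨u, rfl⟩) W (by simpa using ht) (by simpa using hW)
  have hc := fun φ W hφ hW => hR.dec.exists_conjVariants hR.unif hR.fvp φ W hφ hW
  have hu := hR.exists_unif
  have hr := fun s (hs : R.omegaC.FinSort s) => hR.exists_reps hs
  choose! varUnif h1 using hv
  choose! variants h2 using ht
  choose! conjVariants h3 using hc
  choose! unif h4 using hu
  choose! reps h5 using hr
  exact ⟨⟨nf, varUnif, variants, conjVariants, unif, fun u v => decide (R.omegaC.EqB u v),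
    fun s => decide (R.omegaC.FinSort s), reps, fun _ => false⟩,
    ⟨fun t _ => hnf t, h1, h2, h3, h4, fun u v _ => decide_eq_true_iff,
      fun s => decide_eq_true_iff, h5, fun _ _ h => by simp at h⟩⟩

end Conditions
end PredTheory
end
end VarSat

/-! ### The invariant of the conjunctions, and Step 1 -/

namespace VarSat
section
variable {S F : Type} [PartialOrder S]

namespace RewTheory.IsDecomposition
variable {T : RewTheory S F} (hT : T.IsDecomposition)

theorem eqE_pull {σ ρ' ρ : Subst S F} (hσ : T.sig.IsSubst σ) (hρ' : T.sig.IsSubst ρ')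
    (hρ : T.sig.IsSubst ρ) (h : ∀ x, T.EqE ((σ x).subst ρ') (ρ x)) {t : Tm S F}
    (ht : T.sig.WT t) : T.EqE ((t.subst σ).subst ρ') (t.subst ρ) := by
  rw [Term.subst_subst]
  exact eqE_subst_congr ht (hσ.comp hρ') hρ fun x _ => h x

include hT

/-- The backward direction of every step: a ground solution `ρ'` of an instance by `σ` yields a
solution of the original, namely the normal form of `σρ'`. -/
theorem exists_pull {σ ρ' : Subst S F} (hσ : T.sig.IsSubst σ) (hρ' : T.sig.IsSubst ρ')
    (hg : ∀ x, (ρ' x).Ground) : ∃ ρ, T.GroundNormal ρ ∧ ∀ x, T.EqE ((σ x).subst ρ') (ρ x) := by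
  obtain ⟨ρ, h1, h2, h3, h4⟩ := hT.exists_nf_subst (hσ.comp hρ')
  refine ⟨ρ, ⟨h1, fun x => List.subset_nil.1 ?_, h2⟩, h3⟩
  have h : ((σ x).subst ρ').Ground := Term.ground_subst.2 fun y _ => hg y
  exact h ▸ h4 x

end RewTheory.IsDecomposition

open RewTheory.IsDecomposition

namespace PredTheory
variable {R : PredTheory S F}

/-- There are no symbols in `Ω_Π` and no variables of sort `Pred`. -/
def NoPred (R : PredTheory S F) (t : Tm S F) : Prop :=
  t.AllSyms R.NotPred ∧ ∀ x ∈ t.vars, x.1 ≠ R.Pred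

/-- The equations and disequalities that occur in Steps 1 and 2. -/
structure IsItem (R : PredTheory S F) (e : Eqn S F) : Prop where
  eqn : R.sig.IsEqn e
  right : R.NoPred e.2
  left : R.NoPred e.1 ∨ (∃ p, R.part p = .pred ∧ HasRoot p e.1) ∧
    R.full.EqE e.2 (.app R.tt [])

omit [PartialOrder S] in
theorem isPi_iff {e : Eqn S F} : R.isPi e = true ↔ ∃ p, R.part p = .pred ∧ HasRoot p e.1 := by
  unfold isPi
  cases e.1 with
  | var x => simp [HasRoot]
  | app f ts =>
    simp only [decide_eq_true_eq, HasRoot, Term.app.injEq]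
    exact ⟨fun h => ⟨f, h, ts, rfl, rfl⟩, by rintro ⟨p, h, _, rfl, -⟩; exact h⟩

omit [PartialOrder S] in
theorem isPi_of_notPred {e : Eqn S F} (h : e.1.AllSyms R.NotPred) : R.isPi e = false := by
  rw [Bool.eq_false_iff, ne_eq, isPi_iff]
  rintro ⟨p, hp, ts, he⟩
  rw [he] at h
  exact (Term.allSyms_app.1 h).1 hp

theorem IsItem.noPred {e : Eqn S F} (h : R.IsItem e) (hp : R.isPi e = false) :
    R.NoPred e.1 := by
  rcases h.left with h | h
  · exact h
  · rw [isPi_iff.2 h.1] at hp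
    cases hp

omit [PartialOrder S] in
theorem findPi_none [DecidableEq F] {D : Conj S F} (h : R.findPi D = none) :
    ∀ e ∈ D, R.isPi e = false := by
  induction D with
  | nil => simp
  | cons e D ih =>
    obtain ⟨u, v⟩ := e
    cases u with
    | var x =>
      simp only [findPi, Option.map_eq_none_iff] at h
      simpa [isPi] using ih h
    | app f ts =>
      simp only [findPi] at h
      split_ifs at h with hf
      rw [Option.map_eq_none_iff] at h
      simpa [isPi, hf] using ih h

omit [PartialOrder S] in
theorem findPi_some [DecidableEq F] {D D₁ D₂ : Conj S F} {p : F} {t : Tm S F}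
    (h : R.findPi D = some (D₁, p, t, D₂)) :
    R.part p = .pred ∧ HasRoot p t ∧ ∃ v, D = D₁ ++ (t, v) :: D₂ := by
  induction D generalizing D₁ with
  | nil => simp [findPi] at h
  | cons e D ih =>
    obtain ⟨u, v⟩ := e
    have hrec : (R.findPi D).map (fun q => ((u, v) :: q.1, q.2)) = some (D₁, p, t, D₂) →
        R.part p = .pred ∧ HasRoot p t ∧ ∃ w, (u, v) :: D = D₁ ++ (t, w) :: D₂ := by
      intro h
      obtain ⟨⟨D₁', q⟩, hq, he⟩ := Option.map_eq_some_iff.1 h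
      simp only [Prod.mk.injEq] at he
      obtain ⟨rfl, rfl⟩ := he
      obtain ⟨h1, h2, w, h3⟩ := ih hq
      exact ⟨h1, h2, w, by rw [h3]; rfl⟩
    cases u with
    | var x => exact hrec (by simpa only [findPi] using h)
    | app f ts =>
      simp only [findPi] at h
      split_ifs at h with hf
      · simp only [Option.some.injEq, Prod.mk.injEq] at h
        obtain ⟨rfl, rfl, rfl, rfl⟩ := h
        exact ⟨hf, ⟨ts, rfl⟩, v, rfl⟩
      · exact hrec h

omit [PartialOrder S] in
theorem rootIs_iff [DecidableEq F] {p : F} {t : Tm S F} : rootIs p t = true ↔ HasRoot p t := by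
  cases t with
  | var x => simp [rootIs, HasRoot]
  | app f ts => simp [rootIs, HasRoot]

namespace Conditions
variable [DecidableEq S] [Primcodable S] [Primcodable F] (hR : R.Conditions)
include hR

theorem isItem_of_isAtom {e : Eqn S F} (h : R.IsAtom e) : R.IsItem e := by
  rcases h with ⟨h, hv⟩ | ⟨p, ts, hp, hs, rfl⟩
  · obtain ⟨h1, h2, h3⟩ := Sig.isEqn_restrict.1 h
    simp only [Eqn.vars, List.mem_append] at hv
    exact ⟨h1, ⟨h3, fun x hx => hv x (.inr hx)⟩, .inl ⟨h2, fun x hx => hv x (.inl hx)⟩⟩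
  · exact ⟨⟨_, hs, hR.hasSort_tt⟩, ⟨hR.tt_notPred, by simp [Term.vars]⟩,
      .inr ⟨⟨p, hp, ts, rfl⟩, .refl hR.wt_tt⟩⟩

theorem isItem_subst {e : Eqn S F} (h : R.IsItem e) {σ : Subst S F} (hσ : R.sig.IsSubst σ) :
    R.IsItem (e.subst σ) := by
  refine ⟨h.eqn.subst hσ, hR.subst_notPred h.right.1 h.right.2 hσ, ?_⟩
  rcases h.left with h | ⟨⟨p, hp, ts, h⟩, h'⟩
  · exact .inl (hR.subst_notPred h.1 h.2 hσ)
  · refine .inr ⟨⟨p, hp, _, by rw [Eqn.subst, h, Term.subst]⟩, ?_⟩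
    have : R.full.EqE (e.2.subst σ) ((Term.app R.tt []).subst σ) := h'.subst hσ
    rwa [Term.subst] at this

/-- A side without predicates has no variable of sort `Pred` either, so no instance of it acquires a
predicate as root. Hence substitutions preserve the number of disequalities that Step 2 has to
treat. -/
theorem isPi_subst {e : Eqn S F} (h : R.IsItem e) {σ : Subst S F} (hσ : R.sig.IsSubst σ) :
    R.isPi (e.subst σ) = R.isPi e := by
  cases he : R.isPi e with
  | false =>
    have := h.noPred he
    exact isPi_of_notPred (hR.subst_notPred this.1 this.2 hσ).1
  | true =>
    obtain ⟨p, hp, ts, he⟩ := isPi_iff.1 he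
    exact isPi_iff.2 ⟨p, hp, _, by rw [Eqn.subst, he, Term.subst]⟩

/-- Normalization can turn a predicate atom into a reduct of `tt`, and the disequality then counts
as one without predicates. It can also rewrite the `tt` on the right, which is why `IsItem` asks
only for `E`-equality with `tt`. -/
theorem isItem_nf {e e' : Eqn S F} (h : R.IsItem e) (h1 : R.full.NF e.1 e'.1)
    (h2 : R.full.NF e.2 e'.2) : R.IsItem e' := by
  obtain ⟨s, hs1, hs2⟩ := h.eqn
  have key : ∀ {t u : Tm S F}, R.full.NF t u → R.NoPred t → R.NoPred u := fun hn h =>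
    ⟨hR.steps_deltaC hn.1 h.1, fun x hx => h.2 x (hR.dec.steps_vars hn.1 hx)⟩
  refine ⟨⟨s, hR.dec.steps_hasSort h1.1 hs1, hR.dec.steps_hasSort h2.1 hs2⟩, key h2 h.right, ?_⟩
  rcases h.left with h | ⟨⟨p, hp, ts, h⟩, h'⟩
  · exact .inl (key h1 h)
  · have hw : R.sig.WT (.app p ts) := ⟨s, h ▸ hs1⟩
    rcases hR.steps_hasRoot hp h1.1 ⟨ts, h⟩ with h3 | h3
    · exact .inr ⟨⟨p, hp, h3⟩, (nf_eqE ⟨s, hs2⟩ h2).symm.trans h'⟩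
    · refine .inl ⟨h3.1, fun x hx => hR.vars_app hw x ?_⟩
      rw [← h]
      exact hR.dec.steps_vars h1.1 hx

variable {sub : Subroutines S F} (hs : sub.Correct R)
include hs

theorem not_obvious {D : Conj S F} (hD : ∀ e ∈ D, R.IsItem e) (h : R.full.Sat D) :
    (!sub.obvious D) = true := by
  rw [Bool.not_eq_true', Bool.eq_false_iff]
  exact fun ho => hs.obvious D (fun e he => (hD e he).eqn) ho
    ((hR.dec.satNe_canon_iff fun e he => (hD e he).eqn).2 h)

omit hR [Primcodable S] [Primcodable F] in
theorem varUnif_spec {G D : Conj S F} (hG : ∀ e ∈ G, R.IsItem e) :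
    R.full.IsVarUnif G (G.vars ++ D.vars) (sub.varUnif G (G.vars ++ D.vars)) :=
  hs.varUnif _ _ (fun e he => (hG e he).eqn) (List.subset_append_left _ _)

theorem unifStep_isItem {G D : Conj S F} (hG : ∀ e ∈ G, R.IsItem e) (hD : ∀ e ∈ D, R.IsItem e)
    {D' : Conj S F} (h : D' ∈ unifStep sub G D) : ∀ e ∈ D', R.IsItem e := by
  obtain ⟨α, hα, rfl⟩ := List.mem_map.1 (List.mem_filter.1 h).1
  have hαs := ((varUnif_spec hs hG).1 α hα).1.1
  intro e he
  obtain ⟨e', he', rfl⟩ := List.mem_map.1 he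
  obtain ⟨e, he₀, rfl⟩ := List.mem_map.1 he'
  have hi := hR.isItem_subst (hD e he₀) hαs
  exact hR.isItem_nf hi (hs.nf _ hi.eqn.left) (hs.nf _ hi.eqn.right)

/-- Forwards, the solution is a normalized `E`-unifier of `G`, so it factors on all variables of the
disjunct through some `α`. Backwards, the composite of `α` with a solution unifies `G` because `α`
does. -/
theorem unifStep_sat {G D : Conj S F} (hG : ∀ e ∈ G, R.IsItem e) (hD : ∀ e ∈ D, R.IsItem e) :
    (∃ ρ, R.full.GroundNormal ρ ∧ (∀ e ∈ G, R.full.EqE (e.1.subst ρ) (e.2.subst ρ)) ∧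
      R.full.SatBy ρ D) ↔ ∃ D' ∈ unifStep sub G D, R.full.Sat D' := by
  have hU := varUnif_spec hs (D := D) hG
  have hnf : ∀ {t : Tm S F} {σ ρ : Subst S F}, R.sig.WT t → R.sig.IsSubst σ → R.sig.IsSubst ρ →
      R.full.EqE ((t.subst σ).subst ρ) ((sub.nf (t.subst σ)).subst ρ) := fun ht hσ hρ =>
    Sig.EqMod.subst (nf_eqE (ht.subst hσ) (hs.nf _ (ht.subst hσ))) hρ
  constructor
  · rintro ⟨ρ, hρ, hg, hd⟩
    obtain ⟨α, hα, ρ', hρ', -, he⟩ := hU.2 ρ ⟨hρ.subst, hg⟩ hρ.irred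
    have hαs := (hU.1 α hα).1.1
    -- The factor `ρ'` is ground only on the variables in the values of `α`, because `=_B` preserves
    -- groundness; off these it is replaced by ground terms.
    obtain ⟨ρ'', hρ'', he'⟩ := hR.dec.exists_groundNormal hR.nonempty hρ'
      (X := (G.vars ++ D.vars).flatMap fun x => (α.fn x).vars) fun y hy => by
        obtain ⟨x, hx, hy⟩ := List.mem_flatMap.1 hy
        exact Term.ground_subst.1 ((hR.dec.eqB_ground (he x hx)).1 (hρ.ground x)) y hy
    have key : ∀ t : Tm S F, R.sig.WT t → t.vars ⊆ D.vars →
        R.full.EqE (t.subst ρ) ((sub.nf (t.subst α.fn)).subst ρ'') := fun t ht hv => by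
      refine Sig.EqMod.trans ?_ (hnf ht hαs hρ''.subst)
      rw [Term.subst_subst]
      refine eqE_subst_congr ht hρ.subst (hαs.comp hρ''.subst) fun x hx => ?_
      have hx : x ∈ G.vars ++ D.vars := List.mem_append_right _ (hv hx)
      exact (eqE_of_eqB (he x hx)).trans (eqE_subst_congr ⟨_, hαs x⟩ hρ' hρ''.subst
        fun y hy => he' y (List.mem_flatMap.2 ⟨x, hx, hy⟩))
    have hsat : R.full.Sat ((D.subst α.fn).map fun e => (sub.nf e.1, sub.nf e.2)) := by
      refine ⟨ρ'', hρ'', fun e he h => ?_⟩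
      obtain ⟨e', he', rfl⟩ := List.mem_map.1 he
      obtain ⟨e, he₀, rfl⟩ := List.mem_map.1 he'
      refine hd e he₀ (((key e.1 (hD e he₀).eqn.left fun x hx => ?_).trans h).trans
        (key e.2 (hD e he₀).eqn.right fun x hx => ?_).symm)
      exacts [Conj.mem_vars.2 ⟨e, he₀, .inl hx⟩, Conj.mem_vars.2 ⟨e, he₀, .inr hx⟩]
    refine ⟨_, List.mem_filter.2 ⟨List.mem_map_of_mem hα, ?_⟩, hsat⟩
    refine hR.not_obvious hs (fun e he => ?_) hsat
    obtain ⟨e', he', rfl⟩ := List.mem_map.1 he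
    obtain ⟨e, he₀, rfl⟩ := List.mem_map.1 he'
    have hi := hR.isItem_subst (hD e he₀) hαs
    exact hR.isItem_nf hi (hs.nf _ hi.eqn.left) (hs.nf _ hi.eqn.right)
  · rintro ⟨D', hD', ρ', hρ', hd⟩
    obtain ⟨α, hα, rfl⟩ := List.mem_map.1 (List.mem_filter.1 hD').1
    obtain ⟨hαs, hαu⟩ := (hU.1 α hα).1
    obtain ⟨ρ, hρ, he⟩ := hR.dec.exists_pull hαs hρ'.subst hρ'.ground
    have hp : ∀ {t : Tm S F}, R.sig.WT t → R.full.EqE ((t.subst α.fn).subst ρ') (t.subst ρ) :=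
      fun ht => eqE_pull hαs hρ'.subst hρ.subst he ht
    refine ⟨ρ, hρ, fun e he => ?_, fun e he h => ?_⟩
    · have h : R.full.EqE (e.1.subst α.fn) (e.2.subst α.fn) := hαu e he
      exact ((hp (hG e he).eqn.left).symm.trans (h.subst hρ'.subst)).trans
        (hp (hG e he).eqn.right)
    · have h1 := (hD e he).eqn.left
      have h2 := (hD e he).eqn.right
      exact hd _ (List.mem_map_of_mem (List.mem_map_of_mem he))
        ((((hnf h1 hαs hρ'.subst).symm.trans (hp h1)).trans h).trans
          ((hp h2).symm.trans (hnf h2 hαs hρ'.subst)))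

end Conditions
end PredTheory
end
end VarSat

/-! ### Step 2: one round and its soundness -/

namespace VarSat
section
variable {S F : Type}

theorem mem_vars_fn [DecidableEq S] {θ : ASubst S F} {x y : Var S} (h : y ∈ (θ.fn x).vars) :
    y = x ∨ y ∈ θ.flatMap fun b => b.2.vars := by
  unfold ASubst.fn at h
  cases hl : θ.lookup x with
  | none => left; simpa [hl, Term.vars] using h
  | some t =>
    right
    rw [hl, Option.getD_some] at h
    obtain ⟨l, l', rfl, -⟩ := List.lookup_eq_some_iff.1 hl
    exact List.mem_flatMap.2 ⟨(x, t), by simp, h⟩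

theorem shift_ne_of_freshIdx {W : List (Var S)} {t : Tm S F} {y : Var S}
    (h : y ∈ (t.subst (shift (freshIdx W))).vars) : y ∉ W := fun hW => by
  have := mem_vars_shift h
  have := lt_freshIdx hW
  omega

variable [PartialOrder S]
open RewTheory.IsDecomposition

namespace PredTheory.Conditions
variable {R : PredTheory S F} [DecidableEq S] [Primcodable S] [Primcodable F]
  (hR : R.Conditions) {sub : Subroutines S F} (hs : sub.Correct R)
include hR

omit [DecidableEq S] [Primcodable S] [Primcodable F] hR in
theorem isItem_of_omegaC {e : Eqn S F} (h : R.omegaC.sig.IsEqn e)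
    (hv : ∀ x ∈ e.1.vars ++ e.2.vars, x.1 ≠ R.Pred) : R.IsItem e ∧ R.isPi e = false := by
  obtain ⟨h1, h2, h3⟩ := Sig.isEqn_restrict.1 h
  have h2 := (allSyms_isCtor_iff.1 h2).2
  have h3 := (allSyms_isCtor_iff.1 h3).2
  exact ⟨⟨h1, ⟨h3, fun x hx => hv x (List.mem_append_right _ hx)⟩,
    .inl ⟨h2, fun x hx => hv x (List.mem_append_left _ hx)⟩⟩, isPi_of_notPred h2⟩

omit [Primcodable S] [Primcodable F] [DecidableEq S] hR in
theorem hasSort_pattern {p : F} (hp : R.IsNegPatterns p) {pt : Pattern S F}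
    (hpt : pt ∈ R.pats p) : R.sig.HasSort (.app p pt.1) R.Pred :=
  (Sig.hasSort_restrict.1 (hp.sort pt hpt)).1

/-- The items of a pattern, renamed, are `(Δ ⊎ Ω_c)`-disequalities. -/
theorem pattern_isItem {p : F} (hp : R.part p = .pred) {pt : Pattern S F}
    (hpt : pt ∈ R.pats p) {e : Eqn S F} (he : e ∈ pt.2) : R.IsItem e ∧ R.isPi e = false := by
  refine isItem_of_omegaC ((hR.patterns p hp).constr pt hpt e he) fun x hx => ?_
  refine hR.vars_app ⟨_, hasSort_pattern (hR.patterns p hp) hpt⟩ x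
    ((hR.patterns p hp).vars pt hpt (Conj.mem_vars.2 ⟨e, he, List.mem_append.1 hx⟩))

include hs

omit [Primcodable S] [Primcodable F] hR in
theorem variants_spec {t : Tm S F} {W : List (Var S)} (ht : R.sig.WT t) (hW : t.vars ⊆ W)
    {v : Tm S F × ASubst S F} (hv : v ∈ sub.variants t W) :
    R.sig.IsSubst v.2.fn ∧ Away v.2.fn t.vars W ∧ R.full.NFB (t.subst v.2.fn) v.1 := by
  obtain ⟨h1, h2⟩ := (hs.variants t W ht hW).1 v hv
  refine ⟨h1.subst, by simpa using h2, by simpa using h1.nf⟩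

omit hR [Primcodable S] [Primcodable F] [PartialOrder S] [DecidableEq S] hs in
theorem all_notDef_iff {t : Tm S F} :
    (t.syms.all fun f => decide (R.part f ≠ .defined)) = true ↔ t.AllSyms R.NotDef := by
  simp [Term.AllSyms, NotDef]

omit hs in
theorem pattern_unif_isEqn {p : F} (hp : R.part p = .pred) {t t' : Tm S F}
    (ht : R.sig.HasSort t R.Pred) (hn : R.full.NFB t t') (hd : t'.AllSyms R.NotDef)
    {pt : Pattern S F} (hpt : pt ∈ R.pats p) (k : ℕ) :
    R.omega.sig.IsEqn (t', (Term.app p pt.1).subst (shift k)) :=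
  ⟨R.Pred, Sig.hasSort_restrict.2 ⟨hR.dec.nfb_hasSort hn ht, hd⟩,
    ((hR.patterns p hp).sort pt hpt).subst (isSubst_shift k)⟩

variable [DecidableEq F]

theorem elimOne_mem {W : List (Var S)} {p : F} {t : Tm S F} {D₁ D₂ : Conj S F}
    (hp : R.part p = .pred) (ht : R.sig.HasSort t R.Pred) (hW : t.vars ⊆ W)
    {D' : Conj S F} (h : D' ∈ R.elimOne sub W D₁ p t D₂) :
    ∃ v ∈ sub.variants t W, HasRoot p v.1 ∧ v.1.AllSyms R.NotDef ∧ ∃ pt ∈ R.pats p,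
      ∃ k, (∀ y ∈ ((Term.app p pt.1).subst (shift k)).vars, y ∉ W) ∧
      ∃ α : ASubst S F, R.omega.sig.IsSubst α.fn ∧
        R.full.EqB (v.1.subst α.fn) (((Term.app p pt.1).subst (shift k)).subst α.fn) ∧
        D' = ((D₁ ++ pt.2.subst (shift k) ++ D₂).subst v.2.fn).subst α.fn := by
  obtain ⟨v, hv, h⟩ := List.mem_flatMap.1 (List.mem_filter.1 h).1
  split_ifs at h with hc
  · rw [Bool.and_eq_true, rootIs_iff, all_notDef_iff] at hc
    obtain ⟨pt, hpt, h⟩ := List.mem_flatMap.1 h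
    obtain ⟨α, hα, rfl⟩ := List.mem_map.1 h
    obtain ⟨h1, h2, h3⟩ := variants_spec hs ⟨_, ht⟩ hW hv
    have heq := hR.pattern_unif_isEqn hp (ht.subst h1) h3 hc.2 hpt
      (freshIdx (W ++ v.2.flatMap (fun b => b.2.vars) ++ v.1.vars))
    obtain ⟨⟨h4, h5⟩, -⟩ := (hs.unif _ _ (by simpa using heq) (by
      intro x hx
      simp only [Conj.mem_vars, List.mem_singleton, exists_eq_left] at hx
      simp only [List.mem_append]
      tauto)).1 α hα
    refine ⟨v, hv, hc.1, hc.2, pt, hpt, _, fun y hy => ?_, α, h4, ?_, rfl⟩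
    · exact fun hyW => shift_ne_of_freshIdx hy (by simp [hyW])
    · exact (h5 _ (List.mem_singleton.2 rfl)).mono (fun _ _ _ => Sig.op_of_restrict)
        Set.subset_union_right
  · simp at h

omit hR [Primcodable S] [Primcodable F] [PartialOrder S] [DecidableEq F] [DecidableEq S] hs in
-- The variant substitution moves only variables in `W`, which the renamed pattern avoids. Applying
-- it to the renamed constraint therefore changes nothing.
theorem subst_shift_away {t s : Tm S F} {θ : Subst S F} {W : List (Var S)}
    (ha : Away θ t.vars W) (hW : t.vars ⊆ W) {k : ℕ}
    (hk : ∀ y ∈ (s.subst (shift k)).vars, y ∉ W) :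
    (s.subst (shift k)).subst θ = s.subst (shift k) := by
  refine (Term.subst_congr _ fun y hy => ?_).trans (Term.subst_var _)
  by_contra h
  exact hk y hy (hW ((ha.1 y).1 h))

omit hR [Primcodable S] [Primcodable F] [PartialOrder S] [DecidableEq F] [DecidableEq S] hs in
theorem vars_subst_mono {s q : Tm S F} (h : s.vars ⊆ q.vars) (σ : Subst S F) :
    (s.subst σ).vars ⊆ (q.subst σ).vars := fun y hy => by
  obtain ⟨x, hx, hy⟩ := Term.mem_vars_subst.1 hy
  exact Term.mem_vars_subst.2 ⟨x, h hx, hy⟩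

omit [DecidableEq F] hs in
-- The constraint of a pattern consists of constructor disequalities, and substitutions preserve the
-- number of predicate disequalities. What is left is the count on both sides of the eliminated one,
-- which makes the rounds end.
theorem elimOne_isItem_aux {p : F} {D₁ D₂ : Conj S F} (hp : R.part p = .pred)
    (h1 : ∀ e ∈ D₁, R.IsItem e) (h2 : ∀ e ∈ D₂, R.IsItem e) {pt : Pattern S F}
    (hpt : pt ∈ R.pats p) (k : ℕ) {θ α : Subst S F} (hθ : R.sig.IsSubst θ)
    (hα : R.sig.IsSubst α) :
    (∀ e ∈ ((D₁ ++ pt.2.subst (shift k) ++ D₂).subst θ).subst α, R.IsItem e) ∧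
      (((D₁ ++ pt.2.subst (shift k) ++ D₂).subst θ).subst α).countP R.isPi =
        D₁.countP R.isPi + D₂.countP R.isPi := by
  have hC : ∀ e ∈ pt.2.subst (shift k), R.IsItem e ∧ R.isPi e = false := by
    intro e he
    obtain ⟨e, he₀, rfl⟩ := List.mem_map.1 he
    have h := hR.pattern_isItem hp hpt he₀
    exact ⟨hR.isItem_subst h.1 (isSubst_shift k), by rw [hR.isPi_subst h.1 (isSubst_shift k), h.2]⟩
  have hall : ∀ e ∈ D₁ ++ pt.2.subst (shift k) ++ D₂, R.IsItem e := by
    simp only [List.mem_append]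
    rintro e ((he | he) | he)
    exacts [h1 e he, (hC e he).1, h2 e he]
  refine ⟨fun e he => ?_, ?_⟩
  · obtain ⟨e', he', rfl⟩ := List.mem_map.1 he
    obtain ⟨e, he₀, rfl⟩ := List.mem_map.1 he'
    exact hR.isItem_subst (hR.isItem_subst (hall e he₀) hθ) hα
  · rw [Conj.subst, Conj.subst, List.countP_map, List.countP_map]
    have : List.countP R.isPi (pt.2.subst (shift k)) = 0 :=
      List.countP_eq_zero.2 fun e he => by simp [(hC e he).2]
    rw [List.countP_congr (q := R.isPi) fun e he => ?_, List.countP_append, List.countP_append,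
      this, add_zero]
    simp only [Function.comp]
    rw [hR.isPi_subst (hR.isItem_subst (hall e he) hθ) hα, hR.isPi_subst (hall e he) hθ]

theorem elimOne_isItem {p : F} {t v : Tm S F} {D₁ D₂ : Conj S F} (hp : R.part p = .pred)
    (hr : HasRoot p t) (hD : ∀ e ∈ D₁ ++ (t, v) :: D₂, R.IsItem e) {W : List (Var S)}
    (hW : t.vars ⊆ W) {D' : Conj S F} (h : D' ∈ R.elimOne sub W D₁ p t D₂) :
    (∀ e ∈ D', R.IsItem e) ∧ D'.countP R.isPi = D₁.countP R.isPi + D₂.countP R.isPi := by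
  obtain ⟨ts, rfl⟩ := hr
  have ht := hR.hasSort_pred hp (hD (.app p ts, v) (by simp)).eqn.left
  obtain ⟨v, hv, -, -, pt, hpt, k, -, α, hα, -, rfl⟩ := hR.elimOne_mem hs hp ht hW h
  exact hR.elimOne_isItem_aux hp (fun e he => hD e (by simp [he])) (fun e he => hD e (by simp [he]))
    hpt k (variants_spec hs ⟨_, ht⟩ hW hv).1 fun x => (hα x).mono fun _ _ _ => Sig.op_of_restrict

/-- Solutions of the conjunctions that result from Step 2 yield solutions of the given one. -/
theorem elimOne_sound {p : F} {t v : Tm S F} {D₁ D₂ : Conj S F} (hp : R.part p = .pred)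
    (hr : HasRoot p t) (hD : ∀ e ∈ D₁ ++ (t, v) :: D₂, R.IsItem e) {W : List (Var S)}
    (hW : t.vars ⊆ W) {D' : Conj S F} (h : D' ∈ R.elimOne sub W D₁ p t D₂)
    (hsat : R.full.Sat D') : R.full.Sat (D₁ ++ (t, v) :: D₂) := by
  obtain ⟨ts, rfl⟩ := hr
  have hi := hD (.app p ts, v) (by simp)
  have ht := hR.hasSort_pred hp hi.eqn.left
  have hpat := hR.patterns p hp
  obtain ⟨⟨t', θ⟩, hv, -, -, pt, hpt, k, hk, α, hα, hu, rfl⟩ := hR.elimOne_mem hs hp ht hW h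
  obtain ⟨hθ, haway, hnf⟩ := variants_spec hs ⟨_, ht⟩ hW hv
  have hα : R.sig.IsSubst α.fn := fun x => (hα x).mono fun _ _ _ => Sig.op_of_restrict
  obtain ⟨ρ', hρ', hsat⟩ := hsat
  -- The solution `ρ'` is pulled back twice: along `θα` to the variables of the given conjunction,
  -- and along the renaming followed by `α` to those of the pattern.
  obtain ⟨ρ, hρ, hpull⟩ := hR.dec.exists_pull (hθ.comp hα) hρ'.subst hρ'.ground
  obtain ⟨ρj, hρj, hpull'⟩ := hR.dec.exists_pull
    (σ := fun x => (shift k x).subst α.fn) ((isSubst_shift k).comp hα) hρ'.subst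
    hρ'.ground
  have hq : ∀ s : Tm S F, R.sig.WT s → R.full.EqE (((s.subst θ.fn).subst α.fn).subst ρ')
      (s.subst ρ) := fun s hs => by
    rw [Term.subst_subst s]
    exact eqE_pull (hθ.comp hα) hρ'.subst hρ.subst hpull hs
  have hq' : ∀ s : Tm S F, R.sig.WT s →
      R.full.EqE (((s.subst (shift k)).subst α.fn).subst ρ') (s.subst ρj) := fun s hs => by
    rw [Term.subst_subst s]
    exact eqE_pull ((isSubst_shift k).comp hα) hρ'.subst hρj.subst hpull' hs
  have hpw : R.sig.WT (.app p pt.1) := ⟨_, hasSort_pattern hpat hpt⟩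
  -- No variable of a predicate atom has sort `Pred`, so the ground normal forms put in for the
  -- variables are `Ω_c`-terms.
  have hinst : R.IsPatInst (Term.app p pt.1).vars ρj := fun x hx =>
    ⟨hρj.ground x, Sig.hasSort_restrict.2 ⟨hρj.subst x, hR.isCtor_of_irred (hρj.ground x)
      ⟨_, hρj.subst x⟩ (hρj.irred x)
      (hR.of_sort_ne_pred (hρj.subst x) (hR.vars_app hpw x hx)).1⟩, hρj.irred x⟩
  have hcon : ∀ e ∈ pt.2, ¬ R.full.EqE (e.1.subst ρj) (e.2.subst ρj) := by
    intro e he hne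
    have hew := (hR.pattern_isItem hp hpt he).1.eqn
    have hev : ∀ s : Tm S F, s.vars ⊆ pt.2.vars →
        (s.subst (shift k)).subst θ.fn = s.subst (shift k) := fun s hsv =>
      subst_shift_away haway hW fun y hy =>
        hk y (vars_subst_mono (List.Subset.trans hsv (hpat.vars pt hpt)) _ hy)
    have hmem : ((e.subst (shift k)).subst θ.fn).subst α.fn ∈
        ((D₁ ++ pt.2.subst (shift k) ++ D₂).subst θ.fn).subst α.fn :=
      List.mem_map_of_mem (List.mem_map_of_mem (List.mem_append_left _
        (List.mem_append_right _ (List.mem_map_of_mem he))))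
    refine hsat _ hmem ?_
    simp only [Eqn.subst]
    rw [hev _ fun x hx => Conj.mem_vars.2 ⟨e, he, .inl hx⟩,
      hev _ fun x hx => Conj.mem_vars.2 ⟨e, he, .inr hx⟩]
    exact ((hq' _ hew.left).trans hne).trans (hq' _ hew.right).symm
  refine ⟨ρ, hρ, fun e he hne => ?_⟩
  have hew := (hD e he).eqn
  have hother : e ∈ D₁ ∨ e ∈ D₂ → False := fun he => by
    have hmem : (e.subst θ.fn).subst α.fn ∈
        ((D₁ ++ pt.2.subst (shift k) ++ D₂).subst θ.fn).subst α.fn :=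
      List.mem_map_of_mem (List.mem_map_of_mem (by
        simp only [List.mem_append]
        tauto))
    exact hsat _ hmem (((hq _ hew.left).trans hne).trans (hq _ hew.right).symm)
  rcases List.mem_append.1 he with he | he
  · exact hother (.inl he)
  rcases List.mem_cons.1 he with rfl | he
  -- As its constraint holds, the instance of the pattern represents an element of `C_R`. It is then
  -- irreducible, so it cannot be equal to `tt`, although it is `E`-equal to the instance of the
  -- eliminated atom.
  · obtain ⟨t₀, u₀, -, -, hn, hcls⟩ := (hpat.inst_iff pt hpt ρj hinst).2 hcon
    have hirr : R.full.Irred ((Term.app p pt.1).subst ρj) := by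
      have : (Term.app p pt.1).subst ρj ∈ R.full.cls ((Term.app p pt.1).subst ρj) :=
        Sig.EqMod.refl (hpw.subst hρj.subst)
      rw [hcls] at this
      exact hR.dec.irred_of_eqB this hn.2
    refine hR.not_eqE_tt hp ⟨_, by rw [Term.subst]⟩ hirr ?_
    have h1 : R.full.EqE (((Term.app p ts).subst θ.fn).subst α.fn) (t'.subst α.fn) :=
      ((hR.dec.nfb_iff (Sig.WT.subst ⟨_, ht⟩ hθ)).1 hnf).1.subst hα
    have h2 : R.full.EqE (v.subst ρ) ((Term.app R.tt []).subst ρ) := by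
      rcases hi.left with h | h
      · exact absurd hp (Term.allSyms_app.1 h.1).1
      · exact h.2.subst hρ.subst
    rw [Term.subst] at h2
    have h3 : R.full.EqE (((Term.app p ts).subst θ.fn).subst α.fn)
        (((Term.app p pt.1).subst (shift k)).subst α.fn) := h1.trans (eqE_of_eqB hu)
    exact ((hq' _ hpw).symm.trans (h3.subst hρ'.subst).symm).trans
      (((hq _ ⟨_, ht⟩).trans hne).trans h2)
  · exact hother (.inr he)

end PredTheory.Conditions
end
end VarSat

/-! ### Step 2: completeness and iteration -/

namespace VarSat
section
variable {S F : Type} [PartialOrder S]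
open RewTheory.IsDecomposition

namespace PredTheory.Conditions
variable {R : PredTheory S F} [DecidableEq S] [DecidableEq F] [Primcodable S] [Primcodable F]
  (hR : R.Conditions) {sub : Subroutines S F} (hs : sub.Correct R)
include hR hs

/-- A solution yields a solution of one of the conjunctions that result from Step 2. -/
theorem elimOne_complete {p : F} {t v : Tm S F} {D₁ D₂ : Conj S F} (hp : R.part p = .pred)
    (hr : HasRoot p t) (hD : ∀ e ∈ D₁ ++ (t, v) :: D₂, R.IsItem e)
    (hsat : R.full.Sat (D₁ ++ (t, v) :: D₂)) :
    ∃ D' ∈ R.elimOne sub (Conj.vars (D₁ ++ (t, v) :: D₂)) D₁ p t D₂, R.full.Sat D' := by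
  classical
  set W := Conj.vars (D₁ ++ (t, v) :: D₂) with hW'
  have hW : t.vars ⊆ W := fun x hx => Conj.mem_vars.2 ⟨(t, v), by simp, .inl hx⟩
  obtain ⟨ts, rfl⟩ := hr
  have hi := hD (.app p ts, v) (by simp)
  have ht := hR.hasSort_pred hp hi.eqn.left
  have hpat := hR.patterns p hp
  obtain ⟨ρ, hρ, hsat⟩ := hsat
  -- the normal form of the instance of the predicate atom
  have hneq : ¬ R.full.EqE ((Term.app p ts).subst ρ) (.app R.tt []) := fun h => by
    have h2 : R.full.EqE (v.subst ρ) ((Term.app R.tt []).subst ρ) := by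
      rcases hi.left with h | h
      · exact absurd hp (Term.allSyms_app.1 h.1).1
      · exact h.2.subst hρ.subst
    rw [Term.subst] at h2
    exact hsat (.app p ts, v) (by simp) (h.trans h2.symm)
  have htρ := ht.subst hρ.subst
  obtain ⟨u, hu⟩ := hR.dec.exists_nf ((Term.app p ts).subst ρ)
  have hus := hR.dec.steps_hasSort hu.1 htρ
  have hug : u.Ground := List.subset_nil.1 fun x hx => by
    have := hR.dec.steps_vars hu.1 hx
    rwa [show ((Term.app p ts).subst ρ).vars = [] from
      Term.ground_subst.2 fun y _ => hρ.ground y] at this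
  -- Not being `tt`, the instance keeps its predicate under normalization, so the patterns apply to
  -- it.
  have hur : HasRoot p u := by
    rcases hR.steps_hasRoot hp hu.1 ⟨_, by rw [Term.subst]⟩ with h | h
    · exact h
    · exact absurd ((nf_eqE ⟨_, htρ⟩ hu).trans h.2) hneq
  have hud : u.AllSyms R.NotDef := hR.notDef_of_irred hug ⟨_, hus⟩ hu.2
  -- the pattern
  obtain ⟨pt, hpt, ρj, hinst, hcon, huq⟩ : ∃ pt ∈ R.pats p, ∃ ρj,
      R.IsPatInst (Term.app p pt.1).vars ρj ∧
      (∀ e ∈ pt.2, ¬ R.full.EqE (e.1.subst ρj) (e.2.subst ρj)) ∧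
      R.full.EqB u ((Term.app p pt.1).subst ρj) := by
    obtain ⟨us, rfl⟩ := hur
    obtain ⟨pt, hpt, ρj, hinst, hcls, hcon⟩ :=
      (hpat.complete_iff us hug hus).1 ⟨_, _, hug, hus, ⟨.refl, hu.2⟩, rfl⟩
    have : Term.app p us ∈ R.full.cls (.app p us) := Sig.EqMod.refl ⟨_, hus⟩
    rw [hcls] at this
    exact ⟨pt, hpt, ρj, hinst, hcon, Sig.EqMod.symm this⟩
  have hpw : R.sig.WT (.app p pt.1) := ⟨_, hasSort_pattern hpat hpt⟩
  -- the variant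
  have hvar := hR.dec.isVariant_cut (ts := [.app p ts]) (vs := [u]) hρ.subst hρ.irred
    (.cons ⟨u, hu, .refl ⟨_, hus⟩⟩ .nil)
  obtain ⟨⟨t', θ⟩, hv, ρ₁, hρ₁, h1, h2⟩ := (hs.variants _ W ⟨_, ht⟩ hW).2 _ _ hvar
  obtain ⟨hθ, haway, hnf⟩ := variants_spec hs ⟨_, ht⟩ hW hv
  have h1 : ∀ x ∈ (Term.app p ts).vars, R.full.EqB ((θ.fn x).subst ρ₁) (ρ x) := fun x hx => by
    have := h1 x (by simpa using hx)
    rwa [Sig.cut, if_pos (by simpa using hx)] at this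
  have h2 : R.full.EqB (t'.subst ρ₁) u := (List.forall₂_cons.1 h2).1
  have htθ := ht.subst hθ
  have ht's : R.sig.HasSort t' R.Pred := hR.dec.nfb_hasSort hnf htθ
  have ht'd : t'.AllSyms R.NotDef :=
    (Term.allSyms_subst.1 ((h2.allSyms hR.ax_notDef).2 hud)).1
  obtain ⟨w, hw, ht'w⟩ := hnf
  -- Otherwise the variant would be `E`-equal to `tt`, and then so would its instance `u`.
  have ht'r : HasRoot p t' := by
    rw [hR.hasRoot_eqB hp ht'w]
    rcases hR.steps_hasRoot hp hw.1 ⟨_, by rw [Term.subst]⟩ with h | ⟨-, h⟩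
    · exact h
    · exfalso
      have h3 : R.full.EqE (t'.subst ρ₁) ((Term.app R.tt []).subst ρ₁) :=
        Sig.EqMod.subst ((eqE_of_eqB ht'w).trans h) hρ₁
      rw [Term.subst] at h3
      exact hneq ((nf_eqE ⟨_, htρ⟩ hu).trans ((eqE_of_eqB h2).symm.trans h3))
  set Z := (Term.app p ts).vars.flatMap fun x => (θ.fn x).vars with hZ
  have ht'Z : t'.vars ⊆ Z := fun y hy => by
    have := hR.dec.steps_vars hw.1 ((hR.dec.eqB_mem_vars ht'w y).1 hy)
    obtain ⟨x, hx, hy⟩ := Term.mem_vars_subst.1 this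
    exact List.mem_flatMap.2 ⟨x, hx, hy⟩
  -- The variables `Z` of the variant, `W` of the conjunction and those of the renamed pattern are
  -- pairwise disjoint, so substitutions on them can be glued.
  have hZW : ∀ y ∈ Z, y ∉ W := fun y hy => by
    obtain ⟨x, hx, hy⟩ := List.mem_flatMap.1 hy
    exact haway.2.1 x hx y hy
  set W₁ := W ++ θ.flatMap (fun b => b.2.vars) ++ t'.vars with hW₁
  have hWW₁ : W ⊆ W₁ := fun x hx => by simp [hW₁, hx]
  have hZW₁ : Z ⊆ W₁ := fun y hy => by
    obtain ⟨x, hx, hy⟩ := List.mem_flatMap.1 hy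
    rcases mem_vars_fn hy with rfl | hy
    · exact hWW₁ (hW hx)
    · exact List.mem_append_left _ (List.mem_append_right _ hy)
  set k := freshIdx W₁ with hk
  set q := (Term.app p pt.1).subst (shift k) with hq
  have hqW₁ : ∀ y ∈ q.vars, y ∉ W₁ := fun y hy => shift_ne_of_freshIdx hy
  -- the common instance of the variant and the pattern
  set σ : Subst S F := fun y => if y ∈ Z then ρ₁ y else if y ∈ W then ρ y else
    if y ∈ q.vars then unshift k ρj y else .var y with hσ
  have hσZ : ∀ y ∈ Z, σ y = ρ₁ y := fun y hy => if_pos hy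
  have hσW : ∀ y ∈ W, σ y = ρ y := fun y hy =>
    (if_neg fun h => hZW y h hy).trans (if_pos hy)
  have hσq : ∀ y ∈ q.vars, σ y = unshift k ρj y := fun y hy =>
    (if_neg fun h => hqW₁ y hy (hZW₁ h)).trans
      ((if_neg fun h => hqW₁ y hy (hWW₁ h)).trans (if_pos hy))
  -- The unification takes place over `Ω_c ⊎ Ω_Π`, so the glued substitution must be free of defined
  -- symbols. On `Z` this is inherited from ground normal forms to which the instances of `θ` are
  -- `B`-equal, on `W` the values are such normal forms, and on the pattern they are `Ω_c`-terms.
  have hgd : ∀ y ∈ Z ++ W ++ q.vars, (σ y).Ground ∧ R.omega.sig.HasSort (σ y) y.1 := by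
    intro y hy
    rw [List.mem_append, List.mem_append] at hy
    rcases hy with (hy | hy) | hy
    · rw [hσZ y hy]
      obtain ⟨x, hx, hy⟩ := List.mem_flatMap.1 hy
      exact ⟨Term.ground_subst.1 ((hR.dec.eqB_ground (h1 x hx)).2 (hρ.ground x)) y hy,
        Sig.hasSort_restrict.2 ⟨hρ₁ y, (Term.allSyms_subst.1 (((h1 x hx).allSyms hR.ax_notDef).2
          (hR.notDef_of_irred (hρ.ground x) ⟨_, hρ.subst x⟩ (hρ.irred x)))).2 y hy⟩⟩
    · rw [hσW y hy]
      exact ⟨hρ.ground y, Sig.hasSort_restrict.2 ⟨hρ.subst y,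
        hR.notDef_of_irred (hρ.ground y) ⟨_, hρ.subst y⟩ (hρ.irred y)⟩⟩
    · rw [hσq y hy]
      obtain ⟨x, hx, hy⟩ := Term.mem_vars_subst.1 hy
      simp only [shift, Term.vars, List.mem_singleton] at hy
      subst hy
      simp only [unshift, Nat.add_sub_cancel]
      obtain ⟨h3, h4, -⟩ := hinst x hx
      obtain ⟨h4, h5⟩ := Sig.hasSort_restrict.1 h4
      exact ⟨h3, Sig.hasSort_restrict.2 ⟨h4, (allSyms_isCtor_iff.1 h5).1⟩⟩
  have hσs : R.omega.sig.IsSubst σ := fun y => by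
    by_cases hy : y ∈ Z ++ W ++ q.vars
    · exact (hgd y hy).2
    · simp only [List.mem_append, not_or] at hy
      simp only [hσ, if_neg hy.1.1, if_neg hy.1.2, if_neg hy.2]
      exact .var y
  have hσf : R.sig.IsSubst σ := fun y => (hσs y).mono fun _ _ _ => Sig.op_of_restrict
  have ht'σ : t'.subst σ = t'.subst ρ₁ := Term.subst_congr _ fun y hy => hσZ y (ht'Z hy)
  have hpσ : ∀ s : Tm S F, s.vars ⊆ (Term.app p pt.1).vars →
      (s.subst (shift k)).subst σ = s.subst ρj := fun s hsv => by
    rw [← shift_unshift k ρj s]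
    exact Term.subst_congr _ fun y hy => hσq y (vars_subst_mono hsv _ hy)
  have heqn := hR.pattern_unif_isEqn hp htθ ⟨w, hw, ht'w⟩ ht'd hpt k
  have hunif : R.omega.sig.IsUnifier R.axC [(t', q)] σ := by
    refine ⟨hσs, fun e he => ?_⟩
    obtain rfl := List.mem_singleton.1 he
    refine (hR.protects_omega.eqB_iff _ _ (heqn.left.subst hσs) (heqn.right.subst hσs)).2 ?_
    have h3 : R.full.EqB (t'.subst σ) (q.subst σ) := by
      rw [ht'σ, hq, hpσ _ (List.Subset.refl _)]
      exact Sig.EqMod.trans h2 huq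
    exact h3
  obtain ⟨hU1, hU2⟩ := hs.unif [(t', q)] (W₁ ++ q.vars) (by simpa using heqn) (by
    intro x hx
    simp only [Conj.mem_vars, List.mem_singleton, exists_eq_left] at hx
    simp only [hW₁, List.mem_append]
    tauto)
  obtain ⟨α, hα, ρ₂, hρ₂, hαρ⟩ := hU2 σ hunif
  have hαs : R.sig.IsSubst α.fn := fun x =>
    ((hU1 α hα).1.1 x).mono fun _ _ _ => Sig.op_of_restrict
  have hρ₂s : R.sig.IsSubst ρ₂ := fun x => (hρ₂ x).mono fun _ _ _ => Sig.op_of_restrict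
  -- The unifiers are complete relative to a set that contains `W`, so the factorization also
  -- controls variables outside the unification problem.
  have hαρ : ∀ x ∈ Z ++ W ++ q.vars, R.full.EqB (σ x) ((α.fn x).subst ρ₂) := fun x hx => by
    refine (hαρ x ?_).mono (fun _ _ _ => Sig.op_of_restrict) Set.subset_union_right
    simp only [List.mem_append] at hx ⊢
    rcases hx with (hx | hx) | hx
    exacts [.inl (hZW₁ hx), .inl (hWW₁ hx), .inr hx]
  obtain ⟨ρ', hρ', hρ'e⟩ := hR.dec.exists_groundNormal hR.nonempty hρ₂s
    (X := (Z ++ W ++ q.vars).flatMap fun x => (α.fn x).vars) fun y hy => by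
      obtain ⟨x, hx, hy⟩ := List.mem_flatMap.1 hy
      exact Term.ground_subst.1 ((hR.dec.eqB_ground (hαρ x hx)).1 (hgd x hx).1) y hy
  have key : ∀ s : Tm S F, R.sig.WT s → s.vars ⊆ Z ++ W ++ q.vars →
      R.full.EqE ((s.subst α.fn).subst ρ') (s.subst σ) := fun s hsw hsv => by
    rw [Term.subst_subst]
    refine eqE_subst_congr hsw (hαs.comp hρ'.subst) hσf fun x hx => ?_
    refine Sig.EqMod.symm ((eqE_of_eqB (hαρ x (hsv hx))).trans ?_)
    exact eqE_subst_congr ⟨_, hαs x⟩ hρ₂s hρ'.subst fun y hy =>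
      hρ'e y (List.mem_flatMap.2 ⟨x, hsv hx, hy⟩)
  -- the new solution
  have hold : ∀ s : Tm S F, R.sig.WT s → s.vars ⊆ W →
      R.full.EqE (((s.subst θ.fn).subst α.fn).subst ρ') (s.subst ρ) := fun s hsw hsv => by
    have hθx : ∀ x ∉ (Term.app p ts).vars, θ.fn x = .var x := fun x hx => by
      by_contra h
      exact hx ((haway.1 x).1 h)
    refine (key _ (hsw.subst hθ) fun y hy => ?_).trans ?_
    · obtain ⟨x, hx, hy⟩ := Term.mem_vars_subst.1 hy
      by_cases hxt : x ∈ (Term.app p ts).vars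
      · exact List.mem_append_left _ (List.mem_append_left _ (List.mem_flatMap.2 ⟨x, hxt, hy⟩))
      · rw [hθx x hxt, Term.vars, List.mem_singleton] at hy
        subst hy
        exact List.mem_append_left _ (List.mem_append_right _ (hsv hx))
    · rw [Term.subst_subst]
      refine eqE_subst_congr hsw (hθ.comp hσf) hρ.subst fun x hx => ?_
      by_cases hxt : x ∈ (Term.app p ts).vars
      · rw [Term.subst_congr (τ := ρ₁) _ fun y hy => hσZ y (List.mem_flatMap.2 ⟨x, hxt, hy⟩)]
        exact eqE_of_eqB (h1 x hxt)
      · rw [hθx x hxt, Term.subst, hσW x (hsv hx)]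
        exact .refl ⟨_, hρ.subst x⟩
  have hnewsat : R.full.Sat
      (((D₁ ++ pt.2.subst (shift k) ++ D₂).subst θ.fn).subst α.fn) := by
    refine ⟨ρ', hρ', fun e he hne => ?_⟩
    obtain ⟨e', he', rfl⟩ := List.mem_map.1 he
    obtain ⟨e, he₀, rfl⟩ := List.mem_map.1 he'
    have hother : e ∈ D₁ ∨ e ∈ D₂ → False := fun h => by
      have he₁ : e ∈ D₁ ++ (Term.app p ts, v) :: D₂ := by
        simp only [List.mem_append, List.mem_cons]
        tauto
      have hew := (hD e he₁).eqn
      exact hsat e he₁ (((hold _ hew.left fun x hx => Conj.mem_vars.2 ⟨e, he₁, .inl hx⟩).symm.trans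
        hne).trans (hold _ hew.right fun x hx => Conj.mem_vars.2 ⟨e, he₁, .inr hx⟩))
    rw [List.mem_append, List.mem_append] at he₀
    rcases he₀ with (he₀ | he₀) | he₀
    · exact hother (.inl he₀)
    · obtain ⟨e, he₁, rfl⟩ := List.mem_map.1 he₀
      have hew := (hR.pattern_isItem hp hpt he₁).1.eqn
      have hnew : ∀ s : Tm S F, R.sig.WT s → s.vars ⊆ pt.2.vars →
          R.full.EqE ((((s.subst (shift k)).subst θ.fn).subst α.fn).subst ρ') (s.subst ρj) := by
        intro s hsw hsv
        have hsv' := List.Subset.trans hsv (hpat.vars pt hpt)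
        have hsq := vars_subst_mono hsv' (shift k)
        rw [subst_shift_away haway hW fun y hy h => hqW₁ y (hsq hy) (hWW₁ h), ← hpσ s hsv']
        exact key _ (hsw.subst (isSubst_shift k)) fun y hy => List.mem_append_right _ (hsq hy)
      exact hcon e he₁ (((hnew _ hew.left fun x hx => Conj.mem_vars.2 ⟨e, he₁, .inl hx⟩).symm.trans
        hne).trans (hnew _ hew.right fun x hx => Conj.mem_vars.2 ⟨e, he₁, .inr hx⟩))
    · exact hother (.inr he₀)
  refine ⟨_, List.mem_filter.2 ⟨List.mem_flatMap.2 ⟨(t', θ), hv, ?_⟩, ?_⟩, hnewsat⟩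
  · rw [if_pos (by rw [Bool.and_eq_true, rootIs_iff, all_notDef_iff]; exact ⟨ht'r, ht'd⟩)]
    exact List.mem_flatMap.2 ⟨pt, hpt, List.mem_map_of_mem hα⟩
  · refine hR.not_obvious hs ?_ hnewsat
    exact (hR.elimOne_isItem_aux hp (fun e he => hD e (by simp [he]))
      (fun e he => hD e (by simp [he])) hpt k hθ hαs).1

/-- The number `n` is fuel: each round lowers the number of predicate disequalities by one, so a
bound on it suffices for all of them to be eliminated. -/
theorem elim_spec (n : ℕ) {D : Conj S F} (hD : ∀ e ∈ D, R.IsItem e) (hn : D.countP R.isPi ≤ n) :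
    (R.full.Sat D ↔ ∃ D' ∈ R.elim sub n D, R.full.Sat D') ∧
      ∀ D' ∈ R.elim sub n D, ∀ e ∈ D', R.IsItem e ∧ R.isPi e = false := by
  induction n generalizing D with
  | zero =>
    have h0 := List.countP_eq_zero.1 (Nat.le_zero.1 hn)
    simp only [elim, List.mem_singleton, exists_eq_left, forall_eq, true_and]
    exact fun e he => ⟨hD e he, by simpa using h0 e he⟩
  | succ n ih =>
    rw [elim]
    cases hf : R.findPi D with
    | none =>
      simp only [List.mem_singleton, exists_eq_left, forall_eq, true_and]
      exact fun e he => ⟨hD e he, findPi_none hf e he⟩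
    | some r =>
      obtain ⟨D₁, p, t, D₂⟩ := r
      obtain ⟨hp, hr, v, rfl⟩ := findPi_some hf
      have hW : t.vars ⊆ Conj.vars (D₁ ++ (t, v) :: D₂) := fun x hx =>
        Conj.mem_vars.2 ⟨(t, v), by simp, .inl hx⟩
      have hcount : D₁.countP R.isPi + D₂.countP R.isPi ≤ n := by
        rw [List.countP_append, List.countP_cons_of_pos (isPi_iff.2 ⟨p, hp, hr⟩)] at hn
        omega
      have hitem := fun D' (h : D' ∈ R.elimOne sub (Conj.vars (D₁ ++ (t, v) :: D₂)) D₁ p t D₂) =>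
        hR.elimOne_isItem hs hp hr hD hW h
      have ih' := fun D' h => ih (hitem D' h).1 ((hitem D' h).2.trans_le hcount)
      dsimp only
      refine ⟨⟨fun h => ?_, ?_⟩, fun D'' h => ?_⟩
      · obtain ⟨D', hD', h⟩ := hR.elimOne_complete hs hp hr hD h
        obtain ⟨D'', h1, h2⟩ := (ih' D' hD').1.1 h
        exact ⟨D'', List.mem_flatMap.2 ⟨D', hD', h1⟩, h2⟩
      · rintro ⟨D'', h, hsat⟩
        obtain ⟨D', hD', h1⟩ := List.mem_flatMap.1 h
        exact hR.elimOne_sound hs hp hr hD hW hD' ((ih' D' hD').1.2 ⟨D'', h1, hsat⟩)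
      · obtain ⟨D', hD', h1⟩ := List.mem_flatMap.1 h
        exact (ih' D' hD').2 D'' h1

end PredTheory.Conditions
end
end VarSat

/-! ### Step 3 and the correctness of the procedure -/

namespace VarSat
section
variable {S F : Type}

theorem fn_cons [DecidableEq S] (y : Var S) (r : Tm S F) (τ : ASubst S F) (x : Var S) :
    ASubst.fn ((y, r) :: τ) x = if x = y then r else τ.fn x := by
  unfold ASubst.fn
  rw [List.lookup_cons]
  by_cases h : x = y
  · simp [h]
  · simp [h, beq_false_of_ne h]

theorem PredTheory.map_mem_choices {sub : Subroutines S F} {r : Subst S F} {L : List (Var S)}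
    (h : ∀ y ∈ L, r y ∈ sub.reps y.1) : (L.map fun y => (y, r y)) ∈ choices sub L := by
  induction L with
  | nil => simp [choices]
  | cons y L ih =>
    rw [choices]
    exact List.mem_flatMap.2 ⟨r y, h y (by simp),
      List.mem_map_of_mem (ih fun y hy => h y (by simp [hy]))⟩

theorem PredTheory.fn_of_mem_choices [DecidableEq S] {sub : Subroutines S F} {L : List (Var S)}
    {τ : ASubst S F} (h : τ ∈ choices sub L) (x : Var S) :
    (x ∈ L → τ.fn x ∈ sub.reps x.1) ∧ (x ∉ L → τ.fn x = .var x) := by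
  induction L generalizing τ with
  | nil =>
    obtain rfl : τ = [] := by simpa [choices] using h
    exact ⟨by simp, fun _ => rfl⟩
  | cons y L ih =>
    rw [choices] at h
    obtain ⟨r, hr, h⟩ := List.mem_flatMap.1 h
    obtain ⟨τ, hτ, rfl⟩ := List.mem_map.1 h
    rw [fn_cons]
    by_cases hxy : x = y
    · subst hxy
      simp [hr]
    · simpa [hxy] using ih hτ

variable [PartialOrder S]
open RewTheory.IsDecomposition

/-- Evaluation in the initial algebra. -/
theorem eval_initAlg {Sg : Sig S F} {E : Set (Eqn S F)} (hE : ∀ e ∈ E, Sg.IsEqn e)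
    {μ : Subst S F} (hμ : Sg.IsSubst μ) (hg : ∀ x, (μ x).Ground)
    {a : Var S → (initAlg Sg E).U} (ha : ∀ x, a x = {v | v.Ground ∧ Sg.EqMod E (μ x) v})
    {t : Tm S F} (ht : Sg.WT t) :
    (initAlg Sg E).eval a t = {v | v.Ground ∧ Sg.EqMod E (t.subst μ) v} := by
  induction t using Term.induct with
  | hv x => simpa only [Alg.eval, Term.subst] using ha x
  | ha f ts ih =>
    have hw := ht.subst hμ
    rw [Term.subst] at hw
    rw [Alg.eval, Term.subst]
    let ev : Tm S F → Set (Tm S F) := (initAlg Sg E).eval a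
    have hev : ∀ t ∈ ts, ev t = {v | v.Ground ∧ Sg.EqMod E (t.subst μ) v} :=
      fun t h => ih t h (ht.arg h)
    refine Set.ext fun v => ?_
    change (v.Ground ∧ ∃ us, List.Forall₂ (fun u c => u ∈ c) us (ts.map ev) ∧
      Sg.EqMod E (.app f us) v) ↔ v.Ground ∧ Sg.EqMod E (.app f (ts.map (Term.subst μ))) v
    refine and_congr_right fun hv => ⟨?_, fun h => ⟨ts.map (Term.subst μ), ?_, h⟩⟩
    · rintro ⟨us, h, he⟩
      refine .trans (.congr' ?_ hw (he.wt hE).1) he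
      rw [List.forall₂_map_right_iff] at h
      rw [List.forall₂_map_left_iff]
      refine List.forall₂_iff_zip.2 ⟨h.length_eq.symm, fun {t u} htu => ?_⟩
      have : u ∈ ev t := (List.forall₂_iff_zip.1 h.flip).2 htu
      rw [hev t (List.of_mem_zip htu).1] at this
      exact this.2
    · rw [List.forall₂_map_left_iff, List.forall₂_map_right_iff, List.forall₂_same]
      intro t ht'
      rw [hev t ht']
      exact ⟨Term.ground_subst.2 fun x _ => hg x, .refl ((ht.arg ht').subst hμ)⟩

theorem exists_of_satNe_initAlg {Sg : Sig S F} {E : Set (Eqn S F)} (hE : ∀ e ∈ E, Sg.IsEqn e)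
    {D : Conj S F} (hD : ∀ e ∈ D, Sg.IsEqn e) (h : (initAlg Sg E).SatNe D) :
    ∃ μ, Sg.IsSubst μ ∧ (∀ x, (μ x).Ground) ∧
      ∀ e ∈ D, ¬ Sg.EqMod E (e.1.subst μ) (e.2.subst μ) := by
  obtain ⟨a, ha, h⟩ := h
  choose μ hg hμ ha using ha
  refine ⟨μ, hμ, hg, fun e he h' => h e he ?_⟩
  rw [eval_initAlg hE hμ hg ha (hD e he).left, eval_initAlg hE hμ hg ha (hD e he).right]
  refine Set.ext fun v => and_congr_right fun _ => ?_
  exact ⟨fun h => h'.symm.trans h, fun h => h'.trans h⟩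

namespace PredTheory.Conditions
variable {R : PredTheory S F} [DecidableEq S] [DecidableEq F] [Primcodable S] [Primcodable F]
  (hR : R.Conditions) {sub : Subroutines S F} (hs : sub.Correct R)

omit [DecidableEq S] [DecidableEq F] [Primcodable S] [Primcodable F] [PartialOrder S] in
theorem all_ctor_iff {D : Conj S F} [DecidableEq Part] :
    (D.all fun e => (e.1.syms ++ e.2.syms).all fun f => decide (R.part f = .ctor)) = true ↔
      ∀ e ∈ D, e.1.AllSyms R.IsCtor ∧ e.2.AllSyms R.IsCtor := by
  simp only [List.all_eq_true, decide_eq_true_eq, List.mem_append, Term.AllSyms, IsCtor]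
  exact ⟨fun h e he => ⟨fun f hf => h e he f (.inl hf), fun f hf => h e he f (.inr hf)⟩,
    fun h e he f hf => hf.elim ((h e he).1 f) ((h e he).2 f)⟩

include hR hs

omit hR [DecidableEq F] [Primcodable S] [Primcodable F] in
theorem isReps_of_mem {s : S} (h : sub.finSort s = true) :
    R.omegaC.IsReps s (sub.reps s) ∧ ∀ r ∈ sub.reps s, R.omegaC.Irred r :=
  hs.reps s ((hs.finSort s).1 h)

omit [DecidableEq F] in
-- The normalized instance of `D` under a solution is a variant over `Ω_c`, so it is an instance of
-- a computed variant. That variant is over `Ω_c` too, and the values at its variables of finite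
-- sort select the representatives that pass the test.
theorem finalStep_complete {D : Conj S F} (hD : ∀ e ∈ D, R.IsItem e ∧ R.isPi e = false)
    (h : R.full.Sat D) : R.finalStep sub D = true := by
  obtain ⟨ρ, hρ, hsat⟩ := h
  have hDe : ∀ e ∈ D, R.full.sig.IsEqn e := fun e he => (hD e he).1.eqn
  obtain ⟨D', hvar, hnf⟩ := hR.dec.exists_isVariant_conj hDe hρ.subst hρ.irred
  obtain ⟨hV, hc⟩ := hs.conjVariants D D.vars hDe (List.Subset.refl _)
  obtain ⟨⟨D₁, γ⟩, hp, ρ₁, hρ₁, -, h2⟩ := hc _ _ hvar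
  have h2 := Conj.forall₂_sides.1 h2
  -- the sides of the more general variant have instances that are normalized ground `Ω_c`-terms
  have hnfc : ∀ {t u : Tm S F}, R.sig.WT t → R.NoPred t → R.full.NF (t.subst ρ) u →
      u.Ground ∧ u.AllSyms R.IsCtor ∧ R.full.Irred u := fun {t u} hw ht hn => by
    have hg : u.Ground := List.subset_nil.1 fun x hx => by
      have := hR.dec.steps_vars hn.1 hx
      rwa [show (t.subst ρ).vars = [] from Term.ground_subst.2 fun y _ => hρ.ground y] at this
    refine ⟨hg, hR.isCtor_of_irred hg (hR.dec.steps_wt hn.1 (hw.subst hρ.subst)) hn.2 ?_, hn.2⟩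
    exact hR.steps_deltaC hn.1 (hR.subst_notPred ht.1 ht.2 hρ.subst).1
  have hD' : ∀ e' ∈ D', (e'.1.Ground ∧ e'.1.AllSyms R.IsCtor ∧ R.full.Irred e'.1) ∧
      (e'.2.Ground ∧ e'.2.AllSyms R.IsCtor ∧ R.full.Irred e'.2) ∧
      ¬ R.full.EqE e'.1 e'.2 := fun e' he' => by
    obtain ⟨e, he, h3, h4⟩ := hnf.flip.exists_of_mem_left he'
    have hi := (hD _ he).1
    refine ⟨hnfc hi.eqn.left (hi.noPred (hD _ he).2) h3, hnfc hi.eqn.right hi.right h4, fun h => ?_⟩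
    exact hsat _ he (((nf_eqE (hi.eqn.left.subst hρ.subst) h3).trans h).trans
      (nf_eqE (hi.eqn.right.subst hρ.subst) h4).symm)
  -- A term with an irreducible ground instance over `Ω_c` is itself over `Ω_c`, and the substituted
  -- terms inherit all three properties.
  have hside : ∀ {t u : Tm S F}, R.full.EqB (t.subst ρ₁) u →
      u.Ground ∧ u.AllSyms R.IsCtor ∧ R.full.Irred u → t.AllSyms R.IsCtor ∧ ∀ x ∈ t.vars,
        (ρ₁ x).Ground ∧ R.omegaC.sig.HasSort (ρ₁ x) x.1 ∧ R.full.Irred (ρ₁ x) := by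
    rintro t u he ⟨hg, hc, hi⟩
    have hsy := Term.allSyms_subst.1 ((he.allSyms hR.ax_isCtor).2 hc)
    refine ⟨hsy.1, fun x hx => ⟨?_, ?_, ?_⟩⟩
    · exact Term.ground_subst.1 ((hR.dec.eqB_ground he).2 hg) x hx
    · exact Sig.hasSort_restrict.2 ⟨hρ₁ x, hsy.2 x hx⟩
    · exact hR.dec.irred_subst_var (hR.dec.wt_eqB he).1 (hR.dec.irred_of_eqB he.symm hi) hx
  have hctor : ∀ e ∈ D₁, e.1.AllSyms R.IsCtor ∧ e.2.AllSyms R.IsCtor := fun e he => by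
    obtain ⟨e', he', h3, h4⟩ := h2.exists_of_mem_left he
    exact ⟨(hside h3 (hD' e' he').1).1, (hside h4 (hD' e' he').2.1).1⟩
  have heqn : ∀ e ∈ D₁, R.omegaC.sig.IsEqn e := fun e he =>
    Sig.isEqn_restrict.2 ⟨hR.dec.isEqn_of_isVariant hDe (hV _ hp).1 e he, hctor e he⟩
  have hvars : ∀ x ∈ D₁.vars, (ρ₁ x).Ground ∧ R.omegaC.sig.HasSort (ρ₁ x) x.1 ∧
      R.full.Irred (ρ₁ x) := fun x hx => by
    obtain ⟨e, he, hx⟩ := Conj.mem_vars.1 hx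
    obtain ⟨e', he', h3, h4⟩ := h2.exists_of_mem_left he
    exact hx.elim ((hside h3 (hD' e' he').1).2 x) ((hside h4 (hD' e' he').2.1).2 x)
  -- the representatives
  set L := D₁.vars.filter fun y => sub.finSort y.1 with hL
  have hrep : ∀ y : Var S, ∃ r, y ∈ L → r ∈ sub.reps y.1 ∧ R.omegaC.EqB (ρ₁ y) r := fun y => by
    by_cases hy : y ∈ L
    · obtain ⟨hyD, hyf⟩ := List.mem_filter.1 hy
      obtain ⟨hreps, hirr⟩ := isReps_of_mem hs hyf
      obtain ⟨hg, hso, hi⟩ := hvars y hyD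
      obtain ⟨r, hr, he⟩ := hreps.2 _ hg hso
      exact ⟨r, fun _ => ⟨hr, hR.dec_omegaC.eqB_of_irred he
        ((hR.irred_omegaC_iff ⟨_, hso⟩).2 hi) (hirr r hr)⟩⟩
    · exact ⟨.var y, fun h => absurd h hy⟩
  choose r hr using hrep
  have hrs : ∀ y ∈ L, (r y).Ground ∧ R.omegaC.sig.HasSort (r y) y.1 := fun y hy =>
    (isReps_of_mem hs (List.mem_filter.1 hy).2).1.1 _ (hr y hy).1
  have hτ : R.omegaC.sig.IsSubst (Sig.cut r L) := .cut' fun y hy => (hrs y hy).2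
  have hτf : R.sig.IsSubst (Sig.cut r L) := fun y => (hτ y).mono fun _ _ _ => Sig.op_of_restrict
  -- Representatives are ground and `B`-equal to the values they replace, so inserting them first
  -- does not change the instance modulo `B`. Normality and the disequalities can then be read off
  -- from that instance.
  have hτρ : ∀ {t u : Tm S F}, R.omegaC.sig.WT t → t.vars ⊆ D₁.vars →
      R.full.EqB (t.subst ρ₁) u → R.full.EqB ((t.subst (Sig.cut r L)).subst ρ₁) u := by
    intro t u hw hv he
    refine Sig.EqMod.trans ?_ he
    rw [Term.subst_subst]
    refine Sig.EqMod.subst_congr (wt_of_omegaC hw) (hτf.comp hρ₁) hρ₁ fun x hx => ?_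
    by_cases hxL : x ∈ L
    · rw [Sig.cut, if_pos hxL, (hrs x hxL).1.subst_eq]
      exact (eqB_of_omegaC (hr x hxL).2).symm
    · rw [Sig.cut, if_neg hxL, Term.subst]
      exact .refl ⟨_, hρ₁ x⟩
  have hnorm : ∀ {t u : Tm S F}, R.omegaC.sig.WT t → t.vars ⊆ D₁.vars →
      R.full.EqB (t.subst ρ₁) u → R.full.Irred u →
      sub.eqB (sub.nf (t.subst (Sig.cut r L))) (t.subst (Sig.cut r L)) = true := by
    intro t u hw hv he hi
    have hwt := hw.subst hτ
    have hirr := hR.dec.irred_of_eqB_subst hρ₁ (hτρ hw hv he) hi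
    rw [steps_of_irred hirr (hs.nf _ (wt_of_omegaC hwt)).1]
    exact (hs.eqB _ _ (hwt.imp fun _ h => ⟨h, h⟩)).2 (.refl hwt)
  refine List.any_eq_true.2 ⟨(D₁, γ), hp, ?_⟩
  rw [Bool.and_eq_true, all_ctor_iff]
  refine ⟨hctor, List.any_eq_true.2 ⟨_, map_mem_choices fun y hy => (hr y hy).1, ?_⟩⟩
  rw [fn_map r, List.all_eq_true]
  intro e he
  obtain ⟨e, he₀, rfl⟩ := List.mem_map.1 he
  obtain ⟨e', he', h3, h4⟩ := h2.exists_of_mem_left he₀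
  have hv1 : e.1.vars ⊆ D₁.vars := fun x hx => Conj.mem_vars.2 ⟨e, he₀, .inl hx⟩
  have hv2 : e.2.vars ⊆ D₁.vars := fun x hx => Conj.mem_vars.2 ⟨e, he₀, .inr hx⟩
  obtain ⟨⟨-, -, hi1⟩, ⟨-, -, hi2⟩, hne⟩ := hD' e' he'
  have hw := heqn e he₀
  rw [Bool.and_eq_true, Bool.and_eq_true, Bool.not_eq_true', Bool.eq_false_iff]
  refine ⟨⟨hnorm hw.left hv1 h3 hi1, hnorm hw.right hv2 h4 hi2⟩, fun h => hne ?_⟩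
  have h5 := eqB_of_omegaC ((hs.eqB _ _ (hw.subst hτ)).1 h)
  exact eqE_of_eqB (((hτρ hw.left hv1 h3).symm.trans (h5.subst hρ₁)).trans (hτρ hw.right hv2 h4))

omit [DecidableEq F] in
-- Once the representatives are inserted, only variables of infinite sorts are left. The sides are
-- normalized and not `B`-equal, hence not `E`-equal, so OS-compactness gives a solution in the
-- initial algebra of the constructors, which is then carried over to `R`.
theorem finalStep_sound {D : Conj S F} (hD : ∀ e ∈ D, R.IsItem e ∧ R.isPi e = false)
    (h : R.finalStep sub D = true) : R.full.Sat D := by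
  have hDe : ∀ e ∈ D, R.full.sig.IsEqn e := fun e he => (hD e he).1.eqn
  obtain ⟨⟨D₁, γ⟩, hp, h⟩ := List.any_eq_true.1 h
  rw [Bool.and_eq_true, all_ctor_iff] at h
  obtain ⟨hctor, h⟩ := h
  obtain ⟨τ, hτ, h⟩ := List.any_eq_true.1 h
  rw [List.all_eq_true] at h
  have hvar := ((hs.conjVariants D D.vars hDe (List.Subset.refl _)).1 _ hp).1
  have heqn : ∀ e ∈ D₁, R.omegaC.sig.IsEqn e := fun e he =>
    Sig.isEqn_restrict.2 ⟨hR.dec.isEqn_of_isVariant hDe hvar e he, hctor e he⟩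
  have hτL : ∀ x ∈ D₁.vars.filter fun y => sub.finSort y.1,
      (τ.fn x).Ground ∧ R.omegaC.sig.HasSort (τ.fn x) x.1 := fun x hx =>
    (isReps_of_mem hs (List.mem_filter.1 hx).2).1.1 _ ((fn_of_mem_choices hτ x).1 hx)
  have hτs : R.omegaC.sig.IsSubst τ.fn := fun x => by
    by_cases hx : x ∈ D₁.vars.filter fun y => sub.finSort y.1
    · exact (hτL x hx).2
    · rw [(fn_of_mem_choices hτ x).2 hx]
      exact .var x
  -- The test `sub.eqB` is specified only on `Ω_c`-terms, so the normal form of an `Ω_c`-term first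
  -- has to be seen to be one.
  have hnf : ∀ {t : Tm S F}, R.omegaC.sig.WT t → sub.eqB (sub.nf t) t = true →
      R.omegaC.Irred t := fun {t} hw he => by
    have hn := hs.nf t (wt_of_omegaC hw)
    obtain ⟨s, hso⟩ := hw
    have hns : R.omegaC.sig.HasSort (sub.nf t) s := Sig.hasSort_restrict.2
      ⟨hR.dec.steps_hasSort hn.1 (Sig.hasSort_restrict.1 hso).1, hR.allSyms_nf_omegaC ⟨s, hso⟩ hn⟩
    refine (hR.irred_omegaC_iff ⟨s, hso⟩).2 (hR.dec.irred_of_eqB ?_ hn.2)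
    exact eqB_of_omegaC ((hs.eqB _ _ ⟨s, hns, hso⟩).1 he)
  have hE : ∀ e ∈ R.omegaC.eqns, R.omegaC.sig.IsEqn e := by
    rintro e (he | he)
    exacts [hR.dec_omegaC.ax_eqn e he, hR.dec_omegaC.rules_eqn e he]
  have hτeqn : ∀ e ∈ D₁.subst τ.fn, R.omegaC.sig.IsEqn e := fun e he => by
    obtain ⟨e, he₀, rfl⟩ := List.mem_map.1 he
    exact (heqn e he₀).subst hτs
  have hsatne : (initAlg R.omegaC.sig R.omegaC.eqns).SatNe (D₁.subst τ.fn) := by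
    refine hR.compact.compact (D₁.subst τ.fn) hτeqn (fun x hx => ?_) fun e he heq => ?_
    · obtain ⟨e', he', hx⟩ := Conj.mem_vars.1 hx
      obtain ⟨e, he₀, rfl⟩ := List.mem_map.1 he'
      obtain ⟨y, hy, hx⟩ : ∃ y ∈ D₁.vars, x ∈ (τ.fn y).vars := by
        rcases hx with hx | hx <;> obtain ⟨y, hy, hx⟩ := Term.mem_vars_subst.1 hx
        exacts [⟨y, Conj.mem_vars.2 ⟨e, he₀, .inl hy⟩, hx⟩, ⟨y, Conj.mem_vars.2 ⟨e, he₀, .inr hy⟩, hx⟩]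
      by_cases hyL : y ∈ D₁.vars.filter fun y => sub.finSort y.1
      · exact absurd hx (Term.ground_iff.1 (hτL y hyL).1 x)
      · rw [(fn_of_mem_choices hτ y).2 hyL, Term.vars, List.mem_singleton] at hx
        subst hx
        exact fun hf => hyL (List.mem_filter.2 ⟨hy, (hs.finSort _).2 hf⟩)
    · have hw := hτeqn e he
      have h := h e he
      rw [Bool.and_eq_true, Bool.and_eq_true, Bool.not_eq_true', Bool.eq_false_iff] at h
      exact h.2 ((hs.eqB _ _ hw).2 (hR.dec_omegaC.eqB_of_irred heq (hnf hw.left h.1.1)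
        (hnf hw.right h.1.2)))
  obtain ⟨μ, hμ, hμg, hne⟩ := exists_of_satNe_initAlg hE hτeqn hsatne
  have hγ := hvar.subst
  have hτf : R.sig.IsSubst τ.fn := fun y => (hτs y).mono fun _ _ _ => Sig.op_of_restrict
  have hμf : R.sig.IsSubst μ := fun y => (hμ y).mono fun _ _ _ => Sig.op_of_restrict
  -- The solution is the normal form of the variant substitution `γ`, followed by the
  -- representatives `τ` and the constructor solution `μ`.
  obtain ⟨ρ, hρ, hpull⟩ := hR.dec.exists_pull (hγ.comp hτf) hμf hμg
  have key : ∀ {t u : Tm S F}, R.sig.WT t → R.full.NFB (t.subst γ.fn) u →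
      R.full.EqE ((u.subst τ.fn).subst μ) (t.subst ρ) := fun {t u} hw hn => by
    have h1 := ((hR.dec.nfb_iff (hw.subst hγ)).1 hn).1
    have h2 : R.full.EqE (((t.subst γ.fn).subst τ.fn).subst μ) ((u.subst τ.fn).subst μ) :=
      (h1.subst hτf).subst hμf
    rw [Term.subst_subst t] at h2
    exact h2.symm.trans (eqE_pull (hγ.comp hτf) hμf hρ.subst hpull hw)
  refine ⟨ρ, hρ, fun e he heq => ?_⟩
  obtain ⟨e₁, he₁, h3, h4⟩ := (Conj.forall₂_sides.1 hvar.nf).exists_of_mem_left he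
  have hw := ((heqn e₁ he₁).subst hτs).subst hμ
  refine hne _ (List.mem_map_of_mem he₁) ((hR.eqE_omegaC_iff hw.left hw.right).2 ?_)
  exact ((key (hDe e he).left h3).trans heq).trans (key (hDe e he).right h4).symm

/-- Step 2 ends with `(Δ ⊎ Ω_c)`-disequalities. -/
theorem elimStep_isEqn {φ : QF (Eqn S F)} (hφ : R.IsFormula φ) {GD : Conj S F × Conj S F}
    (hGD : GD ∈ dnf true φ) {D' : Conj S F} (hD' : D' ∈ unifStep sub GD.1 GD.2)
    {D'' : Conj S F} (hD'' : D'' ∈ R.elimStep sub D') : ∀ e ∈ D'', R.deltaC.sig.IsEqn e := by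
  have h := isAtom_of_mem_dnf hφ hGD
  have hi := hR.unifStep_isItem hs (fun e he => hR.isItem_of_isAtom (h e (by simp [he])))
    (fun e he => hR.isItem_of_isAtom (h e (by simp [he]))) hD'
  intro e he
  have h' := (hR.elim_spec hs _ hi le_rfl).2 D'' hD'' e he
  exact Sig.isEqn_restrict.2 ⟨h'.1.eqn, (h'.1.noPred h'.2).1, h'.1.right.1⟩

/-- The procedure is correct. -/
theorem decideSat_iff {φ : QF (Eqn S F)} (hφ : R.IsFormula φ) :
    R.decideSat sub φ = true ↔ R.full.canon.Satisfiable φ := by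
  have hat : ∀ GD ∈ dnf true φ, (∀ e ∈ GD.1, R.IsItem e) ∧ ∀ e ∈ GD.2, R.IsItem e :=
    fun GD hGD => ⟨fun e he => hR.isItem_of_isAtom (isAtom_of_mem_dnf hφ hGD e (by simp [he])),
      fun e he => hR.isItem_of_isAtom (isAtom_of_mem_dnf hφ hGD e (by simp [he]))⟩
  have h1 : R.full.canon.Satisfiable φ ↔ ∃ GD ∈ dnf true φ, ∃ ρ, R.full.GroundNormal ρ ∧
      (∀ e ∈ GD.1, R.full.EqE (e.1.subst ρ) (e.2.subst ρ)) ∧ R.full.SatBy ρ GD.2 := by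
    constructor
    · rintro ⟨a, ha, h⟩
      obtain ⟨ρ, hρ, rfl⟩ := hR.dec.isAssign_iff.1 ha
      obtain ⟨GD, hGD, hG, hD⟩ := (holds_iff_dnf _ _ φ).1.1 h
      exact ⟨GD, hGD, ρ, hρ,
        fun e he => (hR.dec.eval_eq_iff hρ ((hat GD hGD).1 e he).eqn).1 (hG e he),
        fun e he h => hD e he ((hR.dec.eval_eq_iff hρ ((hat GD hGD).2 e he).eqn).2 h)⟩
    · rintro ⟨GD, hGD, ρ, hρ, hG, hD⟩
      exact ⟨_, hR.dec.isAssign_iff.2 ⟨ρ, hρ, rfl⟩, (holds_iff_dnf _ _ φ).1.2 ⟨GD, hGD,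
        fun e he => (hR.dec.eval_eq_iff hρ ((hat GD hGD).1 e he).eqn).2 (hG e he),
        fun e he h => hD e he ((hR.dec.eval_eq_iff hρ ((hat GD hGD).2 e he).eqn).1 h)⟩⟩
  rw [h1, decideSat, List.any_eq_true]
  refine exists_congr fun GD => and_congr_right fun hGD => ?_
  obtain ⟨hG, hD⟩ := hat GD hGD
  rw [hR.unifStep_sat hs hG hD, List.any_eq_true]
  refine exists_congr fun D' => and_congr_right fun hD' => ?_
  have h2 := hR.elim_spec hs _ (hR.unifStep_isItem hs hG hD hD') le_rfl
  rw [h2.1, List.any_eq_true]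
  refine exists_congr fun D'' => and_congr_right fun hD'' => ?_
  exact ⟨hR.finalStep_sound hs (h2.2 D'' hD''), hR.finalStep_complete hs (h2.2 D'' hD'')⟩

end PredTheory.Conditions
end
end VarSat

/-! ### Computability of operations on lists -/

namespace Computable
variable {α β γ σ : Type} [Primcodable α] [Primcodable β] [Primcodable γ] [Primcodable σ]

/-- A right fold is a left fold over the reversed list, and the fold over its first `n` entries is
computed by recursion on `n`. The default case of the lookup is never used below the length. -/
theorem list_foldr {f : α → List β} {g : α → σ} {h : α → β × σ → σ} (hf : Computable f)
    (hg : Computable g) (hh : Computable₂ h) :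
    Computable fun a => (f a).foldr (fun b s => h a (b, s)) (g a) := by
  have key : Computable fun a => (f a).length.rec (motive := fun _ => σ) (g a) fun n s =>
      Option.casesOn ((f a).reverse[n]?) s fun b => h a (b, s) := by
    refine nat_rec (h := fun a p => Option.casesOn ((f a).reverse[p.1]?) p.2 fun b => h a (b, p.2))
      (list_length.comp hf) hg ?_
    refine option_casesOn ?_ (snd.comp snd) ?_
    · exact list_getElem?.comp (list_reverse.comp (hf.comp fst)) (fst.comp snd)
    · exact hh.comp (fst.comp fst) (pair snd (snd.comp (snd.comp fst)))
  refine key.of_eq fun a => ?_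
  have : ∀ (r : List β) n, (n.rec (motive := fun _ => σ) (g a) fun n s =>
      Option.casesOn (r[n]?) s fun b => h a (b, s)) =
      (r.take n).foldl (fun s b => h a (b, s)) (g a) := by
    intro r n
    induction n with
    | zero => simp
    | succ n ih =>
      rw [List.take_add_one, List.foldl_append, ← ih]
      change Option.casesOn (motive := fun _ => σ) r[n]? _ _ = _
      cases r[n]? <;> rfl
  rw [this, ← List.length_reverse, List.take_length, List.foldl_reverse]

theorem list_map' {f : α → List β} {g : α → β → γ} (hf : Computable f) (hg : Computable₂ g) :
    Computable fun a => (f a).map (g a) := by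
  refine (list_foldr (h := fun a p => g a p.1 :: p.2) hf (const []) ?_).of_eq fun a => ?_
  · exact list_cons.comp (hg.comp fst (fst.comp snd)) (snd.comp snd)
  · induction f a <;> simp_all

theorem list_flatMap' {f : α → List β} {g : α → β → List γ} (hf : Computable f)
    (hg : Computable₂ g) : Computable fun a => (f a).flatMap (g a) := by
  refine (list_foldr (h := fun a p => g a p.1 ++ p.2) hf (const []) ?_).of_eq fun a => ?_
  · exact list_append.comp (hg.comp fst (fst.comp snd)) (snd.comp snd)
  · induction f a <;> simp_all

theorem list_filter' {f : α → List β} {p : α → β → Bool} (hf : Computable f)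
    (hp : Computable₂ p) : Computable fun a => (f a).filter (p a) := by
  refine (list_flatMap' (g := fun a b => bif p a b then [b] else []) hf ?_).of_eq fun a => ?_
  · exact cond hp (list_cons.comp snd (const [])) (const [])
  · induction f a with
    | nil => rfl
    | cons b l ih => rw [List.flatMap_cons, ih, List.filter_cons]; cases p a b <;> rfl

theorem list_any' {f : α → List β} {p : α → β → Bool} (hf : Computable f)
    (hp : Computable₂ p) : Computable fun a => (f a).any (p a) := by
  refine (list_foldr (h := fun a q => bif p a q.1 then true else q.2) hf (const false) ?_).of_eq
    fun a => ?_
  · exact cond (hp.comp fst (fst.comp snd)) (const true) (snd.comp snd)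
  · induction f a with
    | nil => rfl
    | cons b l ih => rw [List.foldr_cons, ih, List.any_cons]; cases p a b <;> rfl

theorem list_all' {f : α → List β} {p : α → β → Bool} (hf : Computable f)
    (hp : Computable₂ p) : Computable fun a => (f a).all (p a) := by
  refine (list_foldr (h := fun a q => bif p a q.1 then q.2 else false) hf (const true) ?_).of_eq
    fun a => ?_
  · exact cond (hp.comp fst (fst.comp snd)) (snd.comp snd) (const false)
  · induction f a with
    | nil => rfl
    | cons b l ih => rw [List.foldr_cons, ih, List.all_cons]; cases p a b <;> rfl

theorem bool_and {f g : α → Bool} (hf : Computable f) (hg : Computable g) :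
    Computable fun a => f a && g a :=
  (cond hf hg (const false)).of_eq fun a => by cases f a <;> rfl

theorem bool_not {f : α → Bool} (hf : Computable f) : Computable fun a => !f a :=
  (cond hf (const false) (const true)).of_eq fun a => by cases f a <;> rfl

theorem decide_eq [DecidableEq β] {f g : α → β} (hf : Computable f) (hg : Computable g) :
    Computable fun a => decide (f a = g a) :=
  (Primrec.eq (α := β)).decide.to_comp.comp hf hg

theorem list_lookup [DecidableEq β] {f : α → List (β × γ)} {g : α → β} (hf : Computable f)
    (hg : Computable g) : Computable fun a => (f a).lookup (g a) := by
  refine (list_foldr (h := fun a q => bif decide (g a = q.1.1) then some q.1.2 else q.2) hf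
    (const none) ?_).of_eq fun a => ?_
  · exact cond (decide_eq (hg.comp fst) (fst.comp (fst.comp snd)))
      (option_some.comp (snd.comp (fst.comp snd))) (snd.comp snd)
  · induction f a with
    | nil => rfl
    | cons b l ih =>
      rw [List.foldr_cons, ih, List.lookup_cons]
      by_cases h : g a = b.1
      · simp [h]
      · simp [h, beq_false_of_ne h]

end Computable

/-! ### Computability of operations on terms -/

namespace VarSat
open Computable

namespace Term
variable {V F α : Type} [Primcodable V] [Primcodable F] [Primcodable α]

/-- The code of a term is by definition the code of its token list, so computability can be tested
on tokens. -/
theorem computable_toks : Computable (toks (V := V) (F := F)) :=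
  encode_iff.1 (Computable.encode.of_eq fun _ => rfl)

theorem computable_of_toks {f : α → Term V F} (h : Computable fun a => (f a).toks) :
    Computable f :=
  encode_iff.1 ((encode_iff.2 h).of_eq fun _ => rfl)

omit [Primcodable V] [Primcodable F] in
-- In Polish notation substitution replaces each variable token by a list of tokens and leaves
-- symbol tokens, with their numbers of arguments, unchanged. No recursion on terms is needed to
-- compute it.
theorem toks_subst (σ : V → Term V F) (t : Term V F) :
    (t.subst σ).toks = t.toks.flatMap (Sum.elim (fun x => (σ x).toks) fun k => [.inr k]) := by
  induction t using induct with
  | hv x => simp [subst, toks]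
  | ha f ts ih =>
    simp only [subst, toks, List.length_map, List.flatMap_cons, Sum.elim_inr,
      List.singleton_append, List.flatMap_map, List.flatMap_assoc]
    congr 1
    exact List.flatMap_congr ih

omit [Primcodable V] [Primcodable F] in
theorem vars_eq_toks (t : Term V F) :
    t.vars = t.toks.flatMap (Sum.elim (fun x => [x]) fun _ => []) := by
  induction t using induct with
  | hv x => simp [vars, toks]
  | ha f ts ih =>
    simp only [vars, toks, List.flatMap_cons, Sum.elim_inr, List.nil_append, List.flatMap_assoc]
    exact List.flatMap_congr ih

omit [Primcodable V] [Primcodable F] in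
theorem syms_eq_toks (t : Term V F) :
    t.syms = t.toks.flatMap (Sum.elim (fun _ => []) fun k => [k.1]) := by
  induction t using induct with
  | hv x => simp [syms, toks]
  | ha f ts ih =>
    simp only [syms, toks, List.flatMap_cons, Sum.elim_inr, List.singleton_append,
      List.flatMap_assoc]
    congr 1
    exact List.flatMap_congr ih

theorem computable_var : Computable (var : V → Term V F) :=
  computable_of_toks ((list_cons.comp Computable.sumInl (const [])).of_eq fun _ => by simp [toks])

theorem computable_app : Computable₂ (app : F → List (Term V F) → Term V F) := by
  refine computable_of_toks ((list_cons.comp (Computable.sumInr.comp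
    (pair fst (list_length.comp snd))) (list_flatMap' snd
      (computable_toks.comp snd).to₂)).of_eq fun p => ?_)
  simp [toks]

theorem computable_vars : Computable (vars : Term V F → List V) :=
  (list_flatMap' (g := fun _ k => Sum.casesOn k (fun x => [x]) fun _ => []) computable_toks
    (sumCasesOn snd (list_cons.comp snd (const [])).to₂ (const []).to₂)).of_eq fun t => by
      rw [vars_eq_toks]; rfl

theorem computable_syms : Computable (syms : Term V F → List F) :=
  (list_flatMap' (g := fun _ k => Sum.casesOn k (fun _ => []) fun k => [k.1]) computable_toks
    (sumCasesOn snd (const []).to₂ (list_cons.comp (fst.comp snd) (const [])).to₂)).of_eq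
      fun t => by rw [syms_eq_toks]; rfl

theorem computable_subst {f : α → Term V F} {g : α → V → Term V F} (hf : Computable f)
    (hg : Computable₂ g) : Computable fun a => (f a).subst (g a) := by
  refine computable_of_toks ((list_flatMap' (g := fun a k => Sum.casesOn k
    (fun x => (g a x).toks) fun k => [.inr k]) (computable_toks.comp hf) ?_).of_eq fun a => ?_)
  · exact sumCasesOn snd (computable_toks.comp (hg.comp (fst.comp fst) snd)).to₂
      (list_cons.comp (Computable.sumInr.comp snd) (const [])).to₂
  · rw [toks_subst]; rfl

/-- The root symbol of a term. -/
def root : Term V F → Option F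
  | .var _ => none
  | .app f _ => some f

theorem computable_root : Computable (root : Term V F → Option F) := by
  refine (option_bind (g := fun _ k => Sum.casesOn k (fun _ => none) fun k => some k.1)
    (list_getElem?.comp computable_toks (const 0)) (sumCasesOn snd (const none).to₂
      (option_some.comp (fst.comp snd)).to₂)).of_eq fun t => ?_
  cases t <;> simp [toks, root]

end Term

end VarSat

/-! ### Computability of the procedure -/

namespace VarSat
open Computable

namespace QF
variable {A : Type} [Primcodable A]

theorem computable_toks : Computable (toks (A := A)) :=
  encode_iff.1 (Computable.encode.of_eq fun _ => rfl)

variable {X : Type}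

/-- Recursion on formulas. -/
def fold (atom : A → X) (neg : X → X) (and or : X → X → X) : QF A → X
  | .eq e => atom e
  | .neg φ => neg (fold atom neg and or φ)
  | .and φ ψ => and (fold atom neg and or φ) (fold atom neg and or ψ)
  | .or φ ψ => or (fold atom neg and or φ) (fold atom neg and or ψ)

/-- One step of the computation of `fold` from Polish notation, on a stack. -/
def foldTok (d : X) (atom : A → X) (neg : X → X) (and or : X → X → X) (k : A ⊕ Option Bool)
    (st : List X) : List X :=
  Sum.casesOn k (fun e => atom e :: st) fun o =>
    Option.casesOn o (neg (st[0]?.getD d) :: st.tail) fun b =>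
      bif b then and (st[0]?.getD d) (st[1]?.getD d) :: st.tail.tail
      else or (st[0]?.getD d) (st[1]?.getD d) :: st.tail.tail

omit [Primcodable A] in
theorem foldr_foldTok (d : X) (atom : A → X) (neg : X → X) (and or : X → X → X) (φ : QF A)
    (st : List X) : φ.toks.foldr (foldTok d atom neg and or) st =
      fold atom neg and or φ :: st := by
  induction φ generalizing st with
  | eq e => simp [toks, foldTok, fold]
  | neg φ ih => simp [toks, foldTok, fold, ih]
  | and φ ψ ih1 ih2 => simp [toks, foldTok, fold, ih1, ih2]
  | or φ ψ ih1 ih2 => simp [toks, foldTok, fold, ih1, ih2]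

/-- Reading the tokens from the right with a stack turns structural recursion into a fold over a
list. The default `d` is used only when the stack is too short, which does not happen on the tokens
of a formula. -/
theorem computable_fold [Primcodable X] (d : X) {atom : A → X} {neg : X → X} {and or : X → X → X}
    (hatom : Computable atom) (hneg : Computable neg) (hand : Computable₂ and)
    (hor : Computable₂ or) : Computable (fold atom neg and or) := by
  have ht : Computable (List.tail (α := X)) := Primrec.list_tail.to_comp
  have hget : ∀ n, Computable fun st : List X => st[n]?.getD d := fun n =>
    option_getD (list_getElem?.comp Computable.id (const n)) (const d)
  have h1 : Computable₂ fun (p : List X × Option Bool) (b : Bool) =>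
      bif b then and (p.1[0]?.getD d) (p.1[1]?.getD d) :: p.1.tail.tail
      else or (p.1[0]?.getD d) (p.1[1]?.getD d) :: p.1.tail.tail := by
    have hst : Computable fun q : (List X × Option Bool) × Bool => q.1.1 := fst.comp fst
    exact cond snd
      (list_cons.comp (hand.comp ((hget 0).comp hst) ((hget 1).comp hst)) (ht.comp (ht.comp hst)))
      (list_cons.comp (hor.comp ((hget 0).comp hst) ((hget 1).comp hst)) (ht.comp (ht.comp hst)))
  have h2 : Computable fun p : List X × Option Bool =>
      (Option.casesOn p.2 (neg (p.1[0]?.getD d) :: p.1.tail) fun b =>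
        bif b then and (p.1[0]?.getD d) (p.1[1]?.getD d) :: p.1.tail.tail
        else or (p.1[0]?.getD d) (p.1[1]?.getD d) :: p.1.tail.tail : List X) :=
    option_casesOn snd (list_cons.comp (hneg.comp ((hget 0).comp fst)) (ht.comp fst)) h1
  have h3 : Computable fun p : (A ⊕ Option Bool) × List X =>
      foldTok d atom neg and or p.1 p.2 :=
    sumCasesOn fst (list_cons.comp (hatom.comp snd) (snd.comp fst)).to₂
      (h2.comp (pair (snd.comp fst) snd)).to₂
  have h4 : Computable fun φ : QF A => φ.toks.foldr (foldTok d atom neg and or) [] :=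
    list_foldr (h := fun _ p => foldTok d atom neg and or p.1 p.2) computable_toks (const [])
      (h3.comp snd).to₂
  exact ((hget 0).comp h4).of_eq fun φ => by simp [foldr_foldTok]

end QF

section
variable {S F α : Type}

/-- The conjunction of two disjunctive normal forms. -/
def dnfAnd (A B : List (Conj S F × Conj S F)) : List (Conj S F × Conj S F) :=
  A.flatMap fun p => B.map fun q => (p.1 ++ q.1, p.2 ++ q.2)

/-- The normal forms of a formula and of its negation refer to each other, so they are computed as a
pair, which negation swaps. -/
theorem fold_eq_dnf (φ : QF (Eqn S F)) : φ.fold (fun e => ([([e], [])], [([], [e])]))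
    Prod.swap (fun A B => (dnfAnd A.1 B.1, A.2 ++ B.2)) (fun A B => (A.1 ++ B.1, dnfAnd A.2 B.2)) =
      (dnf true φ, dnf false φ) := by
  induction φ with
  | eq e => simp [QF.fold, dnf]
  | neg φ ih => simp [QF.fold, dnf, ih]
  | and φ ψ ih1 ih2 => rw [QF.fold, ih1, ih2, dnf, dnf]; rfl
  | or φ ψ ih1 ih2 => rw [QF.fold, ih1, ih2, dnf, dnf]; rfl

variable [Primcodable S] [Primcodable F] [Primcodable α]

theorem computable_dnfAnd {f g : α → List (Conj S F × Conj S F)} (hf : Computable f)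
    (hg : Computable g) : Computable fun a => dnfAnd (f a) (g a) := by
  have h : Computable fun b : α × Conj S F × Conj S F =>
      (g b.1).map fun q => (b.2.1 ++ q.1, b.2.2 ++ q.2) := by
    refine list_map' (hg.comp fst) ?_
    exact pair (list_append.comp (fst.comp (snd.comp fst)) (fst.comp snd))
      (list_append.comp (snd.comp (snd.comp fst)) (snd.comp snd))
  exact list_flatMap' hf h

theorem computable_dnf : Computable (dnf true : QF (Eqn S F) → _) := by
  have h1 : Computable fun e : Eqn S F => [e] := list_cons.comp Computable.id (const [])
  have h2 : Computable fun e : Eqn S F =>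
      ([(([e] : Conj S F), ([] : Conj S F))], [(([] : Conj S F), ([e] : Conj S F))]) :=
    pair (list_cons.comp (pair h1 (const [])) (const []))
      (list_cons.comp (pair (const []) h1) (const []))
  have h3 : Computable fun A : List (Conj S F × Conj S F) × List (Conj S F × Conj S F) => A.swap :=
    pair snd fst
  have h4 : Computable₂ fun A B : List (Conj S F × Conj S F) × List (Conj S F × Conj S F) =>
      (dnfAnd A.1 B.1, A.2 ++ B.2) := by
    refine pair (computable_dnfAnd ?_ ?_) (list_append.comp ?_ ?_)
    exacts [fst.comp fst, fst.comp snd, snd.comp fst, snd.comp snd]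
  have h5 : Computable₂ fun A B : List (Conj S F × Conj S F) × List (Conj S F × Conj S F) =>
      (A.1 ++ B.1, dnfAnd A.2 B.2) := by
    refine pair (list_append.comp ?_ ?_) (computable_dnfAnd ?_ ?_)
    exacts [fst.comp fst, fst.comp snd, snd.comp fst, snd.comp snd]
  have h6 := QF.computable_fold ([], []) h2 h3 h4 h5
  exact (fst.comp h6).of_eq fun φ => congrArg Prod.fst (fold_eq_dnf φ)

theorem Eqn.computable_vars : Computable (Eqn.vars : Eqn S F → List (Var S)) :=
  list_append.comp (Term.computable_vars.comp fst) (Term.computable_vars.comp snd)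

theorem Conj.computable_vars : Computable (Conj.vars : Conj S F → List (Var S)) :=
  list_flatMap' Computable.id (Eqn.computable_vars.comp snd)

theorem Conj.computable_subst {f : α → Conj S F} {g : α → Subst S F} (hf : Computable f)
    (hg : Computable₂ g) : Computable fun a => (f a).subst (g a) :=
  list_map' (g := fun a => Eqn.subst (g a)) hf
    (pair (Term.computable_subst (g := fun p : α × Eqn S F => g p.1) (fst.comp snd)
      (hg.comp (fst.comp fst) snd))
    (Term.computable_subst (g := fun p : α × Eqn S F => g p.1) (snd.comp snd)
      (hg.comp (fst.comp fst) snd)))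

theorem ASubst.computable_fn [DecidableEq S] {f : α → ASubst S F} (hf : Computable f) :
    Computable₂ fun a => (f a).fn :=
  (option_getD (list_lookup (hf.comp fst) snd) (Term.computable_var.comp snd)).of_eq fun p => by
    unfold ASubst.fn
    congr 2
    -- The two lookups compare variables by different Boolean tests, which agree in value.
    exact congrArg (@BEq.mk _) (by
      ext x y
      rw [Bool.eq_iff_iff]
      simp [Prod.ext_iff])

theorem computable_freshIdx : Computable (freshIdx : List (Var S) → ℕ) :=
  list_foldr (h := fun _ (p : Var S × ℕ) => max (p.1.2 + 1) p.2) Computable.id (const 0)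
    (Primrec.nat_max.to_comp.comp (succ.comp (snd.comp (fst.comp snd))) (snd.comp snd))

theorem computable_shift {f : α → ℕ} (hf : Computable f) :
    Computable₂ fun a => (shift (f a) : Subst S F) :=
  Term.computable_var.comp (pair (fst.comp snd)
    (Primrec.nat_add.to_comp.comp (snd.comp snd) (hf.comp fst)))

theorem computable_rootIs [DecidableEq F] {f : α → F} {g : α → Tm S F} (hf : Computable f)
    (hg : Computable g) : Computable fun a => rootIs (f a) (g a) :=
  (option_casesOn (g := fun a q => decide (q = f a)) (Term.computable_root.comp hg) (const false)
    (decide_eq snd (hf.comp fst))).of_eq fun a => by cases g a <;> rfl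

namespace PredTheory
variable (R : PredTheory S F) (hp : Computable R.part)
include hp

theorem computable_isPi : Computable R.isPi :=
  (option_casesOn (g := fun _ q => decide (R.part q = .pred))
    (Term.computable_root.comp fst) (const false)
    (decide_eq (hp.comp snd) (const _))).of_eq fun e => by
      rcases e with ⟨_ | _, _⟩ <;> rfl

/-- The fold also carries the part of the list read so far, since this part is returned behind the
disequality that is found. -/
theorem computable_findPi : Computable R.findPi := by
  have hs : Computable (fun p : Eqn S F × Conj S F × Option (Conj S F × F × Tm S F × Conj S F) =>
      (p.1 :: p.2.1, bif R.isPi p.1 then (Term.root p.1.1).map fun f => ([], f, p.1.1, p.2.1)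
        else p.2.2.map fun q => (p.1 :: q.1, q.2))) :=
    pair (list_cons.comp fst (fst.comp snd)) (cond ((R.computable_isPi hp).comp fst)
      (option_map (Term.computable_root.comp (fst.comp fst)) (pair (const []) (pair snd
        (pair (fst.comp (fst.comp fst)) (fst.comp (snd.comp fst))))))
      (option_map (snd.comp snd) (pair (list_cons.comp (fst.comp fst) (fst.comp snd))
        (snd.comp snd))))
  have hs' : Computable fun q : Conj S F ×
      (Eqn S F × Conj S F × Option (Conj S F × F × Tm S F × Conj S F)) =>
      (q.2.1 :: q.2.2.1, bif R.isPi q.2.1 then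
        (Term.root q.2.1.1).map fun f => (([] : Conj S F), f, q.2.1.1, q.2.2.1)
        else q.2.2.2.map fun r => (q.2.1 :: r.1, r.2)) := hs.comp snd
  have hf := list_foldr Computable.id (const (([] : Conj S F),
    (none : Option (Conj S F × F × Tm S F × Conj S F)))) hs'.to₂
  refine (snd.comp hf).of_eq fun D => ?_
  suffices h : ∀ D : Conj S F, D.foldr (fun e s => (e :: s.1, bif R.isPi e then
      (Term.root e.1).map fun f => ([], f, e.1, s.1) else s.2.map fun q => (e :: q.1, q.2)))
      ([], none) = (D, R.findPi D) from congrArg Prod.snd (h D)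
  intro D
  induction D with
  | nil => rfl
  | cons e D ih =>
    rw [List.foldr_cons, ih]
    rcases e with ⟨_ | ⟨f, ts⟩, v⟩
    · rfl
    · by_cases h : R.part f = .pred <;> simp [findPi, isPi, Term.root, h]

end PredTheory

namespace Subroutines
variable [DecidableEq S] {sub : Subroutines S F}

theorem IsComputable.unifStep [DecidableEq F] (hc : sub.IsComputable) :
    Computable₂ (PredTheory.unifStep sub) := by
  refine list_filter' (f := fun p : Conj S F × Conj S F => _) (p := fun _ D' => !sub.obvious D')
    (list_map' (g := fun (p : Conj S F × Conj S F) (α : ASubst S F) =>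
      (p.2.subst α.fn).map fun e => (sub.nf e.1, sub.nf e.2)) ?_ ?_)
    (bool_not (hc.obvious.comp snd))
  · exact hc.varUnif.comp fst (list_append.comp (Conj.computable_vars.comp fst)
      (Conj.computable_vars.comp snd))
  · exact list_map' (g := fun _ (e : Eqn S F) => (sub.nf e.1, sub.nf e.2))
      (Conj.computable_subst (snd.comp fst) (ASubst.computable_fn snd))
      (pair (hc.nf.comp (fst.comp snd)) (hc.nf.comp (snd.comp snd)))

theorem IsComputable.choices [DecidableEq F] (hc : sub.IsComputable) :
    Computable (PredTheory.choices sub) := by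
  refine (list_foldr (h := fun (_ : List (Var S)) p => (sub.reps p.1.1).flatMap fun r =>
    p.2.map fun τ => (p.1, r) :: τ) Computable.id (const [[]]) ?_).of_eq fun L => ?_
  · refine list_flatMap' (f := fun q : List (Var S) × Var S × List (ASubst S F) => _)
      (g := fun q r => q.2.2.map fun τ => (q.2.1, r) :: τ) (hc.reps.comp (fst.comp (fst.comp snd)))
      (list_map' (f := fun w : (List (Var S) × Var S × List (ASubst S F)) × Tm S F => _)
        (g := fun w τ => (w.1.2.1, w.2) :: τ) (snd.comp (snd.comp fst)) ?_)
    exact list_cons.comp (pair (fst.comp (snd.comp (fst.comp fst))) (snd.comp fst)) snd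
  · induction L with
    | nil => rfl
    | cons y L ih => simp only [id] at ih ⊢; rw [List.foldr_cons, ih]; rfl

end Subroutines

namespace PredTheory
variable [DecidableEq S] [DecidableEq F] {R : PredTheory S F} {sub : Subroutines S F}

/-- One round of Step 2. -/
def elimRound (R : PredTheory S F) (sub : Subroutines S F) (D : Conj S F) : List (Conj S F) :=
  Option.casesOn (R.findPi D) [D] fun q => R.elimOne sub D.vars q.1 q.2.1 q.2.2.1 q.2.2.2

omit [Primcodable S] [Primcodable F] in
-- `elim` recurses on each resulting conjunction separately, whereas recursion on `n` needs one
-- fixed map on lists of conjunctions. The two agree because a conjunction without predicates is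
-- left alone by further rounds, and the first round may be split off at either end.
theorem elim_eq_rec (n : ℕ) (D : Conj S F) : R.elim sub n D =
    n.rec (motive := fun _ => List (Conj S F)) [D] fun _ L => L.flatMap (R.elimRound sub) := by
  have h1 : ∀ n D, R.elim sub (n + 1) D = (R.elimRound sub D).flatMap (R.elim sub n) := by
    intro n D
    rw [elim, elimRound]
    rcases h : R.findPi D with _ | ⟨D₁, p, t, D₂⟩
    · cases n <;> simp [elim, h]
    · rfl
  have h2 : ∀ n D, R.elim sub (n + 1) D = (R.elim sub n D).flatMap (R.elimRound sub) := by
    intro n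
    induction n with
    | zero => intro D; rw [h1]; simp [elim]
    | succ n ih =>
      intro D
      rw [h1, h1, List.flatMap_assoc]
      congr 1
      funext D'
      exact ih D'
  induction n with
  | zero => rfl
  | succ n ih => rw [h2, ih]

omit [DecidableEq F] in
theorem computable_elimPattern (hc : sub.IsComputable) {W : α → List (Var S)}
    {D₁ D₂ C : α → Conj S F} {p : α → F} {vs : α → List (Tm S F)} {t : α → Tm S F}
    {θ : α → ASubst S F} (hW : Computable W) (hD₁ : Computable D₁) (hp : Computable p)
    (hvs : Computable vs) (hC : Computable C) (ht : Computable t) (hθ : Computable θ)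
    (hD₂ : Computable D₂) : Computable fun a =>
      (sub.unif [(t a, (Term.app (p a) (vs a)).subst (shift (freshIdx (W a))))]
        (W a ++ ((Term.app (p a) (vs a)).subst (shift (freshIdx (W a)))).vars)).map fun α =>
          ((D₁ a ++ (C a).subst (shift (freshIdx (W a))) ++ D₂ a).subst (θ a).fn).subst α.fn := by
  have hk : Computable₂ fun a => (shift (freshIdx (W a)) : Subst S F) :=
    computable_shift (computable_freshIdx.comp hW)
  have hq := Term.computable_subst (Term.computable_app.comp hp hvs) hk
  have hD := Conj.computable_subst (list_append.comp (list_append.comp hD₁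
    (Conj.computable_subst hC hk)) hD₂) (ASubst.computable_fn hθ)
  refine list_map' (hc.unif.comp (list_cons.comp (pair ht hq) (const [])) ?_) ?_
  · exact list_append.comp hW (Term.computable_vars.comp hq)
  · exact Conj.computable_subst (hD.comp fst) (ASubst.computable_fn snd)

omit [DecidableEq S] in
theorem computable_isCtorVariant (hp : Computable R.part) {p : α → F} {t : α → Tm S F}
    (hq : Computable p) (ht : Computable t) : Computable fun a =>
      rootIs (p a) (t a) && (t a).syms.all fun f => decide (R.part f ≠ .defined) := by
  refine bool_and (computable_rootIs hq ht) (list_all'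
    (p := fun _ f => decide (R.part f ≠ .defined)) (Term.computable_syms.comp ht) ?_)
  exact (bool_not (decide_eq (hp.comp snd) (const Part.defined))).of_eq fun b => by simp

theorem computable_elimOne (hc : sub.IsComputable) (hp : Computable R.part)
    (hpats : Computable R.pats) {W : α → List (Var S)} {D₁ D₂ : α → Conj S F} {p : α → F}
    {t : α → Tm S F} (hW : Computable W) (hD₁ : Computable D₁) (hq : Computable p)
    (ht : Computable t) (hD₂ : Computable D₂) :
    Computable fun a => R.elimOne sub (W a) (D₁ a) (p a) (t a) (D₂ a) := by
  have hW₁ : Computable fun b : α × (Tm S F × ASubst S F) =>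
      W b.1 ++ b.2.2.flatMap (fun c => c.2.vars) ++ b.2.1.vars := by
    refine list_append.comp (list_append.comp (hW.comp fst) (list_flatMap' (snd.comp snd) ?_))
      (Term.computable_vars.comp (fst.comp snd))
    exact Term.computable_vars.comp (snd.comp snd)
  have hpat := list_flatMap' (hpats.comp (hq.comp fst)) (computable_elimPattern hc (hW₁.comp fst)
    (hD₁.comp (fst.comp fst)) (hq.comp (fst.comp fst)) (fst.comp snd) (snd.comp snd)
    (fst.comp (snd.comp fst)) (snd.comp (snd.comp fst)) (hD₂.comp (fst.comp fst))).to₂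
  have hvar := list_flatMap' (hc.variants.comp ht hW) (cond
    (computable_isCtorVariant hp (hq.comp fst) (fst.comp snd)) hpat (const [])).to₂
  refine (list_filter' (p := fun _ D' => !sub.obvious D') hvar
    (bool_not (hc.obvious.comp snd))).of_eq fun a => ?_
  simp only [elimOne, Bool.cond_eq_ite]

theorem computable_elimStep (hc : sub.IsComputable) (hp : Computable R.part)
    (hpats : Computable R.pats) : Computable (R.elimStep sub) := by
  have ho : Computable fun b : Conj S F × (Conj S F × F × Tm S F × Conj S F) =>
      R.elimOne sub b.1.vars b.2.1 b.2.2.1 b.2.2.2.1 b.2.2.2.2 := by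
    refine computable_elimOne hc hp hpats (Conj.computable_vars.comp fst) ?_ ?_ ?_ ?_
    exacts [fst.comp snd, fst.comp (snd.comp snd), fst.comp (snd.comp (snd.comp snd)),
      snd.comp (snd.comp (snd.comp snd))]
  have hr : Computable (R.elimRound sub) :=
    option_casesOn (R.computable_findPi hp) (list_cons.comp Computable.id (const [])) ho
  have hn : Computable fun D : Conj S F => D.countP R.isPi :=
    (list_length.comp (list_filter' (p := fun _ => R.isPi) Computable.id
      ((R.computable_isPi hp).comp snd))).of_eq fun D => List.countP_eq_length_filter.symm
  refine (nat_rec (g := fun D => [D]) (h := fun _ q => q.2.flatMap (R.elimRound sub)) hn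
    (list_cons.comp Computable.id (const []))
    (list_flatMap' (snd.comp snd) (hr.comp snd))).of_eq fun D => ?_
  rw [elimStep, elim_eq_rec]

theorem computable_finalStep (hc : sub.IsComputable) (hp : Computable R.part) :
    Computable (R.finalStep sub) := by
  refine list_any' (f := fun D => sub.conjVariants D (Conj.vars D))
    (p := fun D v =>
      v.1.all (fun e => (e.1.syms ++ e.2.syms).all fun f => decide (R.part f = .ctor)) &&
      (choices sub (v.1.vars.filter fun y => sub.finSort y.1)).any fun τ =>
        (v.1.subst τ.fn).all fun e =>
          sub.eqB (sub.nf e.1) e.1 && sub.eqB (sub.nf e.2) e.2 && !sub.eqB e.1 e.2)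
    (hc.conjVariants.comp Computable.id Conj.computable_vars) (bool_and ?_ ?_)
  · refine list_all' (f := fun b : Conj S F × (Conj S F × ASubst S F) => b.2.1)
      (p := fun _ e => (e.1.syms ++ e.2.syms).all fun f => decide (R.part f = .ctor))
      (fst.comp snd) (list_all' (p := fun _ f => decide (R.part f = .ctor)) ?_
        (decide_eq (hp.comp snd) (const _)))
    exact list_append.comp (Term.computable_syms.comp (fst.comp snd))
      (Term.computable_syms.comp (snd.comp snd))
  · refine list_any' (f := fun b : Conj S F × (Conj S F × ASubst S F) =>
        choices sub (b.2.1.vars.filter fun y => sub.finSort y.1))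
      (p := fun b τ => (b.2.1.subst τ.fn).all fun e =>
        sub.eqB (sub.nf e.1) e.1 && sub.eqB (sub.nf e.2) e.2 && !sub.eqB e.1 e.2) ?_
      (list_all' (p := fun _ (e : Eqn S F) =>
        sub.eqB (sub.nf e.1) e.1 && sub.eqB (sub.nf e.2) e.2 && !sub.eqB e.1 e.2) ?_ ?_)
    · exact hc.choices.comp (list_filter' (p := fun _ y => sub.finSort y.1)
        (Conj.computable_vars.comp (fst.comp snd)) (hc.finSort.comp (fst.comp snd)))
    · exact Conj.computable_subst (fst.comp (snd.comp fst)) (ASubst.computable_fn snd)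
    · exact (bool_and (bool_and
        (hc.eqB.comp (hc.nf.comp (fst.comp snd)) (fst.comp snd))
        (hc.eqB.comp (hc.nf.comp (snd.comp snd)) (snd.comp snd)))
        (bool_not (hc.eqB.comp (fst.comp snd) (snd.comp snd))))

/-- The procedure is a computable function if the subroutines, the partition of the symbols and the
assignment of the patterns are computable. -/
theorem computable_decideSat (hc : sub.IsComputable) (hp : Computable R.part)
    (hpats : Computable R.pats) : Computable (R.decideSat sub) := by
  refine list_any' (p := fun _ GD => (unifStep sub GD.1 GD.2).any fun D' =>
    (R.elimStep sub D').any fun D'' => R.finalStep sub D'') computable_dnf (list_any'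
    (p := fun _ D' => (R.elimStep sub D').any fun D'' => R.finalStep sub D'')
    (hc.unifStep.comp (fst.comp snd) (snd.comp snd)) (list_any'
    (p := fun _ D'' => R.finalStep sub D'') ((computable_elimStep hc hp hpats).comp snd)
    ((computable_finalStep hc hp).comp snd)))

end PredTheory
end
end VarSat

/-- Termination lies in the procedure being a total function. What had to be shown is that its
prescribed number of rounds in Step 2 eliminates all predicates. -/
theorem mainTheorem1 {S F : Type} [PartialOrder S] [DecidableEq S] [DecidableEq F]
    [Primcodable S] [Primcodable F] (R : VarSat.PredTheory S F) (hR : R.Conditions) :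
    (∃ sub : VarSat.Subroutines S F, sub.Correct R) ∧
    ∀ sub : VarSat.Subroutines S F, sub.Correct R →
      (∀ φ : VarSat.QF (VarSat.Eqn S F), R.IsFormula φ →
        (∀ GD ∈ VarSat.dnf true φ, ∀ D' ∈ VarSat.PredTheory.unifStep sub GD.1 GD.2,
          ∀ D'' ∈ R.elimStep sub D', ∀ e ∈ D'', R.deltaC.sig.IsEqn e) ∧
        (R.decideSat sub φ = true ↔ R.full.canon.Satisfiable φ)) ∧
      (sub.IsComputable → Computable R.part → Computable R.pats →
        Computable (R.decideSat sub)) :=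
  ⟨hR.exists_subroutines, fun _ hs =>
    ⟨fun _ hφ => ⟨fun _ hGD _ hD' _ hD'' => hR.elimStep_isEqn hs hφ hGD hD' hD'',
      hR.decideSat_iff hs hφ⟩, VarSat.PredTheory.computable_decideSat⟩⟩
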